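/- Let $\mathcal N\subset B(H)$ be a von Neumann algebra on a complex Hilbert space $H$ with a faithful normal semifinite trace $\tau$. For $A\in\mathcal N$ put $\mu(t,A)=\inf\{\|Ap\|: p\in\mathcal N \text{ a projection},\ \tau(1-p)\le t\}$, and let $$\mathcal M_{1,\infty}=\Big\{A\in\mathcal N:\ \sup_{t>0}\frac1{\log(1+t)}\int_0^t\mu(s,A)\,ds<\infty\Big\}.$$ Let $L_\infty(0,\infty)$ be the space of bounded Lebesgue measurable real functions on $(0,\infty)$. A generalised limit is a positive linear functional $\omega:L_\infty(0,\infty)\to\mathbb R$ with $\omega(1)=1$ and $\omega(z)=0$ whenever $z(t)\to0$ as $t\to\infty$; it is dilation invariant if $\omega(t\mapsto z(t/s))=\omega(z)$ for all $z\in L_\infty(0,\infty)$ and $s>0$; it is extended complex-linearly to complex-valued functions. Let $(Mz)(t)=\frac1{\log t}\int_1^t z(s)\frac{ds}{s}$, and write $(\omega\circ M)(z)=\omega(Mz)$ for every locally integrable $z$ on $(0,\infty)$ with $Mz$ bounded. For $B\in\mathcal N$, a function $f$ on $[0,\infty)$ and a positive $A\in\mathcal M_{1,\infty}$ put $$\xi_{\omega,B,f}(A)=(\omega\circ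 M)\Big(t\mapsto\frac1t\,\tau(f(tA)B)\Big),$$ and for arbitrary $A\in\mathcal M_{1,\infty}$ put $$\xi_{\omega,B,f}(A)=\xi_{\omega,B,f}((\Re A)_+)-\xi_{\omega,B,f}((\Re A)_-)+i\big(\xi_{\omega,B,f}((\Im A)_+)-\xi_{\omega,B,f}((\Im A)_-)\big).$$ Fix $q>0$ and let $\xi_\omega=\xi_{\omega,1,g}$ with $g(x)=\exp(-x^{-q})$ for $x>0$ and $g(0)=0$; thus $\xi_\omega(A)=(\omega\circ M)\big(t\mapsto\frac1t\tau(\exp(-(tA)^{-q}))\big)$ for positive $A\in\mathcal M_{1,\infty}$. Theorem. Let $f\in C^2[0,\infty)$ be a bounded real function with $f(0)=f'(0)=0$, let $A\in\mathcal M_{1,\infty}$ and $B\in\mathcal N$, and let $\omega$ be any dilation invariant generalised limit. Then $AB\in\mathcal M_{1,\infty}$, the integral $\int_0^\infty f(s)s^{-2}\,ds$ converges absolutely, $\xi_{\omega,B,f}(A)$ and $\xi_\omega(AB)$ are well defined (on each of the positive operators that occur, the operators under $\tau$ are trace class, and the function to which $M$ is applied is locally integrable with bounded image under $M$), and $$\xi_{\omega,B,f}(A)=\frac1{\Gamma(1+1/q)}\Big(\int_0^\infty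 f(s)\frac{ds}{s^2}\Big)\,\xi_\omega(AB).$$ -/

import Mathlib

open Set Filter Topology MeasureTheory
open scoped ENNReal ComplexStarModule

noncomputable section

namespace NCHeat

/-! ### Bounded functions on the half-line and generalised limits -/

/-- The half-line `(0,∞)`. -/
abbrev HalfLine : Type := Ioi (0 : ℝ)

/-- Lebesgue measure on `(0,∞)`. -/
def lebesgue : Measure HalfLine := Measure.comap (fun t : HalfLine => (t : ℝ)) volume

/-- `L_∞(0,∞)`: the real vector space of all bounded Lebesgue measurable real functions on `(0,∞)`
(`AEMeasurable` with respect to Lebesgue measure is Lebesgue measurability). -/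
def LInfty : Submodule ℝ (HalfLine → ℝ) where
  carrier := {x | AEMeasurable x lebesgue ∧ ∃ C : ℝ, ∀ t, |x t| ≤ C}
  add_mem' := by
    rintro x y ⟨hx, C, hC⟩ ⟨hy, D, hD⟩
    exact ⟨hx.add hy, C + D, fun t => (abs_add_le _ _).trans (add_le_add (hC t) (hD t))⟩
  zero_mem' := ⟨aemeasurable_const, 0, fun t => by simp⟩
  smul_mem' := by
    rintro c x ⟨hx, C, hC⟩
    refine ⟨hx.const_smul c, |c| * C, fun t => ?_⟩
    simpa [abs_mul] using mul_le_mul_of_nonneg_left (hC t) (abs_nonneg c)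

/-- The constant function `1`. -/
def LInfty.one : LInfty := ⟨fun _ => 1, aemeasurable_const, 1, fun _ => by simp⟩

/-- The map `t ↦ t / s` of the half-line, for `s > 0`. -/
def scale (s t : HalfLine) : HalfLine := ⟨(t : ℝ) / s, mem_Ioi.2 (div_pos (mem_Ioi.1 t.2) (mem_Ioi.1 s.2))⟩

theorem quasiMeasurePreserving_scale (s : HalfLine) :
    Measure.QuasiMeasurePreserving (scale s) lebesgue lebesgue := by
  have hm : Measurable (scale s) := (measurable_subtype_coe.div_const _).subtype_mk
  refine ⟨hm, Measure.AbsolutelyContinuous.mk fun S hS h0 => ?_⟩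
  have hemb := MeasurableEmbedding.subtype_coe (measurableSet_Ioi (a := (0 : ℝ)))
  rw [Measure.map_apply hm hS]
  have key : ∀ T : Set HalfLine, lebesgue T = volume ((↑) '' T : Set ℝ) := fun T =>
    (hemb.comap_apply volume T)
  rw [key] at h0 ⊢
  have hsub : ((↑) '' (scale s ⁻¹' S) : Set ℝ) ⊆ (fun r : ℝ => r / (s : ℝ)) ⁻¹' ((↑) '' S) := by
    rintro _ ⟨t, ht, rfl⟩
    exact ⟨scale s t, ht, rfl⟩
  refine measure_mono_null hsub ?_
  have hs : ((s : ℝ)⁻¹) ≠ 0 := inv_ne_zero (ne_of_gt (mem_Ioi.1 s.2))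
  have := Real.volume_preimage_mul_right hs ((↑) '' S : Set ℝ)
  simp only [div_eq_mul_inv]
  rw [this, h0, mul_zero]

/-- The dilation `(σ_s x)(t) = x(t / s)` on `L_∞(0,∞)`, for `s > 0`. -/
def dilation (s : HalfLine) (x : LInfty) : LInfty :=
  ⟨fun t => x.1 (scale s t), x.2.1.comp_quasiMeasurePreserving (quasiMeasurePreserving_scale s),
    x.2.2.imp fun _ h t => h (scale s t)⟩

/-- A generalised limit: a positive normalised linear functional on `L_∞(0,∞)` that vanishes on
every function tending to `0` at `∞`. -/
structure IsGeneralisedLimit (ω : LInfty →ₗ[ℝ] ℝ) : Prop where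
  nonneg : ∀ x : LInfty, (∀ t, 0 ≤ x.1 t) → 0 ≤ ω x
  one : ω LInfty.one = 1
  vanish : ∀ x : LInfty, Tendsto x.1 atTop (𝓝 0) → ω x = 0

/-- Dilation invariance of a linear functional on `L_∞(0,∞)`. -/
def IsDilationInvariant (ω : LInfty →ₗ[ℝ] ℝ) : Prop :=
  ∀ (s : HalfLine) (x : LInfty), ω (dilation s x) = ω x

/-- The function on `(0,∞)` given by `u` belongs to `L_∞(0,∞)`. -/
def MemLInfty (u : ℝ → ℝ) : Prop := (fun t : HalfLine => u t) ∈ LInfty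

open Classical in
/-- The value of `ω` at the function `u|_(0,∞)`; the value `0` is used outside `L_∞(0,∞)`. -/
def evalAt (ω : LInfty →ₗ[ℝ] ℝ) (u : ℝ → ℝ) : ℝ :=
  if h : MemLInfty u then ω ⟨fun t : HalfLine => u t, h⟩ else 0

/-- The complex-linear extension of `ω` to complex-valued functions. -/
def evalComplex (ω : LInfty →ₗ[ℝ] ℝ) (z : ℝ → ℂ) : ℂ :=
  (evalAt ω fun t => (z t).re : ℂ) + Complex.I * (evalAt ω fun t => (z t).im : ℂ)

/-- The Cesàro operator `(Mz)(t) = (1 / log t) ∫_1^t z(s) ds/s`. -/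
def cesaro (z : ℝ → ℂ) (t : ℝ) : ℂ :=
  ((Real.log t)⁻¹ : ℂ) * ∫ s in (1 : ℝ)..t, z s / (s : ℂ)

/-- `z` is locally integrable on `(0,∞)` and `Mz` is a bounded measurable function, so that
`(ω ∘ M)(z)` is meaningful. -/
structure CesaroBounded (z : ℝ → ℂ) : Prop where
  locallyIntegrable : LocallyIntegrableOn z (Ioi 0) volume
  re_mem : MemLInfty fun t => (cesaro z t).re
  im_mem : MemLInfty fun t => (cesaro z t).im

/-- `(ω ∘ M)(z)`. -/
def evalCesaro (ω : LInfty →ₗ[ℝ] ℝ) (z : ℝ → ℂ) : ℂ := evalComplex ω (cesaro z)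

/-! ### Operators, traces and the ideal `𝓜_{1,∞}` -/

variable {H : Type*} [NormedAddCommGroup H] [InnerProductSpace ℂ H] [CompleteSpace H]

/-- The four positive operators `(Re A)₊, (Re A)₋, (Im A)₊, (Im A)₋` of the Jordan
decomposition of `A`. -/
def jordanParts (A : H →L[ℂ] H) : Set (H →L[ℂ] H) :=
  {(ℜ A : H →L[ℂ] H)⁺, (ℜ A : H →L[ℂ] H)⁻, (ℑ A : H →L[ℂ] H)⁺, (ℑ A : H →L[ℂ] H)⁻}

/-- The extension of a functional `φ`, given on positive operators, by the formula
`φ(A) = φ((Re A)₊) - φ((Re A)₋) + i (φ((Im A)₊) - φ((Im A)₋))`. -/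
def jordanExtend (φ : (H →L[ℂ] H) → ℂ) (A : H →L[ℂ] H) : ℂ :=
  (φ ((ℜ A : H →L[ℂ] H)⁺) - φ ((ℜ A : H →L[ℂ] H)⁻)) +
    Complex.I * (φ ((ℑ A : H →L[ℂ] H)⁺) - φ ((ℑ A : H →L[ℂ] H)⁻))

/-- A faithful normal semifinite trace on the von Neumann algebra `N`. Only the values of `toFun`
on the positive elements of `N` carry meaning. -/
structure FNSTrace (N : VonNeumannAlgebra H) where
  toFun : (H →L[ℂ] H) → ℝ≥0∞
  map_add : ∀ S ∈ N, ∀ T ∈ N, 0 ≤ S → 0 ≤ T → toFun (S + T) = toFun S + toFun T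
  map_smul : ∀ c : ℝ, 0 ≤ c → ∀ T ∈ N, 0 ≤ T → toFun (c • T) = ENNReal.ofReal c * toFun T
  tracial : ∀ T ∈ N, toFun (star T * T) = toFun (T * star T)
  faithful : ∀ T ∈ N, 0 ≤ T → toFun T = 0 → T = 0
  normal : ∀ D : Set (H →L[ℂ] H), D.Nonempty → DirectedOn (· ≤ ·) D →
    (∀ S ∈ D, S ∈ N ∧ 0 ≤ S) → ∀ T ∈ N, IsLUB D T → toFun T = ⨆ S ∈ D, toFun S
  semifinite : ∀ T ∈ N, 0 ≤ T → T ≠ 0 → ∃ S ∈ N, 0 ≤ S ∧ S ≤ T ∧ S ≠ 0 ∧ toFun S < ∞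

variable {N : VonNeumannAlgebra H}

namespace FNSTrace

/-- `T ∈ N` with `τ(|T|) < ∞`. -/
def IsTraceClass (τ : FNSTrace N) (T : H →L[ℂ] H) : Prop := T ∈ N ∧ τ.toFun (CFC.abs T) < ∞

/-- The linear extension of `τ` to the trace class operators of `N`. -/
def tr (τ : FNSTrace N) (T : H →L[ℂ] H) : ℂ :=
  jordanExtend (fun P => ((τ.toFun P).toReal : ℂ)) T

/-- The generalised singular value function
`μ(t, A) = inf {‖Ap‖ : p a projection of N, τ(1 - p) ≤ t}`. -/
def singularValue (τ : FNSTrace N) (t : ℝ) (A : H →L[ℂ] H) : ℝ :=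
  sInf {r | ∃ p ∈ N, IsStarProjection p ∧ τ.toFun (1 - p) ≤ ENNReal.ofReal t ∧ r = ‖A * p‖}

/-- The Marcinkiewicz (Dixmier) ideal `𝓜_{1,∞}`: all `A ∈ N` with
`sup_{t>0} (1 / log(1+t)) ∫_0^t μ(s, A) ds < ∞`. -/
def dixmierIdeal (τ : FNSTrace N) : Set (H →L[ℂ] H) :=
  {A | A ∈ N ∧ ∃ C : ℝ, ∀ t : ℝ, 0 < t →
    (Real.log (1 + t))⁻¹ * (∫ s in (0 : ℝ)..t, τ.singularValue s A) ≤ C}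

/-- The function `t ↦ (1/t) τ(f(tA)B)`, for `A ≥ 0`, with `f(tA)` given by functional calculus. -/
def heat (τ : FNSTrace N) (f : ℝ → ℝ) (B A : H →L[ℂ] H) (t : ℝ) : ℂ :=
  (t : ℂ)⁻¹ * τ.tr (cfc f (t • A) * B)

/-- For the positive operator `A`, all the `f(tA)B` are trace class and the function
`M(t ↦ (1/t) τ(f(tA)B))` is bounded. -/
structure HeatAdmissible (τ : FNSTrace N) (f : ℝ → ℝ) (B A : H →L[ℂ] H) : Prop where
  mem : A ∈ τ.dixmierIdeal
  traceClass : ∀ t : ℝ, 0 < t → τ.IsTraceClass (cfc f (t • A) * B)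
  bounded : CesaroBounded (τ.heat f B A)

/-- `ξ_{ω,B,f}`: on positive operators it is `(ω ∘ M)(t ↦ (1/t) τ(f(tA)B))`, and it is extended
through the Jordan decomposition. -/
def xiGen (τ : FNSTrace N) (ω : LInfty →ₗ[ℝ] ℝ) (B : H →L[ℂ] H) (f : ℝ → ℝ)
    (A : H →L[ℂ] H) : ℂ :=
  jordanExtend (fun P => evalCesaro ω (τ.heat f B P)) A

end FNSTrace

/-- The function `x ↦ exp(-x^{-q})` on `[0,∞)`, equal to `0` at `0`. -/
def expInv (q : ℝ) (x : ℝ) : ℝ := if x ≤ 0 then 0 else Real.exp (-(x ^ (-q)))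

/-- `ξ_ω`: on positive operators it is `(ω ∘ M)(t ↦ (1/t) τ(exp(-(tA)^{-q})))`, and it is extended
through the Jordan decomposition. -/
def FNSTrace.xi (τ : FNSTrace N) (q : ℝ) (ω : LInfty →ₗ[ℝ] ℝ) (A : H →L[ℂ] H) : ℂ :=
  τ.xiGen ω 1 (expInv q) A

end NCHeat

end

open NCHeat

noncomputable section

namespace NCHeat

variable {H : Type*} [NormedAddCommGroup H] [InnerProductSpace ℂ H] [CompleteSpace H]

/-! ### Functional calculus and kernel projections in a von Neumann algebra -/

section VonNeumann

variable {N : VonNeumannAlgebra H} {P Q : H →L[ℂ] H}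

/-! Everything is measured through the soft threshold (P - 1/T)₊ of a positive operator. A positive
P lies in the ideal exactly when τ((P - 1/T)₊) = O(log(2 + T)) (`logBounded_abs`,
`mem_dixmierIdeal_of_logBounded_abs`), and the Dixmier functional φ(P) is the generalised limit of
τ((P - 1/T)₊)/log(2 + T). Thresholded traces are subadditive and, up to a change of threshold,
superadditive and tracial (`softThr_add_le`, `softThr_add_ge`, `softThr_star_mul_self_le`). Dilation
invariance of ω absorbs the changes of threshold, so φ is additive and tracial on the cone, and it
extends linearly, independently of the decomposition used (`jordan_sub`).

For fixed C in N one also has the localised functional ψ_C(P), the limit of τ(C*(P - 1/T)₊C)/log(2 +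
T). The crucial identity is φ(C*PC) = ψ_C(P) (`dixmier_conj`). For a contraction C, "≤" is a trace
inequality; with D = (1 - CC*)^{1/2} the two left sides, for C and for D, and the two right sides
both add up to φ(P), so both inequalities are equalities.

On the heat side write f(x) = x²k(x) with k continuous and O(min(1, x⁻²)). The Riesz representation
theorem gives a finite measure m with τ(C*Pk(P)PC) = ∫ k dm, and then (1/t)τ(C*f(tP)C) = ∫ t k(tx)
dm(x). Up to a constant, integrating against ds/s from 1 to T replaces k by its mean y ↦ ∫₀¹ k(uy)
du. This mean differs from c(y - 1)₊/y², where c = ∫₀^∞ k = ∫₀^∞ f(s)s⁻² ds, by O(min(1, y⁻²))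
(`meanProfile_estimates`). Such an error has limit zero: its n dyadic dilates all have the same
limit, while their sum is bounded independently of n (`logLim_dilInt_eq_zero`). The profile (y -
1)₊/y² reproduces exactly τ(C*(P - 1/T)₊C). Hence the Cesàro limit is cψ_C(P) = cφ(C*PC).

Polarisation passes from C*·C to multiplication by B, and linearity from the Jordan parts of A to A
itself, so ξ_{ω,B,f}(A) = cφ(AB). The same formula for AB, the unit and exp(-x^{-q}), whose constant
is Γ(1 + 1/q), gives the theorem. -/

theorem mem_of_commute (hP : P ∈ N) (h : ∀ y, Commute P y → Commute Q y) : Q ∈ N := by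
  rw [← N.commutant_commutant, VonNeumannAlgebra.mem_commutant_iff]
  intro g hg
  have hc : P * g = g * P := VonNeumannAlgebra.mem_commutant_iff.1 hg P hP
  exact (h g hc).symm

theorem cfc_mem (hP : P ∈ N) (f : ℝ → ℝ) : cfc f P ∈ N :=
  mem_of_commute hP fun _ hy => hy.cfc_real f

theorem posPart_mem (hP : P ∈ N) : P⁺ ∈ N :=
  mem_of_commute hP fun _ hy => by rw [CFC.posPart_def]; exact hy.cfcₙ_real _

theorem sqrt_mem (hP : P ∈ N) : CFC.sqrt P ∈ N :=
  mem_of_commute hP fun _ hy => by rw [CFC.sqrt]; exact hy.cfcₙ_nnreal _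

theorem abs_mem (hP : P ∈ N) : CFC.abs P ∈ N := sqrt_mem (mul_mem (star_mem hP) hP)

theorem csmul_mem (c : ℂ) (hP : P ∈ N) : c • P ∈ N :=
  N.toStarSubalgebra.smul_mem hP c

theorem rsmul_mem (c : ℝ) (hP : P ∈ N) : c • P ∈ N := by
  have : c • P = (c : ℂ) • P := by ext; simp
  rw [this]; exact csmul_mem _ hP

theorem realPart_mem (hP : P ∈ N) : (ℜ P : H →L[ℂ] H) ∈ N := by
  rw [realPart_apply_coe]
  exact rsmul_mem _ (add_mem hP (star_mem hP))

/-- The orthogonal projection onto the kernel of an operator. -/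
def kerProj (R : H →L[ℂ] H) : H →L[ℂ] H := R.ker.starProjection

theorem isStarProjection_kerProj (R : H →L[ℂ] H) : IsStarProjection (kerProj R) :=
  isStarProjection_starProjection

theorem mul_kerProj (R : H →L[ℂ] H) : R * kerProj R = 0 := by
  ext x
  exact LinearMap.mem_ker.1 (Submodule.starProjection_apply_mem R.ker x)

theorem kerProj_mul {R Y : H →L[ℂ] H} (h : R * Y = 0) : kerProj R * Y = Y := by
  ext x
  have h2 : Y x ∈ R.ker := by
    have := congrArg (fun T : H →L[ℂ] H => T x) h
    simpa using this
  simpa [kerProj] using Submodule.starProjection_eq_self_iff.2 h2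

/-- The kernel of R is invariant under every operator commuting with R, in particular under the
commutant of N. -/
theorem kerProj_mem {R : H →L[ℂ] H} (hR : R ∈ N) : kerProj R ∈ N := by
  rw [VonNeumannAlgebra.IsStarProjection.mem_iff (isStarProjection_kerProj R)]
  intro y hy
  have hc : R * y = y * R := VonNeumannAlgebra.mem_commutant_iff.1 hy R hR
  rw [Module.End.mem_invtSubmodule]
  have hr : (kerProj R).range = R.ker := by simp [kerProj]
  rw [hr]
  intro x hx
  have h1 := congrArg (fun T : H →L[ℂ] H => T x) hc
  simp only [mul_apply_eq_comp] at h1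
  have hx' : R x = 0 := by simpa using hx
  rw [hx', map_zero] at h1
  simpa using h1

end VonNeumann

/-! ### Order and functional calculus -/

section Order

theorem isSelfAdjoint_of_nonneg {P : H →L[ℂ] H} (h : 0 ≤ P) : IsSelfAdjoint P :=
  IsSelfAdjoint.of_nonneg h

theorem algebraMap_eq_smul (r : ℝ) : algebraMap ℝ (H →L[ℂ] H) r = r • 1 :=
  Algebra.algebraMap_eq_smul_one r

theorem conj_nonneg' {P : H →L[ℂ] H} (h : 0 ≤ P) (K : H →L[ℂ] H) : 0 ≤ star K * P * K :=
  star_left_conjugate_nonneg h K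

theorem conj_mono {P Q : H →L[ℂ] H} (h : P ≤ Q) (K : H →L[ℂ] H) :
    star K * P * K ≤ star K * Q * K :=
  star_left_conjugate_le_conjugate h K

theorem star_mul_self_le_one {K : H →L[ℂ] H} (h : ‖K‖ ≤ 1) : star K * K ≤ 1 := by
  refine CStarAlgebra.star_mul_le_algebraMap_norm_sq.trans ?_
  rw [← map_one (algebraMap ℝ (H →L[ℂ] H))]
  exact algebraMap_mono _ (pow_le_one₀ (norm_nonneg _) h)

theorem self_mul_star_le_one {K : H →L[ℂ] H} (h : ‖K‖ ≤ 1) : K * star K ≤ 1 := by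
  simpa using star_mul_self_le_one (K := star K) (by simpa using h)

theorem norm_le_one_of_star_mul_self_le_one {K : H →L[ℂ] H} (h : star K * K ≤ 1) : ‖K‖ ≤ 1 := by
  have h1 : ‖star K * K‖ ≤ 1 :=
    (CStarAlgebra.norm_le_one_iff_of_nonneg _ (star_mul_self_nonneg K)).2 h
  rw [CStarRing.norm_star_mul_self] at h1
  nlinarith [norm_nonneg K]

theorem le_norm_of_mem_spectrum {P : H →L[ℂ] H} {x : ℝ} (hx : x ∈ spectrum ℝ P) : x ≤ ‖P‖ := by
  have h1 := spectrum.norm_le_norm_mul_of_mem hx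
  have h2 : ‖(1 : H →L[ℂ] H)‖ ≤ 1 := ContinuousLinearMap.norm_id_le
  exact (le_abs_self x).trans (h1.trans (mul_le_of_le_one_right (norm_nonneg _) h2))

/-- The soft threshold `(P - ε)₊`. -/
def softThr (P : H →L[ℂ] H) (ε : ℝ) : H →L[ℂ] H := (P - ε • (1 : H →L[ℂ] H))⁺

theorem isSelfAdjoint_sub_smul_one {P : H →L[ℂ] H} (hP : IsSelfAdjoint P) (ε : ℝ) :
    IsSelfAdjoint (P - ε • (1 : H →L[ℂ] H)) :=
  hP.sub (by rw [← algebraMap_eq_smul]; exact IsSelfAdjoint.algebraMap _ (.all ε))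

theorem posPart_eq_cfc (P : H →L[ℂ] H) : P⁺ = cfc (fun x : ℝ => max x 0) P := by
  rw [CFC.posPart_def, cfcₙ_eq_cfc]
  rfl

theorem cfc_sub_const {P : H →L[ℂ] H} (hP : IsSelfAdjoint P) (ε : ℝ) :
    cfc (fun x : ℝ => x - ε) P = P - ε • (1 : H →L[ℂ] H) := by
  rw [cfc_sub (fun x : ℝ => x) (fun _ => ε) P, cfc_id' ℝ P, cfc_const ε P, algebraMap_eq_smul]

theorem softThr_eq_cfc {P : H →L[ℂ] H} (hP : IsSelfAdjoint P) (ε : ℝ) :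
    softThr P ε = cfc (fun x : ℝ => max (x - ε) 0) P := by
  rw [softThr, posPart_eq_cfc, ← cfc_sub_const hP,
    ← cfc_comp (fun x : ℝ => max x 0) (fun x => x - ε) P]
  rfl

theorem softThr_nonneg (P : H →L[ℂ] H) (ε : ℝ) : 0 ≤ softThr P ε := CFC.posPart_nonneg _

theorem softThr_mem {N : VonNeumannAlgebra H} {P : H →L[ℂ] H} (hP : P ∈ N) (ε : ℝ) :
    softThr P ε ∈ N :=
  posPart_mem (sub_mem hP (rsmul_mem _ (one_mem N)))

theorem sub_smul_one_le_softThr {P : H →L[ℂ] H} (hP : IsSelfAdjoint P) (ε : ℝ) :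
    P - ε • (1 : H →L[ℂ] H) ≤ softThr P ε :=
  CFC.le_posPart (isSelfAdjoint_sub_smul_one hP ε)

theorem softThr_anti {P : H →L[ℂ] H} (hP : IsSelfAdjoint P) {δ ε : ℝ} (h : δ ≤ ε) :
    softThr P ε ≤ softThr P δ := by
  rw [softThr_eq_cfc hP, softThr_eq_cfc hP]
  exact cfc_mono fun x _ => max_le_max (by linarith) le_rfl

theorem softThr_zero {P : H →L[ℂ] H} (hP : 0 ≤ P) : softThr P 0 = P := by
  rw [softThr, zero_smul, sub_zero, CFC.posPart_eq_self P |>.2 hP]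

theorem softThr_le {P : H →L[ℂ] H} (hP : 0 ≤ P) {ε : ℝ} (h : 0 ≤ ε) : softThr P ε ≤ P := by
  simpa only [softThr_zero hP] using softThr_anti (isSelfAdjoint_of_nonneg hP) h

theorem softThr_posPart {P : H →L[ℂ] H} (hP : IsSelfAdjoint P) {ε : ℝ} (h : 0 ≤ ε) :
    softThr P⁺ ε = softThr P ε := by
  rw [softThr_eq_cfc (isSelfAdjoint_of_nonneg (CFC.posPart_nonneg P)), softThr_eq_cfc hP,
    posPart_eq_cfc, ← cfc_comp (fun x : ℝ => max (x - ε) 0) (fun x => max x 0) P]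
  refine cfc_congr fun x _ => ?_
  simp only [Function.comp]
  rcases le_total x 0 with hx | hx
  · rw [max_eq_right hx, max_eq_right (by linarith), max_eq_right (by linarith)]
  · rw [max_eq_left hx]

theorem softThr_smul (P : H →L[ℂ] H) {c : ℝ} (hc : 0 ≤ c) (ε : ℝ) :
    softThr (c • P) (c * ε) = c • softThr P ε := by
  rw [softThr, softThr, ← CFC.posPart_smul_of_nonneg hc, smul_sub, smul_smul]

end Order

/-! ### The approximate polar decomposition -/

/-- K = Z(|Z| + δ)⁻¹ replaces the partial isometry of the polar decomposition. It comes from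
continuous functional calculus alone, and the conclusions reduce to scalar relations on the spectrum
of |Z|, with errors controlled by δ. -/
theorem exists_approx_polar {N : VonNeumannAlgebra H} {Z : H →L[ℂ] H} (hZ : Z ∈ N) {δ : ℝ}
    (hδ : 0 < δ) : ∃ K ∈ N, ‖K‖ ≤ 1 ∧ CFC.abs Z - δ • (1 : H →L[ℂ] H) ≤ star K * Z ∧
      IsSelfAdjoint (star K * Z) ∧ Z = K * CFC.abs Z + δ • K ∧
      star Z * Z - (2 * δ * ‖Z‖) • (1 : H →L[ℂ] H) ≤ star K * (Z * star Z) * K := by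
  set Q := CFC.abs Z with hQ
  have hQ0 : 0 ≤ Q := CFC.abs_nonneg Z
  have hQs : IsSelfAdjoint Q := isSelfAdjoint_of_nonneg hQ0
  have hsp : ∀ x ∈ spectrum ℝ Q, 0 ≤ x := fun x hx => spectrum_nonneg_of_nonneg hQ0 hx
  have hQQ : star Z * Z = Q * Q := (CFC.abs_mul_abs Z).symm
  set c := cfc (fun x : ℝ => (x + δ)⁻¹) Q with hc
  have hcont : ContinuousOn (fun x : ℝ => (x + δ)⁻¹) (spectrum ℝ Q) := by
    refine ContinuousOn.inv₀ (by fun_prop) fun x hx => ?_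
    have := hsp x hx
    positivity
  have hcs : star c = c := (IsSelfAdjoint.cfc (f := fun x : ℝ => (x + δ)⁻¹) (a := Q)).star_eq
  have hQid : Q = cfc (fun x : ℝ => x) Q := (cfc_id' ℝ Q).symm
  have hsq : Q * Q = cfc (fun x : ℝ => x * x) Q := by
    rw [cfc_mul (fun x : ℝ => x) (fun x => x) Q, ← hQid]
  have hcsq : ContinuousOn (fun x : ℝ => x * x) (spectrum ℝ Q) := by fun_prop
  have hc1 : ContinuousOn (fun x : ℝ => (x + δ)⁻¹ * (x * x)) (spectrum ℝ Q) := hcont.mul hcsq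
  have e1 : c * (Q * Q) = cfc (fun x : ℝ => (x + δ)⁻¹ * (x * x)) Q := by
    rw [hsq]; exact (cfc_mul _ _ Q hcont hcsq).symm
  have e2 : c * (Q * Q) * c = cfc (fun x : ℝ => (x + δ)⁻¹ * (x * x) * (x + δ)⁻¹) Q := by
    rw [e1]; exact (cfc_mul _ _ Q hc1 hcont).symm
  have e3 : c * (Q * Q) * (Q * Q) * c
      = cfc (fun x : ℝ => (x + δ)⁻¹ * (x * x) * (x * x) * (x + δ)⁻¹) Q := by
    rw [e1, hsq, ← cfc_mul _ _ Q hc1 hcsq]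
    exact (cfc_mul _ _ Q (hc1.mul hcsq) hcont).symm
  have e4 : c * (Q + δ • 1) = 1 := by
    have : Q + δ • (1 : H →L[ℂ] H) = cfc (fun x : ℝ => x + δ) Q := by
      rw [cfc_add Q (fun x : ℝ => x) (fun _ => δ), cfc_const δ Q, ← hQid, algebraMap_eq_smul]
    rw [this, hc, ← cfc_mul _ _ Q hcont (by fun_prop), ← cfc_one ℝ Q]
    refine cfc_congr fun x hx => ?_
    have := hsp x hx
    have : x + δ ≠ 0 := by positivity
    simp [this]
  refine ⟨Z * c, mul_mem hZ (cfc_mem (abs_mem hZ) _), ?_, ?_, ?_, ?_, ?_⟩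
  · apply norm_le_one_of_star_mul_self_le_one
    rw [star_mul, hcs, mul_assoc, ← mul_assoc (star Z), hQQ, ← mul_assoc, e2, ← cfc_one ℝ Q]
    refine cfc_mono (fun x hx => ?_) (hc1.mul hcont) continuousOn_const
    have h0 := hsp x hx
    have : (x + δ)⁻¹ * (x * x) * (x + δ)⁻¹ = (x / (x + δ)) ^ 2 := by field_simp
    rw [this]
    exact pow_le_one₀ (by positivity) (div_le_one_of_le₀ (by linarith) (by linarith))
  · rw [star_mul, hcs, mul_assoc, hQQ, e1, ← cfc_sub_const hQs]
    refine cfc_mono (fun x hx => ?_) (by fun_prop) hc1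
    have h0 := hsp x hx
    rw [← div_eq_inv_mul, le_div_iff₀ (by linarith)]
    nlinarith
  · rw [star_mul, hcs, mul_assoc, hQQ, e1]
    exact IsSelfAdjoint.cfc
  · rw [mul_assoc, ← mul_smul_comm, ← mul_add]
    have : c * Q + δ • c = 1 := by rw [← e4, mul_add, mul_smul_comm, mul_one]
    rw [this, mul_one]
  · have : star (Z * c) * (Z * star Z) * (Z * c) = c * (Q * Q) * (Q * Q) * c := by
      rw [star_mul, hcs, ← hQQ]; simp only [mul_assoc]
    rw [this, e3, hQQ]
    have h5 : Q * Q - (2 * δ * ‖Z‖) • (1 : H →L[ℂ] H)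
        = cfc (fun x : ℝ => x * x - 2 * δ * ‖Z‖) Q := by
      rw [cfc_sub (fun x : ℝ => x * x) (fun _ => 2 * δ * ‖Z‖) Q, ← hsq, cfc_const _ Q,
        algebraMap_eq_smul]
    rw [h5]
    refine cfc_mono (fun x hx => ?_) (by fun_prop) ((hc1.mul hcsq).mul hcont)
    have h0 := hsp x hx
    have hxn : x ≤ ‖Z‖ := by
      simpa [hQ] using le_norm_of_mem_spectrum hx
    have h6 : (x + δ)⁻¹ * (x * x) * (x * x) * (x + δ)⁻¹ = x ^ 4 / (x + δ) ^ 2 := by field_simp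
    rw [h6]
    -- After clearing the denominator the two sides differ by 3δ²x² + 2δ³x.
    have h7 : x * x - 2 * δ * x ≤ x ^ 4 / (x + δ) ^ 2 := by
      rw [le_div_iff₀ (by positivity)]
      nlinarith [mul_nonneg (mul_nonneg hδ.le hδ.le) (mul_nonneg h0 h0),
        mul_nonneg (mul_nonneg (mul_nonneg hδ.le hδ.le) hδ.le) h0]
    nlinarith

end NCHeat

namespace NCHeat

variable {H : Type*} [NormedAddCommGroup H] [InnerProductSpace ℂ H] [CompleteSpace H]

/-! ### Trace inequalities -/

theorem conj_sub_smul_one_le {P K : H →L[ℂ] H} (hP : IsSelfAdjoint P) (hK : ‖K‖ ≤ 1) {ε : ℝ}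
    (hε : 0 ≤ ε) :
    star K * P * K - ε • (1 : H →L[ℂ] H) ≤ star K * softThr P ε * K := by
  refine le_trans ?_ (conj_mono (sub_smul_one_le_softThr hP ε) K)
  rw [mul_sub, sub_mul, mul_smul_comm, mul_one, smul_mul_assoc]
  exact sub_le_sub_left (smul_le_smul_of_nonneg_left (star_mul_self_le_one hK) hε) _

/-- Expand (U* - W)* P (U* - W) ≥ 0: the operator form of 2 Re(uw) ≤ |u|² + |w|². -/
theorem realPart_mul_mul_le {P : H →L[ℂ] H} (hP : 0 ≤ P) (U W : H →L[ℂ] H) :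
    U * P * W + star (U * P * W) ≤ U * P * star U + star W * P * W := by
  have h := conj_nonneg' hP (star U - W)
  have hPs : star P = P := (isSelfAdjoint_of_nonneg hP).star_eq
  rw [← sub_nonneg]
  convert h using 1
  simp only [star_sub, star_star, star_mul, hPs, sub_mul, mul_sub, mul_assoc]
  abel

theorem realPart_smul_le {Z : H →L[ℂ] H} (hZ : ‖Z‖ ≤ 1) : (ℜ Z : H →L[ℂ] H) ≤ 1 := by
  refine (IsSelfAdjoint.le_algebraMap_norm_self (ℜ Z).2).trans ?_
  rw [← map_one (algebraMap ℝ (H →L[ℂ] H))]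
  exact algebraMap_mono _ ((realPart.norm_le Z).trans hZ)

namespace FNSTrace

variable {N : VonNeumannAlgebra H} (τ : FNSTrace N) {A C P Q S T X Y K : H →L[ℂ] H}

theorem map_zero : τ.toFun 0 = 0 := by
  simpa using τ.map_smul 0 le_rfl 0 (zero_mem N) le_rfl

theorem mono (hS : S ∈ N) (hT : T ∈ N) (h0 : 0 ≤ S) (h : S ≤ T) : τ.toFun S ≤ τ.toFun T := by
  have := τ.map_add S hS (T - S) (sub_mem hT hS) h0 (sub_nonneg.2 h)
  rw [add_sub_cancel] at this
  rw [this]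
  exact le_self_add

/-- The trace property for √Y K. It puts KK* between two fixed factors, where bounds on KK* and sums
over several K can be used. -/
theorem conj_eq (hY : Y ∈ N) (h0 : 0 ≤ Y) (hK : K ∈ N) :
    τ.toFun (star K * Y * K) = τ.toFun (CFC.sqrt Y * (K * star K) * CFC.sqrt Y) := by
  have hs : star (CFC.sqrt Y) = CFC.sqrt Y :=
    (isSelfAdjoint_of_nonneg (CFC.sqrt_nonneg Y)).star_eq
  have := τ.tracial (CFC.sqrt Y * K) (mul_mem (sqrt_mem hY) hK)
  rw [star_mul, hs] at this
  calc τ.toFun (star K * Y * K) = τ.toFun (star K * CFC.sqrt Y * (CFC.sqrt Y * K)) := by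
        congr 1
        nth_rw 1 [← CFC.sqrt_mul_sqrt_self Y h0]
        simp only [mul_assoc]
    _ = _ := by rw [this]; simp only [mul_assoc]

theorem sqrt_conj_le (hY : Y ∈ N) (h0 : 0 ≤ Y) (hK : K ∈ N) (hK0 : 0 ≤ K) {c : ℝ} (hc : 0 ≤ c)
    (h : K ≤ c • 1) :
    τ.toFun (CFC.sqrt Y * K * CFC.sqrt Y) ≤ ENNReal.ofReal c * τ.toFun Y := by
  have hs : star (CFC.sqrt Y) = CFC.sqrt Y :=
    (isSelfAdjoint_of_nonneg (CFC.sqrt_nonneg Y)).star_eq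
  have hsm := sqrt_mem hY
  rw [← τ.map_smul c hc Y hY h0]
  refine τ.mono (mul_mem (mul_mem hsm hK) hsm) (rsmul_mem _ hY) ?_ ?_
  · have := conj_nonneg' hK0 (CFC.sqrt Y)
    rwa [hs] at this
  · have := conj_mono h (CFC.sqrt Y)
    rwa [hs, mul_smul_comm, mul_one, smul_mul_assoc, CFC.sqrt_mul_sqrt_self Y h0] at this

theorem conj_le' (hY : Y ∈ N) (h0 : 0 ≤ Y) (hK : K ∈ N) :
    τ.toFun (star K * Y * K) ≤ ENNReal.ofReal (‖K‖ ^ 2) * τ.toFun Y := by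
  rw [τ.conj_eq hY h0 hK]
  refine τ.sqrt_conj_le hY h0 (mul_mem hK (star_mem hK)) (mul_star_self_nonneg K)
    (by positivity) ?_
  rw [← algebraMap_eq_smul]
  exact CStarAlgebra.mul_star_le_algebraMap_norm_sq

theorem conj_le (hY : Y ∈ N) (h0 : 0 ≤ Y) (hK : K ∈ N) (h : ‖K‖ ≤ 1) :
    τ.toFun (star K * Y * K) ≤ τ.toFun Y := by
  refine (τ.conj_le' hY h0 hK).trans ?_
  refine (mul_le_mul_left (ENNReal.ofReal_le_one.2 (pow_le_one₀ (norm_nonneg _) h)) _).trans ?_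
  rw [one_mul]

/-- X ≤ Y does not imply X⁺ ≤ Y for operators, but it does under the trace. If e is the complement
of the kernel projection of X⁺, then eXe = X⁺, so X⁺ ≤ eYe, and compression by e does not increase
the trace of Y. -/
theorem posPart_le (hX : X ∈ N) (hXs : IsSelfAdjoint X) (hY : Y ∈ N) (h0 : 0 ≤ Y) (h : X ≤ Y) :
    τ.toFun X⁺ ≤ τ.toFun Y := by
  set p := kerProj X⁺ with hp
  have hpN : p ∈ N := kerProj_mem (posPart_mem hX)
  have hpp := isStarProjection_kerProj X⁺
  have hps : star p = p := hpp.isSelfAdjoint.star_eq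
  set e := 1 - p with he
  have hep : IsStarProjection e := hpp.one_sub
  have heN : e ∈ N := sub_mem (one_mem N) hpN
  have hes : star e = e := hep.isSelfAdjoint.star_eq
  have h1 : X⁺ * e = X⁺ := by rw [he, mul_sub, mul_kerProj, mul_one, sub_zero]
  have hXp : star X⁺ = X⁺ := (isSelfAdjoint_of_nonneg (CFC.posPart_nonneg X)).star_eq
  have h2 : e * X⁻ = 0 := by
    rw [he, sub_mul, kerProj_mul (CFC.posPart_mul_negPart X), one_mul, sub_self]
  have h3 : e * X⁺ = X⁺ := by
    have := congrArg star h1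
    rwa [star_mul, hes, hXp] at this
  have h4 : star e * X * e = X⁺ := by
    nth_rw 1 [← CFC.posPart_sub_negPart X hXs]
    rw [hes, mul_sub e, h2, sub_zero, h3, h1]
  rw [← h4]
  calc τ.toFun (star e * X * e) ≤ τ.toFun (star e * Y * e) :=
        τ.mono (by rw [h4]; exact posPart_mem hX) (mul_mem (mul_mem (star_mem heN) hY) heN)
          (by rw [h4]; exact CFC.posPart_nonneg X) (conj_mono h e)
    _ ≤ τ.toFun Y := τ.conj_le hY h0 heN hep.norm_le

theorem softThr_le_of_le (hX : X ∈ N) (hXs : IsSelfAdjoint X) {ε : ℝ} (hY : Y ∈ N) (h0 : 0 ≤ Y)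
    (h : X - ε • (1 : H →L[ℂ] H) ≤ Y) : τ.toFun (softThr X ε) ≤ τ.toFun Y :=
  τ.posPart_le (sub_mem hX (rsmul_mem _ (one_mem N))) (isSelfAdjoint_sub_smul_one hXs ε) hY h0 h

/-- Normality of the trace: P is the least upper bound of its soft thresholds, since any upper bound
dominates P - ε for every ε > 0. -/
theorem le_of_softThr_le (hP : P ∈ N) (h0 : 0 ≤ P) {c : ℝ≥0∞}
    (h : ∀ ε : ℝ, 0 < ε → τ.toFun (softThr P ε) ≤ c) : τ.toFun P ≤ c := by
  have hPs := isSelfAdjoint_of_nonneg h0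
  have hlub : IsLUB (softThr P '' Ioi 0) P := by
    constructor
    · rintro _ ⟨ε, hε, rfl⟩
      exact softThr_le h0 (le_of_lt hε)
    · intro U hU
      have h1 : ∀ ε : ℝ, 0 < ε → P - ε • (1 : H →L[ℂ] H) ≤ U := fun ε hε =>
        (sub_smul_one_le_softThr hPs ε).trans (hU ⟨ε, hε, rfl⟩)
      have h2 : Tendsto (fun ε : ℝ => P - ε • (1 : H →L[ℂ] H)) (𝓝[>] 0) (𝓝 P) := by
        have : Tendsto (fun ε : ℝ => P - ε • (1 : H →L[ℂ] H)) (𝓝 0)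
            (𝓝 (P - (0 : ℝ) • (1 : H →L[ℂ] H))) := by
          apply Continuous.tendsto
          fun_prop
        rw [zero_smul, sub_zero] at this
        exact this.mono_left nhdsWithin_le_nhds
      exact le_of_tendsto h2 (eventually_nhdsWithin_of_forall h1)
  rw [τ.normal (softThr P '' Ioi 0) ⟨_, 1, mem_Ioi.2 one_pos, rfl⟩ ?_ ?_ P hP hlub]
  · refine iSup₂_le ?_
    rintro _ ⟨ε, hε, rfl⟩
    exact h ε hε
  · rintro _ ⟨a, ha, rfl⟩ _ ⟨b, hb, rfl⟩
    exact ⟨_, ⟨min a b, mem_Ioi.2 (lt_min ha hb), rfl⟩, softThr_anti hPs (min_le_left _ _),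
      softThr_anti hPs (min_le_right _ _)⟩
  · rintro _ ⟨ε, _, rfl⟩
    exact ⟨softThr_mem hP ε, softThr_nonneg P ε⟩

theorem softThr_mono (hX : X ∈ N) (hXs : IsSelfAdjoint X) (hY : Y ∈ N) (hYs : IsSelfAdjoint Y)
    (h : X ≤ Y) (ε : ℝ) : τ.toFun (softThr X ε) ≤ τ.toFun (softThr Y ε) :=
  τ.softThr_le_of_le hX hXs (softThr_mem hY ε) (softThr_nonneg _ _)
    ((sub_le_sub_right h _).trans (sub_smul_one_le_softThr hYs ε))

theorem softThr_add_le (hA : A ∈ N) (hAs : IsSelfAdjoint A) (hC : C ∈ N) (hCs : IsSelfAdjoint C)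
    (a b : ℝ) :
    τ.toFun (softThr (A + C) (a + b)) ≤ τ.toFun (softThr A a) + τ.toFun (softThr C b) := by
  rw [← τ.map_add _ (softThr_mem hA a) _ (softThr_mem hC b) (softThr_nonneg _ _)
    (softThr_nonneg _ _)]
  refine τ.softThr_le_of_le (add_mem hA hC) (hAs.add hCs)
    (add_mem (softThr_mem hA a) (softThr_mem hC b))
    (add_nonneg (softThr_nonneg _ _) (softThr_nonneg _ _)) ?_
  rw [add_smul, add_sub_add_comm]
  exact add_le_add (sub_smul_one_le_softThr hAs a) (sub_smul_one_le_softThr hCs b)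

theorem softThr_conj_le (hP : P ∈ N) (hPs : IsSelfAdjoint P) (hK : K ∈ N) (h : ‖K‖ ≤ 1) {ε : ℝ}
    (hε : 0 ≤ ε) :
    τ.toFun (softThr (star K * P * K) ε) ≤ τ.toFun (star K * softThr P ε * K) :=
  τ.softThr_le_of_le (mul_mem (mul_mem (star_mem hK) hP) hK) (hPs.conjugate' K)
    (mul_mem (mul_mem (star_mem hK) (softThr_mem hP ε)) hK)
    (conj_nonneg' (softThr_nonneg _ _) K) (conj_sub_smul_one_le hPs h hε)

/-- With S = A + C and c = (S + δ)^{-1/2}, each B among A, C equals u*(S + δ)u for the contraction u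
= c√B. Thresholding under the conjugation bounds its trace by τ(√R cBc √R), where R = (S - (ε -
δ))₊. These bounds add up to τ(√R cSc √R), which is at most τ(R) because cSc ≤ 1. -/
theorem softThr_add_ge (hA : A ∈ N) (hA0 : 0 ≤ A) (hC : C ∈ N) (hC0 : 0 ≤ C) {δ ε : ℝ}
    (hδ : 0 < δ) (hε : 0 ≤ ε) :
    τ.toFun (softThr A ε) + τ.toFun (softThr C ε) ≤ τ.toFun (softThr (A + C) (ε - δ)) := by
  set S := A + C with hS
  have hS0 : 0 ≤ S := add_nonneg hA0 hC0
  have hSN : S ∈ N := add_mem hA hC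
  have hSs := isSelfAdjoint_of_nonneg hS0
  have hsp : ∀ x ∈ spectrum ℝ S, 0 ≤ x := fun x hx => spectrum_nonneg_of_nonneg hS0 hx
  set c := cfc (fun x : ℝ => (√(x + δ))⁻¹) S with hc
  have hcont : ContinuousOn (fun x : ℝ => (√(x + δ))⁻¹) (spectrum ℝ S) := by
    refine ContinuousOn.inv₀ (by fun_prop) fun x hx => ?_
    have := hsp x hx
    positivity
  have hcs : star c = c := (IsSelfAdjoint.cfc (f := fun x : ℝ => (√(x + δ))⁻¹) (a := S)).star_eq
  have hcN : c ∈ N := cfc_mem hSN _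
  have hSid : S = cfc (fun x : ℝ => x) S := (cfc_id' ℝ S).symm
  have hcSc : c * S * c ≤ 1 := by
    have e : c * S * c = cfc (fun x : ℝ => (√(x + δ))⁻¹ * x * (√(x + δ))⁻¹) S := by
      rw [cfc_mul (fun x : ℝ => (√(x + δ))⁻¹ * x) _ S (hcont.mul continuousOn_id) hcont,
        cfc_mul _ (fun x : ℝ => x) S hcont continuousOn_id, ← hSid]
    rw [e, ← cfc_one ℝ S]
    refine cfc_mono (fun x hx => ?_) ((hcont.mul continuousOn_id).mul hcont) continuousOn_const
    have h0 := hsp x hx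
    have h1 : (√(x + δ))⁻¹ * x * (√(x + δ))⁻¹ = x / (x + δ) := by
      have h2 : √(x + δ) * √(x + δ) = x + δ := Real.mul_self_sqrt (by linarith)
      calc (√(x + δ))⁻¹ * x * (√(x + δ))⁻¹ = x / (√(x + δ) * √(x + δ)) := by
            rw [div_eq_mul_inv, mul_inv]; ring
        _ = _ := by rw [h2]
    rw [h1]
    exact div_le_one_of_le₀ (by linarith) (by linarith)
  have hcc : c * (S + δ • 1) * c = 1 := by
    have e0 : S + δ • (1 : H →L[ℂ] H) = cfc (fun x : ℝ => x + δ) S := by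
      rw [cfc_add S (fun x : ℝ => x) (fun _ => δ), cfc_const δ S, ← hSid, algebraMap_eq_smul]
    have hcx : ContinuousOn (fun x : ℝ => x + δ) (spectrum ℝ S) := by fun_prop
    rw [e0, hc, ← cfc_mul _ _ S hcont hcx, ← cfc_mul (fun x : ℝ => (√(x + δ))⁻¹ * (x + δ)) _ S (hcont.mul hcx) hcont, ← cfc_one ℝ S]
    refine cfc_congr fun x hx => ?_
    have h0 := hsp x hx
    have h2 : √(x + δ) * √(x + δ) = x + δ := Real.mul_self_sqrt (by linarith)
    have h3 : √(x + δ) ≠ 0 := by positivity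
    have h4 : (√(x + δ))⁻¹ * (√(x + δ) * √(x + δ)) * (√(x + δ))⁻¹ = 1 := by field_simp
    rwa [h2] at h4
  set R := softThr S (ε - δ) with hR
  have hRN : R ∈ N := softThr_mem hSN _
  have hR0 : 0 ≤ R := softThr_nonneg _ _
  have key : ∀ B ∈ N, 0 ≤ B → B ≤ S → τ.toFun (softThr B ε)
      ≤ τ.toFun (CFC.sqrt R * (c * B * c) * CFC.sqrt R) := by
    intro B hB hB0 hBS
    have hs : star (CFC.sqrt B) = CFC.sqrt B :=
      (isSelfAdjoint_of_nonneg (CFC.sqrt_nonneg B)).star_eq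
    have hss := CFC.sqrt_mul_sqrt_self B hB0
    set u := c * CFC.sqrt B with hu
    have huN : u ∈ N := mul_mem hcN (sqrt_mem hB)
    have hus : star u = CFC.sqrt B * c := by rw [hu, star_mul, hs, hcs]
    have huu : u * star u = c * B * c := by
      rw [hus, hu, mul_assoc, ← mul_assoc (CFC.sqrt B), hss, mul_assoc]
    have hun : ‖u‖ ≤ 1 := by
      rw [← norm_star]
      apply norm_le_one_of_star_mul_self_le_one
      rw [star_star, huu]
      have h1 := conj_mono hBS c
      rw [hcs] at h1
      exact h1.trans hcSc
    have hBu : star u * (S + δ • 1) * u = B := by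
      rw [hus, hu]
      calc CFC.sqrt B * c * (S + δ • 1) * (c * CFC.sqrt B)
          = CFC.sqrt B * (c * (S + δ • 1) * c) * CFC.sqrt B := by simp only [mul_assoc]
        _ = B := by rw [hcc, mul_one, hss]
    have hSδ : IsSelfAdjoint (S + δ • (1 : H →L[ℂ] H)) := by
      have := isSelfAdjoint_sub_smul_one hSs (-δ)
      rwa [neg_smul, sub_neg_eq_add] at this
    have h2 : softThr (S + δ • (1 : H →L[ℂ] H)) ε = R := by
      rw [hR, softThr, softThr, sub_smul]; congr 1; abel
    have h3 := τ.softThr_conj_le (add_mem hSN (rsmul_mem δ (one_mem N))) hSδ huN hun hε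
    rw [hBu, h2, τ.conj_eq hRN hR0 huN, huu] at h3
    exact h3
  have hsR : star (CFC.sqrt R) = CFC.sqrt R :=
    (isSelfAdjoint_of_nonneg (CFC.sqrt_nonneg R)).star_eq
  have hsRN := sqrt_mem hRN
  have hpos : ∀ B : H →L[ℂ] H, 0 ≤ B → 0 ≤ c * B * c := fun B hB => by
    have := conj_nonneg' hB c
    rwa [hcs] at this
  have hpos2 : ∀ B : H →L[ℂ] H, 0 ≤ B → 0 ≤ CFC.sqrt R * (c * B * c) * CFC.sqrt R := fun B hB => by
    have := conj_nonneg' (hpos B hB) (CFC.sqrt R)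
    rwa [hsR] at this
  have hmem : ∀ B ∈ N, c * B * c ∈ N := fun B hB => mul_mem (mul_mem hcN hB) hcN
  have hmem2 : ∀ B ∈ N, CFC.sqrt R * (c * B * c) * CFC.sqrt R ∈ N := fun B hB =>
    mul_mem (mul_mem hsRN (hmem B hB)) hsRN
  refine (add_le_add (key A hA hA0 (le_add_of_nonneg_right hC0))
    (key C hC hC0 (le_add_of_nonneg_left hA0))).trans ?_
  rw [← τ.map_add _ (hmem2 A hA) _ (hmem2 C hC) (hpos2 A hA0) (hpos2 C hC0)]
  have : CFC.sqrt R * (c * A * c) * CFC.sqrt R + CFC.sqrt R * (c * C * c) * CFC.sqrt R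
      = CFC.sqrt R * (c * S * c) * CFC.sqrt R := by
    rw [hS, ← add_mul, ← mul_add, ← add_mul, ← mul_add]
  rw [this]
  refine (τ.sqrt_conj_le hRN hR0 (hmem S hSN) (hpos S hS0) zero_le_one
    (by rwa [one_smul])).trans ?_
  simp

/-- The approximate polar decomposition dominates X*X, up to a small multiple of 1, by a contractive
conjugate of XX*. One ε of the threshold pays for that error, the other is the threshold of XX*. -/
theorem softThr_star_mul_self_le (hX : X ∈ N) {ε : ℝ} (hε : 0 < ε) :
    τ.toFun (softThr (star X * X) (2 * ε)) ≤ τ.toFun (softThr (X * star X) ε) := by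
  -- Chosen so that the error 2δ‖X‖ is at most ε; adding 1 covers X = 0.
  have hδ : 0 < ε / (2 * (‖X‖ + 1)) := by positivity
  obtain ⟨K, hKN, hK1, -, -, -, hK⟩ := exists_approx_polar hX hδ
  have h2 : 2 * (ε / (2 * (‖X‖ + 1))) * ‖X‖ ≤ ε := by
    have : 2 * (ε / (2 * (‖X‖ + 1))) * ‖X‖ = ε * (‖X‖ / (‖X‖ + 1)) := by field_simp
    rw [this]
    exact mul_le_of_le_one_right hε.le (div_le_one_of_le₀ (by linarith) (by positivity))
  have hXX : X * star X ∈ N := mul_mem hX (star_mem hX)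
  have hs : IsSelfAdjoint (X * star X) := .mul_star_self X
  refine le_trans ?_ (τ.conj_le (softThr_mem hXX ε) (softThr_nonneg _ _) hKN hK1)
  refine τ.softThr_le_of_le (mul_mem (star_mem hX) hX) (.star_mul_self X)
    (mul_mem (mul_mem (star_mem hKN) (softThr_mem hXX ε)) hKN)
    (conj_nonneg' (softThr_nonneg _ _) K) ?_
  refine le_trans ?_ (conj_sub_smul_one_le hs hK1 hε.le)
  have h3 : (2 * (ε / (2 * (‖X‖ + 1))) * ‖X‖) • (1 : H →L[ℂ] H) ≤ ε • 1 :=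
    smul_le_smul_of_nonneg_right h2 zero_le_one
  rw [two_mul, add_smul, ← sub_sub]
  exact sub_le_sub_right ((sub_le_sub_left h3 _).trans hK) _

/-- Writing A = KQ + εK with Q = |A| and U = VK, the real part of VAW is at most the mean of UQU*
and W*QW plus ε. One ε removes this remainder; the other thresholds the two conjugates of Q, each of
trace at most that of (Q - ε)₊. -/
theorem softThr_realPart_le {V W : H →L[ℂ] H} (hA : A ∈ N) (hV : V ∈ N) (hW : W ∈ N)
    (hV1 : ‖V‖ ≤ 1) (hW1 : ‖W‖ ≤ 1) {ε : ℝ} (hε : 0 < ε) :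
    τ.toFun (softThr (ℜ (V * A * W) : H →L[ℂ] H) (2 * ε)) ≤ τ.toFun (softThr (CFC.abs A) ε) := by
  obtain ⟨K, hKN, hK1, -, -, hAK, -⟩ := exists_approx_polar hA hε
  set Q := CFC.abs A with hQ
  have hQN : Q ∈ N := abs_mem hA
  have hQ0 : 0 ≤ Q := CFC.abs_nonneg A
  have hQs := isSelfAdjoint_of_nonneg hQ0
  set U := V * K with hU
  have hUN : U ∈ N := mul_mem hV hKN
  have hU1 : ‖U‖ ≤ 1 := (norm_mul_le _ _).trans (mul_le_one₀ hV1 (norm_nonneg _) hK1)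
  have hUW : ‖U * W‖ ≤ 1 := (norm_mul_le _ _).trans (mul_le_one₀ hU1 (norm_nonneg _) hW1)
  have hVAW : V * A * W = U * Q * W + ε • (U * W) := by
    conv_lhs => rw [hAK]
    rw [mul_add, add_mul, hU, mul_smul_comm, smul_mul_assoc]
    simp only [mul_assoc]
  set Y1 := U * softThr Q ε * star U with hY1
  set Y2 := star W * softThr Q ε * W with hY2
  have hQε := softThr_mem hQN ε
  have hQε0 := softThr_nonneg Q ε
  have hY1N : Y1 ∈ N := mul_mem (mul_mem hUN hQε) (star_mem hUN)
  have hY2N : Y2 ∈ N := mul_mem (mul_mem (star_mem hW) hQε) hW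
  have hY10 : 0 ≤ Y1 := by simpa using conj_nonneg' hQε0 (star U)
  have hY20 : 0 ≤ Y2 := conj_nonneg' hQε0 W
  have hb1 : U * Q * star U - ε • 1 ≤ Y1 := by
    simpa using conj_sub_smul_one_le hQs (K := star U) (by simpa using hU1) hε.le
  have hb2 : star W * Q * W - ε • 1 ≤ Y2 := conj_sub_smul_one_le hQs hW1 hε.le
  have ht1 : τ.toFun Y1 ≤ τ.toFun (softThr Q ε) := by
    simpa using τ.conj_le hQε hQε0 (star_mem hUN) (by simpa using hU1)
  have ht2 : τ.toFun Y2 ≤ τ.toFun (softThr Q ε) := τ.conj_le hQε hQε0 hW hW1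
  have hle : (ℜ (V * A * W) : H →L[ℂ] H) - (2 * ε) • 1 ≤ (2⁻¹ : ℝ) • (Y1 + Y2) := by
    have h1 : (ℜ (V * A * W) : H →L[ℂ] H)
        = (2⁻¹ : ℝ) • (U * Q * W + star (U * Q * W)) + ε • (ℜ (U * W) : H →L[ℂ] H) := by
      rw [hVAW, _root_.map_add, AddSubgroup.coe_add, _root_.map_smul, selfAdjoint.val_smul,
        realPart_apply_coe (U * Q * W)]
    rw [h1]
    have h2 := smul_le_smul_of_nonneg_left (realPart_mul_mul_le hQ0 U W)
      (by norm_num : (0 : ℝ) ≤ 2⁻¹)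
    have h3 := smul_le_smul_of_nonneg_left (realPart_smul_le hUW) hε.le
    have h4 := smul_le_smul_of_nonneg_left (add_le_add hb1 hb2) (by norm_num : (0 : ℝ) ≤ 2⁻¹)
    refine le_trans ?_ h4
    have h5 := sub_le_sub_right (add_le_add h2 h3) ((2 * ε) • (1 : H →L[ℂ] H))
    refine h5.trans (le_of_eq ?_)
    module
  refine (τ.softThr_le_of_le (realPart_mem (mul_mem (mul_mem hV hA) hW)) (ℜ _).2
    (rsmul_mem _ (add_mem hY1N hY2N)) (smul_nonneg (by norm_num) (add_nonneg hY10 hY20)) hle).trans ?_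
  rw [τ.map_smul _ (by norm_num) _ (add_mem hY1N hY2N) (add_nonneg hY10 hY20),
    τ.map_add _ hY1N _ hY2N hY10 hY20]
  calc ENNReal.ofReal 2⁻¹ * (τ.toFun Y1 + τ.toFun Y2)
      ≤ ENNReal.ofReal 2⁻¹ * (τ.toFun (softThr Q ε) + τ.toFun (softThr Q ε)) := by gcongr
    _ = τ.toFun (softThr Q ε) := by
        rw [← two_mul, ← mul_assoc, ENNReal.ofReal_inv_of_pos (by norm_num)]
        rw [ENNReal.ofReal_ofNat, ENNReal.inv_mul_cancel (by norm_num) (by norm_num), one_mul]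

/-- Up to one ε, |AB| is dominated by the self-adjoint operator K*AB, to which the estimate for real
parts applies with threshold 2ε. -/
theorem softThr_abs_mul_le {B : H →L[ℂ] H} (hA : A ∈ N) (hB : B ∈ N) (hB1 : ‖B‖ ≤ 1) {ε : ℝ}
    (hε : 0 < ε) :
    τ.toFun (softThr (CFC.abs (A * B)) (3 * ε)) ≤ τ.toFun (softThr (CFC.abs A) ε) := by
  obtain ⟨K, hKN, hK1, hKle, hKs, -, -⟩ := exists_approx_polar (mul_mem hA hB) hε
  have hAB : CFC.abs (A * B) ∈ N := abs_mem (mul_mem hA hB)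
  have h0 : 0 ≤ CFC.abs (A * B) := CFC.abs_nonneg _
  refine le_trans ?_ (τ.softThr_realPart_le hA (star_mem hKN) hB (by simpa using hK1) hB1 hε)
  have hre : (ℜ (star K * A * B) : H →L[ℂ] H) = star K * (A * B) := by
    rw [mul_assoc]; exact hKs.coe_realPart
  rw [hre]
  refine τ.softThr_le_of_le hAB (isSelfAdjoint_of_nonneg h0)
    (softThr_mem (mul_mem (star_mem hKN) (mul_mem hA hB)) _) (softThr_nonneg _ _) ?_
  refine le_trans ?_ (sub_smul_one_le_softThr hKs _)
  refine le_trans (le_of_eq ?_) (sub_le_sub_right hKle _)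
  module

/-- The absolute value of a product of two Hilbert–Schmidt operators has finite trace. -/
theorem abs_star_mul_lt_top (hX : X ∈ N) (hY : Y ∈ N) (hX2 : τ.toFun (star X * X) < ∞)
    (hY2 : τ.toFun (star Y * Y) < ∞) : τ.toFun (CFC.abs (star X * Y)) < ∞ := by
  have hZ : star X * Y ∈ N := mul_mem (star_mem hX) hY
  refine lt_of_le_of_lt (τ.le_of_softThr_le (abs_mem hZ) (CFC.abs_nonneg _) (c :=
    τ.toFun (star X * X) + τ.toFun (star Y * Y)) fun ε hε => ?_) (ENNReal.add_lt_top.2 ⟨hX2, hY2⟩)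
  obtain ⟨K, hKN, hK1, hKle, hKs, -, -⟩ := exists_approx_polar hZ hε
  set U := star K * star X with hU
  have hUN : U ∈ N := mul_mem (star_mem hKN) (star_mem hX)
  have hle := realPart_mul_mul_le (zero_le_one (α := H →L[ℂ] H)) U Y
  have hUY : U * 1 * Y = star K * (star X * Y) := by rw [mul_one, hU, mul_assoc]
  rw [hUY, hKs.star_eq, mul_one, mul_one] at hle
  have hp1 : 0 ≤ U * star U := mul_star_self_nonneg U
  have hp2 : 0 ≤ star Y * Y := star_mul_self_nonneg Y
  have hm1 : U * star U ∈ N := mul_mem hUN (star_mem hUN)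
  have hm2 : star Y * Y ∈ N := mul_mem (star_mem hY) hY
  have h1 : CFC.abs (star X * Y) - ε • 1 ≤ U * star U + star Y * Y := by
    refine hKle.trans ?_
    have h2 := smul_le_smul_of_nonneg_left hle (by norm_num : (0 : ℝ) ≤ 2⁻¹)
    rw [← two_smul ℝ, smul_smul, inv_mul_cancel₀ two_ne_zero, one_smul] at h2
    refine h2.trans ?_
    have h3 := smul_le_smul_of_nonneg_right (by norm_num : (2⁻¹ : ℝ) ≤ 1) (add_nonneg hp1 hp2)
    rwa [one_smul] at h3
  refine (τ.softThr_le_of_le (abs_mem hZ) (isSelfAdjoint_of_nonneg (CFC.abs_nonneg _))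
    (add_mem hm1 hm2) (add_nonneg hp1 hp2) h1).trans ?_
  rw [τ.map_add _ hm1 _ hm2 hp1 hp2]
  gcongr
  have : U * star U = star K * (star X * X) * K := by rw [hU]; simp [mul_assoc]
  rw [this]
  exact τ.conj_le (mul_mem (star_mem hX) hX) (star_mul_self_nonneg X) hKN hK1

end FNSTrace

end NCHeat

namespace NCHeat

variable {H : Type*} [NormedAddCommGroup H] [InnerProductSpace ℂ H] [CompleteSpace H]

/-! ### Dyadic estimates -/

/-- The continuous function equal to `0` on `(-∞, l/2]`, to `1` on `[l, ∞)`, and affine between. -/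
def ramp (l x : ℝ) : ℝ := min 1 (max 0 (2 * x / l - 1))

theorem continuous_ramp (l : ℝ) : Continuous (ramp l) := by
  unfold ramp
  fun_prop

theorem ramp_nonneg (l x : ℝ) : 0 ≤ ramp l x := le_min zero_le_one (le_max_left _ _)

theorem ramp_le_one (l x : ℝ) : ramp l x ≤ 1 := min_le_left _ _

theorem ramp_of_le {l x : ℝ} (hl : 0 < l) (h : l ≤ x) : ramp l x = 1 := by
  have : 1 ≤ 2 * x / l - 1 := by
    rw [le_sub_iff_add_le, le_div_iff₀ hl]; linarith
  exact min_eq_left (this.trans (le_max_right _ _))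

theorem ramp_of_le_half {l x : ℝ} (hl : 0 < l) (h : x ≤ l / 2) : ramp l x = 0 := by
  have : 2 * x / l - 1 ≤ 0 := by
    rw [sub_nonpos, div_le_iff₀ hl]; linarith
  rw [ramp, max_eq_left this, min_eq_right zero_le_one]

theorem dyadic_sum_le (ε : ℝ) (K : ℕ) : ∑ k ∈ Finset.range K, 2 ^ k * ε = 2 ^ K * ε - ε := by
  rw [← Finset.sum_mul, geom_sum_eq (by norm_num)]
  ring

/-- A geometric sum is at most twice its largest term, here the one at the last index where I holds.
-/
theorem dyadic_indicator_sum_le {ε m : ℝ} (hε : 0 < ε) (hm : 0 ≤ m) (I : ℕ → Prop)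
    [DecidablePred I] (K : ℕ) (h : ∀ k < K, I k → 2 ^ k * ε ≤ m) :
    ∑ k ∈ Finset.range K, 2 ^ k * ε * (if I k then 1 else 0) ≤ 2 * m := by
  induction K with
  | zero => simpa using hm
  | succ K ih =>
    by_cases hI : I K
    · have h1 : ∑ k ∈ Finset.range (K + 1), 2 ^ k * ε * (if I k then 1 else 0)
          ≤ ∑ k ∈ Finset.range (K + 1), 2 ^ k * ε := by
        refine Finset.sum_le_sum fun k _ => mul_le_of_le_one_right (by positivity) ?_
        split_ifs <;> norm_num
      rw [dyadic_sum_le] at h1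
      have h2 := h K (Nat.lt_succ_self K) hI
      rw [pow_succ] at h1
      linarith
    · rw [Finset.sum_range_succ, if_neg hI, mul_zero, add_zero]
      exact ih fun k hk => h k (hk.trans (Nat.lt_succ_self K))

/-- Descend from the top: the first index at which I holds contributes a term that already exceeds
m; if there is none, m ≤ ε. -/
theorem le_dyadic_indicator_sum {ε m : ℝ} (hε : 0 < ε) (I : ℕ → Prop) [DecidablePred I] (K : ℕ)
    (hm : m ≤ 2 ^ K * ε) (h : ∀ k < K, ¬ I k → m ≤ 2 ^ k * ε) :
    m ≤ ε + ∑ k ∈ Finset.range K, 2 * (2 ^ k * ε) * (if I k then 1 else 0) := by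
  induction K with
  | zero => simpa using hm
  | succ K ih =>
    rw [Finset.sum_range_succ]
    have h0 : 0 ≤ ∑ k ∈ Finset.range K, 2 * (2 ^ k * ε) * (if I k then (1 : ℝ) else 0) := by
      refine Finset.sum_nonneg fun k _ => mul_nonneg (by positivity) ?_
      split_ifs <;> norm_num
    by_cases hI : I K
    · rw [if_pos hI]
      rw [pow_succ] at hm
      linarith
    · rw [if_neg hI, mul_zero, add_zero]
      exact ih (h K (Nat.lt_succ_self K) hI) fun k hk => h k (hk.trans (Nat.lt_succ_self K))

/-- A dyadic layer-cake bound, with ramps as continuous substitutes for spectral projections.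
Together with `dyadic_ramp_sum_le` it makes thresholded traces comparable to sums of distribution
functions. -/
theorem sub_le_dyadic_ramp_sum {ε x : ℝ} (hε : 0 < ε) (K : ℕ) (hx : x ≤ 2 ^ K * ε) :
    max (x - ε) 0 ≤ ∑ k ∈ Finset.range K, 2 * (2 ^ k * ε) * ramp (2 ^ k * ε) x := by
  induction K with
  | zero =>
    simp only [pow_zero, one_mul] at hx
    simp [hx]
  | succ K ih =>
    rw [Finset.sum_range_succ]
    have h0 : 0 ≤ ∑ k ∈ Finset.range K, 2 * (2 ^ k * ε) * ramp (2 ^ k * ε) x :=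
      Finset.sum_nonneg fun k _ => mul_nonneg (by positivity) (ramp_nonneg _ _)
    rcases le_total x (2 ^ K * ε) with h | h
    · exact (ih h).trans (le_add_of_nonneg_right (mul_nonneg (by positivity) (ramp_nonneg _ _)))
    · rw [ramp_of_le (by positivity) h, mul_one]
      rw [pow_succ] at hx
      have : 0 < 2 ^ K * ε := by positivity
      exact max_le (by linarith) (by linarith)

theorem dyadic_ramp_sum_le {ε x : ℝ} (hε : 0 < ε) (K : ℕ) :
    ∑ k ∈ Finset.range K, 2 ^ k * ε * ramp (2 ^ k * ε) x ≤ 8 * max (x - ε / 4) 0 := by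
  -- Below ε/2 every ramp vanishes; above it, x - ε/4 ≥ x/2.
  rcases le_total x (ε / 2) with h | h
  · rw [Finset.sum_eq_zero]
    · positivity
    · intro k _
      have : (1 : ℝ) ≤ 2 ^ k := one_le_pow₀ (by norm_num)
      rw [ramp_of_le_half (by positivity) (by nlinarith), mul_zero]
  · have h1 := dyadic_indicator_sum_le (m := 2 * x) hε (by linarith)
      (fun k => 2 ^ k * ε ≤ 2 * x) K (fun k _ hk => hk)
    have h2 : ∑ k ∈ Finset.range K, 2 ^ k * ε * ramp (2 ^ k * ε) x ≤
        ∑ k ∈ Finset.range K, 2 ^ k * ε * (if 2 ^ k * ε ≤ 2 * x then 1 else 0) := by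
      refine Finset.sum_le_sum fun k _ => mul_le_mul_of_nonneg_left ?_ (by positivity)
      split_ifs with hk
      · exact ramp_le_one _ _
      · rw [ramp_of_le_half (by positivity) (by linarith)]
    have h3 := le_max_left (x - ε / 4) 0
    linarith

theorem integral_indicator_Iio_le {a t : ℝ} (ha : 0 ≤ a) (ht : 0 ≤ t) :
    ∫ s in (0 : ℝ)..t, (Iio a).indicator (fun _ => (1 : ℝ)) s ≤ a := by
  rw [intervalIntegral.integral_of_le ht, setIntegral_indicator measurableSet_Iio, setIntegral_const]
  have : volume.real (Ioc 0 t ∩ Iio a) ≤ volume.real (Ioo 0 a) :=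
    measureReal_mono (fun x hx => ⟨hx.1.1, hx.2⟩) (by simp)
  simpa [ha] using this

theorem integral_indicator_Iio {a t : ℝ} (ha : 0 ≤ a) (hat : a ≤ t) :
    ∫ s in (0 : ℝ)..t, (Iio a).indicator (fun _ => (1 : ℝ)) s = a := by
  rw [intervalIntegral.integral_of_le (ha.trans hat), setIntegral_indicator measurableSet_Iio,
    setIntegral_const]
  have : Ioc 0 t ∩ Iio a = Ioo 0 a := by
    ext x
    simp only [mem_inter_iff, mem_Ioc, mem_Iio, mem_Ioo]
    constructor
    · rintro ⟨⟨h1, _⟩, h2⟩; exact ⟨h1, h2⟩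
    · rintro ⟨h1, h2⟩; exact ⟨⟨h1, by linarith⟩, h2⟩
  rw [this]
  simp [ha]

theorem intervalIntegrable_indicator_Iio (a s t : ℝ) :
    IntervalIntegrable ((Iio a).indicator (fun _ => (1 : ℝ))) volume s t :=
  ⟨(integrableOn_const (by simp)).indicator measurableSet_Iio,
    (integrableOn_const (by simp)).indicator measurableSet_Iio⟩

theorem norm_abs_mul (A p : H →L[ℂ] H) : ‖CFC.abs A * p‖ = ‖A * p‖ := by
  have hs : star (CFC.abs A) = CFC.abs A := (isSelfAdjoint_of_nonneg (CFC.abs_nonneg A)).star_eq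
  have h : star (CFC.abs A * p) * (CFC.abs A * p) = star (A * p) * (A * p) := by
    rw [star_mul, star_mul, hs, mul_assoc, ← mul_assoc (CFC.abs A), CFC.abs_mul_abs]
    simp only [mul_assoc]
  have h1 := CStarRing.norm_star_mul_self (x := CFC.abs A * p)
  rw [h, CStarRing.norm_star_mul_self] at h1
  exact ((mul_self_inj (norm_nonneg _) (norm_nonneg _)).1 h1).symm

namespace FNSTrace

variable {N : VonNeumannAlgebra H} (τ : FNSTrace N) {A P X : H →L[ℂ] H}

/-! ### Generalised singular values -/

theorem singularValue_le {t : ℝ} {p : H →L[ℂ] H} (hp : p ∈ N) (hpp : IsStarProjection p)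
    (ht : τ.toFun (1 - p) ≤ ENNReal.ofReal t) (A : H →L[ℂ] H) :
    τ.singularValue t A ≤ ‖A * p‖ :=
  csInf_le ⟨0, by rintro _ ⟨p, -, -, -, rfl⟩; exact norm_nonneg _⟩ ⟨p, hp, hpp, ht, rfl⟩

theorem le_singularValue {t r : ℝ} (A : H →L[ℂ] H)
    (h : ∀ p ∈ N, IsStarProjection p → τ.toFun (1 - p) ≤ ENNReal.ofReal t → r ≤ ‖A * p‖) :
    r ≤ τ.singularValue t A := by
  refine le_csInf ⟨_, 1, one_mem N, .one _, ?_, rfl⟩ ?_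
  · rw [sub_self, τ.map_zero]; exact zero_le
  · rintro _ ⟨p, hp, hpp, ht, rfl⟩
    exact h p hp hpp ht

theorem singularValue_nonneg (t : ℝ) (A : H →L[ℂ] H) : 0 ≤ τ.singularValue t A :=
  τ.le_singularValue A fun _ _ _ _ => norm_nonneg _

theorem singularValue_le_norm (t : ℝ) (A : H →L[ℂ] H) : τ.singularValue t A ≤ ‖A‖ := by
  have := τ.singularValue_le (t := t) (one_mem N) (.one _) (by rw [sub_self, τ.map_zero]; exact zero_le) A
  rwa [mul_one] at this

theorem antitone_singularValue (A : H →L[ℂ] H) : Antitone fun t => τ.singularValue t A :=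
  fun _ _ hst => τ.le_singularValue A fun _ hp hpp h =>
    τ.singularValue_le hp hpp (h.trans (ENNReal.ofReal_le_ofReal hst)) A

theorem intervalIntegrable_singularValue (A : H →L[ℂ] H) (s t : ℝ) :
    IntervalIntegrable (fun t => τ.singularValue t A) volume s t :=
  (τ.antitone_singularValue A).intervalIntegrable

/-- Let h' be the ramp of P = |A| and v its square root. Since P is small on the range of p,
factoring v = gP gives vpv ≤ h'/2. So half of h' is dominated by v(1 - p)v, whose trace equals that
of (1 - p)h'(1 - p) ≤ 1 - p. -/
theorem trace_ramp_le (hA : A ∈ N) {p : H →L[ℂ] H} (hp : p ∈ N) (hpp : IsStarProjection p) {l : ℝ}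
    (hl : 0 < l) (h : ‖A * p‖ ≤ l / 4) :
    τ.toFun (cfc (ramp l) (CFC.abs A)) ≤ 2 * τ.toFun (1 - p) := by
  set P := CFC.abs A with hP
  have hPN : P ∈ N := abs_mem hA
  have hP0 : 0 ≤ P := CFC.abs_nonneg A
  have hPs := isSelfAdjoint_of_nonneg hP0
  have hps : star p = p := hpp.isSelfAdjoint.star_eq
  have hpi : p * p = p := hpp.isIdempotentElem
  set v := cfc (fun x : ℝ => √(ramp l x)) P with hv
  -- The maximum keeps the quotient continuous; it changes nothing in gP = v, since the ramp
  -- vanishes for x ≤ l/2.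
  set g := cfc (fun x : ℝ => √(ramp l x) / max x (l / 2)) P with hg
  set h' := cfc (ramp l) P with hh
  have cr := (continuous_ramp l)
  have cv : Continuous (fun x : ℝ => √(ramp l x)) := by fun_prop
  have cg : Continuous (fun x : ℝ => √(ramp l x) / max x (l / 2)) := by
    refine cv.div₀ (by fun_prop) fun x => ?_
    have : 0 < max x (l / 2) := lt_max_of_lt_right (by linarith)
    exact this.ne'
  have hvs : star v = v := (IsSelfAdjoint.cfc (f := fun x : ℝ => √(ramp l x)) (a := P)).star_eq
  have hgs : star g = g :=
    (IsSelfAdjoint.cfc (f := fun x : ℝ => √(ramp l x) / max x (l / 2)) (a := P)).star_eq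
  have hvN : v ∈ N := cfc_mem hPN _
  have hgN : g ∈ N := cfc_mem hPN _
  have hhN : h' ∈ N := cfc_mem hPN _
  have hh0 : 0 ≤ h' := cfc_nonneg fun x _ => ramp_nonneg _ _
  have hh1 : h' ≤ 1 := by
    rw [← cfc_one ℝ P]
    exact cfc_mono (fun x _ => ramp_le_one _ _) cr.continuousOn continuousOn_const
  have hvv : v * v = h' := by
    rw [hv, ← cfc_mul _ _ P cv.continuousOn cv.continuousOn]
    exact cfc_congr fun x _ => Real.mul_self_sqrt (ramp_nonneg _ _)
  have hgP : g * P = v := by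
    have hPid : P = cfc (fun x : ℝ => x) P := (cfc_id' ℝ P).symm
    calc g * P = g * cfc (fun x : ℝ => x) P := by rw [← hPid]
      _ = v := by
        rw [hg, ← cfc_mul _ (fun x : ℝ => x) P cg.continuousOn continuousOn_id]
        refine cfc_congr fun x _ => ?_
        rcases le_total x (l / 2) with hx | hx
        · simp [ramp_of_le_half hl hx]
        · have : x ≠ 0 := by linarith
          simp only [max_eq_left hx]
          field_simp
  have hPg : P * g = v := by
    have := congrArg star hgP
    rwa [star_mul, hgs, hPs.star_eq, hvs] at this
  have hgg : (l / 4) ^ 2 • (g * g) ≤ (2⁻¹ : ℝ) • h' := by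
    rw [hg, ← cfc_mul _ _ P cg.continuousOn cg.continuousOn, hh,
      ← cfc_smul _ (fun x : ℝ => √(ramp l x) / max x (l / 2) * (√(ramp l x) / max x (l / 2))) P
        (cg.mul cg).continuousOn, ← cfc_smul _ _ P cr.continuousOn]
    refine cfc_mono (fun x _ => ?_) (continuousOn_const.mul (cg.mul cg).continuousOn)
      (continuousOn_const.mul cr.continuousOn)
    simp only [smul_eq_mul]
    have hm : l / 2 ≤ max x (l / 2) := le_max_right _ _
    have hm0 : 0 < max x (l / 2) := by linarith
    have e1 : √(ramp l x) / max x (l / 2) * (√(ramp l x) / max x (l / 2))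
        = ramp l x / (max x (l / 2)) ^ 2 := by
      rw [div_mul_div_comm, Real.mul_self_sqrt (ramp_nonneg _ _), sq]
    rw [e1, mul_div_assoc', div_le_iff₀ (by positivity)]
    have : (l / 4) ^ 2 ≤ 2⁻¹ * (max x (l / 2)) ^ 2 := by nlinarith
    nlinarith [ramp_nonneg l x]
  have hPp : P * p * star (P * p) ≤ (l / 4) ^ 2 • (1 : H →L[ℂ] H) := by
    refine CStarAlgebra.mul_star_le_algebraMap_norm_sq.trans ?_
    rw [← algebraMap_eq_smul, norm_abs_mul]
    exact algebraMap_mono _ (pow_le_pow_left₀ (norm_nonneg _) h 2)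
  have hvpv : v * p * v ≤ (2⁻¹ : ℝ) • h' := by
    have h1 := conj_mono hPp g
    rw [hgs, mul_smul_comm, mul_one, smul_mul_assoc] at h1
    refine le_trans (le_of_eq ?_) (h1.trans hgg)
    rw [star_mul, hps, hPs.star_eq]
    calc v * p * v = g * P * (p * p) * (P * g) := by rw [hgP, hPg, hpi]
      _ = _ := by simp only [mul_assoc]
  set T := (1 - p) * v with hT
  have hTN : T ∈ N := mul_mem (sub_mem (one_mem N) hp) hvN
  have hep : IsStarProjection (1 - p) := hpp.one_sub
  have hes : star (1 - p) = 1 - p := hep.isSelfAdjoint.star_eq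
  have hTT : star T * T = h' - v * p * v := by
    rw [hT, star_mul, hvs, hes]
    calc v * (1 - p) * ((1 - p) * v) = v * ((1 - p) * (1 - p)) * v := by simp only [mul_assoc]
      _ = _ := by rw [hep.isIdempotentElem, mul_sub, sub_mul, mul_one, hvv]
  have hle : (2⁻¹ : ℝ) • h' ≤ star T * T := by
    rw [hTT]
    have := sub_le_sub_left hvpv h'
    refine le_trans (le_of_eq ?_) this
    module
  have h1 : τ.toFun ((2⁻¹ : ℝ) • h') ≤ τ.toFun (1 - p) := by
    refine (τ.mono (rsmul_mem _ hhN) (mul_mem (star_mem hTN) hTN)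
      (smul_nonneg (by norm_num) hh0) hle).trans ?_
    rw [τ.tracial T hTN]
    refine τ.mono (mul_mem hTN (star_mem hTN)) (sub_mem (one_mem N) hp) (mul_star_self_nonneg T) ?_
    have e : T * star T = star (1 - p) * h' * (1 - p) := by
      rw [hT, star_mul, hvs, ← hvv, hes]; simp only [mul_assoc]
    have := conj_mono hh1 (1 - p)
    rw [e]
    rw [hes] at this ⊢
    rwa [mul_one, hep.isIdempotentElem] at this
  rw [τ.map_smul _ (by norm_num) _ hhN hh0, ENNReal.ofReal_inv_of_pos (by norm_num),
    ENNReal.ofReal_ofNat] at h1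
  calc τ.toFun h' = 2 * (2⁻¹ * τ.toFun h') := by
        rw [← mul_assoc, ENNReal.mul_inv_cancel (by norm_num) (by norm_num), one_mul]
    _ ≤ _ := by gcongr

theorem le_singularValue_of_lt_trace_ramp (hA : A ∈ N) {l s : ℝ} (hl : 0 < l)
    (h : 2 * ENNReal.ofReal s < τ.toFun (cfc (ramp l) (CFC.abs A))) :
    l / 4 ≤ τ.singularValue s A := by
  refine τ.le_singularValue A fun p hp hpp ht => ?_
  by_contra! hlt
  have h1 := τ.trace_ramp_le hA hp hpp hl hlt.le
  exact absurd (h.trans_le (h1.trans (by gcongr))) (lt_irrefl _)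

/-- The kernel projection p of (|A| - l)₊ is admissible: on its range |A| is at most l, and 1 - p is
dominated by the ramp, which equals 1 wherever the soft threshold is nonzero. -/
theorem singularValue_le_of_trace_ramp_le (hA : A ∈ N) {l s : ℝ} (hl : 0 < l)
    (h : τ.toFun (cfc (ramp l) (CFC.abs A)) ≤ ENNReal.ofReal s) :
    τ.singularValue s A ≤ l := by
  set P := CFC.abs A with hP
  have hPN : P ∈ N := abs_mem hA
  have hP0 : 0 ≤ P := CFC.abs_nonneg A
  have hPs := isSelfAdjoint_of_nonneg hP0
  set R := softThr P l with hR
  have hRN : R ∈ N := softThr_mem hPN l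
  set p := kerProj R with hp
  have hpN : p ∈ N := kerProj_mem hRN
  have hpp := isStarProjection_kerProj R
  have hps : star p = p := hpp.isSelfAdjoint.star_eq
  have hRp : R * p = 0 := mul_kerProj R
  have hReq := softThr_eq_cfc hPs l
  have cR : Continuous (fun x : ℝ => max (x - l) 0) := by fun_prop
  set h' := cfc (ramp l) P with hh
  have hhs : star h' = h' := (IsSelfAdjoint.cfc (f := ramp l) (a := P)).star_eq
  have hh0 : 0 ≤ h' := cfc_nonneg fun x _ => ramp_nonneg _ _
  have hRh : R * (1 - h') = 0 := by
    have : R * h' = R := by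
      rw [hR, hReq, hh, ← cfc_mul _ _ P cR.continuousOn (continuous_ramp l).continuousOn]
      refine cfc_congr fun x _ => ?_
      rcases le_total x l with hx | hx
      · rw [max_eq_right (by linarith), zero_mul]
      · rw [ramp_of_le hl hx, mul_one]
    rw [mul_sub, mul_one, this, sub_self]
  have h1 : p * (1 - h') = 1 - h' := kerProj_mul hRh
  have h2 : 1 - p ≤ h' := by
    have e : h' - (1 - p) = star p * h' * p := by
      have h3 : p * h' = h' - (1 - p) := by
        rw [mul_sub, mul_one] at h1
        rw [← sub_eq_zero] at h1 ⊢
        rw [← neg_eq_zero, ← h1]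
        abel
      have h4 : h' * p = h' - (1 - p) := by
        have := congrArg star h3
        rwa [star_mul, hps, hhs, star_sub, star_sub, star_one, hps, hhs] at this
      rw [hps, h3, sub_mul, h4, hpp.one_sub_mul_self, sub_zero]
    rw [← sub_nonneg, e]
    exact conj_nonneg' hh0 p
  refine (τ.singularValue_le hpN hpp ((τ.mono (sub_mem (one_mem N) hpN) (cfc_mem hPN _)
    hpp.one_sub.nonneg h2).trans h) A).trans ?_
  rw [← norm_abs_mul, ← hP]
  have e : P = R + cfc (fun x : ℝ => min x l) P := by
    rw [hR, hReq, ← cfc_add P _ _ cR.continuousOn (by fun_prop)]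
    conv_lhs => rw [← cfc_id' ℝ P]
    refine cfc_congr fun x _ => ?_
    rcases le_total x l with hx | hx
    · rw [max_eq_right (by linarith), min_eq_left hx, zero_add]
    · rw [max_eq_left (by linarith), min_eq_right hx]; ring
  rw [e, add_mul, hRp, zero_add]
  refine (norm_mul_le _ _).trans ((mul_le_of_le_one_right (norm_nonneg _) hpp.norm_le).trans ?_)
  refine norm_cfc_le hl.le fun x hx => ?_
  have h0 : 0 ≤ x := spectrum_nonneg_of_nonneg hP0 hx
  rw [Real.norm_eq_abs, abs_of_nonneg (le_min h0 hl.le)]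
  exact min_le_right _ _

end FNSTrace

end NCHeat

namespace NCHeat

variable {H : Type*} [NormedAddCommGroup H] [InnerProductSpace ℂ H] [CompleteSpace H]

/-! ### Logarithmic growth -/

theorem log_two_le {T : ℝ} (hT : 0 ≤ T) : Real.log 2 ≤ Real.log (2 + T) :=
  Real.log_le_log (by norm_num) (by linarith)

theorem log_two_add_pos {T : ℝ} (hT : 0 ≤ T) : 0 < Real.log (2 + T) :=
  (Real.log_pos (by norm_num)).trans_le (log_two_le hT)

theorem exists_log_two_add_mul_le {a : ℝ} (ha : 0 ≤ a) :
    ∃ c : ℝ, 0 ≤ c ∧ ∀ T : ℝ, 0 ≤ T → Real.log (2 + a * T) ≤ c * Real.log (2 + T) := by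
  have hl2 : 0 < Real.log 2 := Real.log_pos (by norm_num)
  have hl : 0 ≤ Real.log (1 + a) := Real.log_nonneg (by linarith)
  refine ⟨Real.log (1 + a) / Real.log 2 + 1, by positivity, fun T hT => ?_⟩
  have h1 : Real.log (2 + a * T) ≤ Real.log ((1 + a) * (2 + T)) :=
    Real.log_le_log (by positivity) (by nlinarith)
  rw [Real.log_mul (by positivity) (by positivity)] at h1
  have h2 : Real.log (1 + a) ≤ Real.log (1 + a) / Real.log 2 * Real.log (2 + T) := by
    calc Real.log (1 + a) = Real.log (1 + a) / Real.log 2 * Real.log 2 := by field_simp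
      _ ≤ _ := mul_le_mul_of_nonneg_left (log_two_le hT) (by positivity)
  linarith

theorem log_one_add_le_two_sqrt {t : ℝ} (ht : 0 ≤ t) : Real.log (1 + t) ≤ 2 * √t := by
  have hs : 0 ≤ √t := Real.sqrt_nonneg t
  have hss : √t ^ 2 = t := Real.sq_sqrt ht
  have h1 : Real.log (1 + t) ≤ Real.log ((1 + √t) ^ 2) :=
    Real.log_le_log (by positivity) (by nlinarith)
  rw [Real.log_pow] at h1
  have h2 : Real.log (1 + √t) ≤ √t := by
    have := Real.log_le_sub_one_of_pos (show 0 < 1 + √t by positivity)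
    linarith
  push_cast at h1
  linarith

theorem half_le_log_one_add {t : ℝ} (h0 : 0 ≤ t) (h1 : t ≤ 1) : t / 2 ≤ Real.log (1 + t) := by
  have := Real.one_sub_inv_le_log_of_pos (show 0 < 1 + t by linarith)
  refine le_trans ?_ this
  have e : 1 - (1 + t)⁻¹ = t / (1 + t) := by
    have : (1 + t) ≠ 0 := by linarith
    field_simp; ring
  rw [e]
  exact div_le_div_of_nonneg_left h0 (by linarith) (by linarith)

namespace FNSTrace

variable {N : VonNeumannAlgebra H} (τ : FNSTrace N) {A B P Q X Y : H →L[ℂ] H}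

/-- A positive operator `P` of `N` with `τ((P - 1/T)₊) = O(log(2 + T))`. -/
structure LogBounded (P : H →L[ℂ] H) : Prop where
  mem : P ∈ N
  nonneg : 0 ≤ P
  bound : ∃ C : ℝ, 0 ≤ C ∧ ∀ T : ℝ, 0 < T →
    τ.toFun (softThr P T⁻¹) ≤ ENNReal.ofReal (C * Real.log (2 + T))

theorem map_sum_smul (K : ℕ) (c : ℕ → ℝ) (hc : ∀ k, 0 ≤ c k) (Q : ℕ → H →L[ℂ] H)
    (hQ : ∀ k, Q k ∈ N) (hQ0 : ∀ k, 0 ≤ Q k) :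
    (∑ k ∈ Finset.range K, c k • Q k) ∈ N ∧ 0 ≤ ∑ k ∈ Finset.range K, c k • Q k ∧
    τ.toFun (∑ k ∈ Finset.range K, c k • Q k)
      = ∑ k ∈ Finset.range K, ENNReal.ofReal (c k) * τ.toFun (Q k) := by
  induction K with
  | zero => simp [τ.map_zero, zero_mem]
  | succ K ih =>
    obtain ⟨h1, h2, h3⟩ := ih
    have h4 := rsmul_mem (c K) (hQ K)
    have h5 : 0 ≤ c K • Q K := smul_nonneg (hc K) (hQ0 K)
    simp only [Finset.sum_range_succ]
    refine ⟨add_mem h1 h4, add_nonneg h2 h5, ?_⟩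
    rw [τ.map_add _ h1 _ h4 h2 h5, h3, τ.map_smul _ (hc K) _ (hQ K) (hQ0 K)]

theorem cfc_sum_smul_ramp (ε : ℝ) (K : ℕ) (P : H →L[ℂ] H) (c : ℕ → ℝ) :
    ∑ k ∈ Finset.range K, c k • cfc (ramp (2 ^ k * ε)) P
      = cfc (fun x => ∑ k ∈ Finset.range K, c k * ramp (2 ^ k * ε) x) P := by
  have h := cfc_sum (fun k x => c k * ramp (2 ^ k * ε) x) P (Finset.range K)
    (fun k _ => ((continuous_ramp _).const_mul _).continuousOn)
  rw [Finset.sum_fn] at h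
  rw [h]
  refine Finset.sum_congr rfl fun k _ => ?_
  rw [← cfc_smul _ _ P (continuous_ramp _).continuousOn]
  rfl

theorem continuous_sum_ramp (ε : ℝ) (K : ℕ) (c : ℕ → ℝ) :
    Continuous fun x => ∑ k ∈ Finset.range K, c k * ramp (2 ^ k * ε) x :=
  continuous_finsetSum _ fun _ _ => (continuous_ramp _).const_mul _

theorem exists_norm_le_two_pow_mul (P : H →L[ℂ] H) {ε : ℝ} (hε : 0 < ε) :
    ∃ K : ℕ, ‖P‖ ≤ 2 ^ K * ε := by
  obtain ⟨K, hK⟩ := pow_unbounded_of_one_lt (‖P‖ / ε) (by norm_num : (1 : ℝ) < 2)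
  exact ⟨K, ((div_lt_iff₀ hε).1 hK).le⟩

theorem softThr_le_sum_ramp (hP : P ∈ N) (h0 : 0 ≤ P) {ε : ℝ} (hε : 0 < ε) {K : ℕ}
    (hK : ‖P‖ ≤ 2 ^ K * ε) :
    τ.toFun (softThr P ε) ≤ ∑ k ∈ Finset.range K,
      ENNReal.ofReal (2 * (2 ^ k * ε)) * τ.toFun (cfc (ramp (2 ^ k * ε)) P) := by
  have hPs := isSelfAdjoint_of_nonneg h0
  obtain ⟨h1, -, h3⟩ := τ.map_sum_smul K (fun k => 2 * (2 ^ k * ε)) (fun k => by positivity)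
    (fun k => cfc (ramp (2 ^ k * ε)) P) (fun k => cfc_mem hP _)
    (fun k => cfc_nonneg fun x _ => ramp_nonneg _ _)
  rw [← h3]
  refine τ.mono (softThr_mem hP ε) h1 (softThr_nonneg _ _) ?_
  rw [softThr_eq_cfc hPs, cfc_sum_smul_ramp ε K P]
  exact cfc_mono (fun x hx => sub_le_dyadic_ramp_sum hε K ((le_norm_of_mem_spectrum hx).trans hK))
    (by fun_prop) (continuous_sum_ramp ε K _).continuousOn

theorem sum_ramp_le_softThr (hP : P ∈ N) (h0 : 0 ≤ P) {ε : ℝ} (hε : 0 < ε) (K : ℕ) :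
    ∑ k ∈ Finset.range K, ENNReal.ofReal (2 ^ k * ε) * τ.toFun (cfc (ramp (2 ^ k * ε)) P)
      ≤ 8 * τ.toFun (softThr P (ε / 4)) := by
  have hPs := isSelfAdjoint_of_nonneg h0
  obtain ⟨h1, h2, h3⟩ := τ.map_sum_smul K (fun k => (2 ^ k * ε)) (fun k => by positivity)
    (fun k => cfc (ramp (2 ^ k * ε)) P) (fun k => cfc_mem hP _)
    (fun k => cfc_nonneg fun x _ => ramp_nonneg _ _)
  have h8 : (8 : ℝ≥0∞) = ENNReal.ofReal 8 := by simp
  rw [← h3, h8, ← τ.map_smul 8 (by norm_num) _ (softThr_mem hP _) (softThr_nonneg _ _)]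
  refine τ.mono h1 (rsmul_mem _ (softThr_mem hP _)) h2 ?_
  have cm : Continuous fun x : ℝ => max (x - ε / 4) 0 := by fun_prop
  rw [softThr_eq_cfc hPs, cfc_sum_smul_ramp ε K P, ← cfc_smul _ _ P cm.continuousOn]
  exact cfc_mono (fun x hx => dyadic_ramp_sum_le hε K) (continuous_sum_ramp ε K _).continuousOn
    (cm.const_smul (8 : ℝ)).continuousOn

/-- With n(l) the trace of the ramp at level l, the singular value function is at least l/4 on [0,
n(l)/2). Summing over dyadic levels bounds the thresholded trace by a multiple of ∫₀^M μ, where M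
need only exceed all n(l)/2. A polynomial bound for M suffices because the integral grows
logarithmically. -/
theorem logBounded_abs (hA : A ∈ τ.dixmierIdeal) : τ.LogBounded (CFC.abs A) := by
  obtain ⟨hAN, C, hC⟩ := hA
  set P := CFC.abs A with hP
  have hPN : P ∈ N := abs_mem hAN
  have hP0 : 0 ≤ P := CFC.abs_nonneg A
  set D := max C 1 with hD
  have hD0 : 0 < D := lt_max_of_lt_right one_pos
  have hintegr : ∀ t : ℝ, 0 < t → ∫ s in (0 : ℝ)..t, τ.singularValue s A ≤ D * Real.log (1 + t) := by
    intro t ht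
    have hlog : 0 < Real.log (1 + t) := Real.log_pos (by linarith)
    have := (hC t ht).trans (le_max_left C 1)
    rwa [inv_mul_le_iff₀ hlog, mul_comm] at this
  set n : ℝ → ℝ≥0∞ := fun l => τ.toFun (cfc (ramp l) P) with hn
  -- From tl/4 ≤ ∫₀ᵗ μ ≤ D log(1 + t) ≤ 2D√t.
  have step1 : ∀ l : ℝ, 0 < l → ∀ t : ℝ, 0 < t → ENNReal.ofReal (2 * t) ≤ n l →
      t ≤ (8 * D / l) ^ 2 := by
    intro l hl t ht hnt
    have h1 : ∫ s in (0 : ℝ)..t, l / 4 ≤ ∫ s in (0 : ℝ)..t, τ.singularValue s A := by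
      refine intervalIntegral.integral_mono_on_of_le_Ioo ht.le intervalIntegrable_const
        (τ.intervalIntegrable_singularValue A 0 t) fun s hs => ?_
      refine τ.le_singularValue_of_lt_trace_ramp hAN hl (lt_of_lt_of_le ?_ hnt)
      rw [ENNReal.ofReal_mul (by norm_num), ENNReal.ofReal_ofNat]
      refine (ENNReal.mul_lt_mul_iff_right (by norm_num) (by norm_num)).2 ?_
      exact (ENNReal.ofReal_lt_ofReal_iff ht).2 hs.2
    rw [intervalIntegral.integral_const, smul_eq_mul, sub_zero] at h1
    have h2 := h1.trans (hintegr t ht)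
    have h3 := log_one_add_le_two_sqrt ht.le
    have hs : 0 < √t := Real.sqrt_pos.2 ht
    have hss : √t * √t = t := Real.mul_self_sqrt ht.le
    have h4 : √t * √t * l ≤ 8 * D * √t := by
      rw [hss]
      nlinarith [mul_le_mul_of_nonneg_left h3 hD0.le]
    have h5 : √t * l ≤ 8 * D := by
      have : √t * (√t * l) ≤ √t * (8 * D) := by linarith
      exact le_of_mul_le_mul_left this hs
    have h6 : √t ≤ 8 * D / l := by rwa [le_div_iff₀ hl]
    calc t = √t ^ 2 := (Real.sq_sqrt ht.le).symm
      _ ≤ _ := pow_le_pow_left₀ hs.le h6 2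
  -- This also excludes n(l) = ∞, by testing real numbers below n(l).
  have step2 : ∀ l : ℝ, 0 < l → n l ≤ ENNReal.ofReal (2 * (8 * D / l) ^ 2) := by
    intro l hl
    by_contra! hlt
    obtain ⟨r, hr0, hr1, hr2⟩ := ENNReal.lt_iff_exists_real_btwn.1 hlt
    have hr3 : 2 * (8 * D / l) ^ 2 < r := by
      rwa [ENNReal.ofReal_lt_ofReal_iff_of_nonneg (by positivity)] at hr1
    have hpos : 0 < (8 * D / l) ^ 2 := by positivity
    have := step1 l hl (r / 2) (by linarith) (by rw [mul_div_cancel₀ r two_ne_zero]; exact hr2.le)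
    linarith
  have step3 : ∀ ε : ℝ, 0 < ε → τ.toFun (softThr P ε)
      ≤ ENNReal.ofReal (32 * D * Real.log (2 + (8 * D / ε) ^ 2)) := by
    intro ε hε
    obtain ⟨K, hK⟩ := exists_norm_le_two_pow_mul P hε
    refine (τ.softThr_le_sum_ramp hPN hP0 hε hK).trans ?_
    have hlpos : ∀ k : ℕ, 0 < 2 ^ k * ε := fun k => by positivity
    have hle : ∀ k : ℕ, ε ≤ 2 ^ k * ε := fun k =>
      le_mul_of_one_le_left hε.le (one_le_pow₀ (by norm_num))
    set a : ℕ → ℝ := fun k => (n (2 ^ k * ε)).toReal / 2 with ha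
    have ha0 : ∀ k, 0 ≤ a k := fun k => by positivity
    have hna : ∀ k, n (2 ^ k * ε) = ENNReal.ofReal (2 * a k) := by
      intro k
      rw [ha, mul_div_cancel₀ _ two_ne_zero, ENNReal.ofReal_toReal]
      exact ((step2 _ (hlpos k)).trans_lt ENNReal.ofReal_lt_top).ne
    -- M exceeds every a k, so each indicator integrates over [0, M] to the full a k.
    set M := (8 * D / ε) ^ 2 + 1 with hM
    have hM0 : 0 < M := by positivity
    have haM : ∀ k, a k ≤ M := by
      intro k
      have h1 := step2 _ (hlpos k)
      rw [hna, ENNReal.ofReal_le_ofReal_iff (by positivity)] at h1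
      have h2 : (8 * D / (2 ^ k * ε)) ^ 2 ≤ (8 * D / ε) ^ 2 :=
        pow_le_pow_left₀ (by positivity) (div_le_div_of_nonneg_left (by positivity) hε (hle k)) 2
      linarith
    have hpt : ∀ s ∈ Icc (0 : ℝ) M, ∑ k ∈ Finset.range K,
        2 ^ k * ε * (Iio (a k)).indicator (fun _ => (1 : ℝ)) s ≤ 8 * τ.singularValue s A := by
      intro s hs
      have h1 := dyadic_indicator_sum_le (m := 4 * τ.singularValue s A) hε
        (mul_nonneg (by norm_num) (τ.singularValue_nonneg s A)) (fun k => s < a k) K ?_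
      · simp only [indicator_apply, mem_Iio]
        linarith
      · intro k _ hk
        have := τ.le_singularValue_of_lt_trace_ramp hAN (hlpos k) (s := s) ?_
        · linarith
        · change 2 * ENNReal.ofReal s < n (2 ^ k * ε)
          rw [hna, ENNReal.ofReal_mul (by norm_num), ENNReal.ofReal_ofNat]
          refine (ENNReal.mul_lt_mul_iff_right (by norm_num) (by norm_num)).2 ?_
          exact (ENNReal.ofReal_lt_ofReal_iff (hs.1.trans_lt hk)).2 hk
    have hsum : ∑ k ∈ Finset.range K, 2 ^ k * ε * a k ≤ 8 * (D * Real.log (1 + M)) := by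
      have h1 := intervalIntegral.integral_mono_on hM0.le
        (IntervalIntegrable.sum (Finset.range K) (f := fun k s =>
          2 ^ k * ε * (Iio (a k)).indicator (fun _ => (1 : ℝ)) s)
          (fun k _ => (intervalIntegrable_indicator_Iio (a k) 0 M).const_mul _))
        ((τ.intervalIntegrable_singularValue A 0 M).const_mul 8)
        (by intro s hs; simpa only [Finset.sum_apply] using hpt s hs)
      simp only [Finset.sum_apply] at h1
      rw [intervalIntegral.integral_const_mul, intervalIntegral.integral_finsetSum
        (fun k _ => (intervalIntegrable_indicator_Iio (a k) 0 M).const_mul _)] at h1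
      simp only [intervalIntegral.integral_const_mul] at h1
      have h2 : ∀ k ∈ Finset.range K, 2 ^ k * ε *
          (∫ s in (0 : ℝ)..M, (Iio (a k)).indicator (fun _ => (1 : ℝ)) s) = 2 ^ k * ε * a k :=
        fun k _ => by rw [integral_indicator_Iio (ha0 k) (haM k)]
      rw [Finset.sum_congr rfl h2] at h1
      exact h1.trans (mul_le_mul_of_nonneg_left (hintegr M hM0) (by norm_num))
    have h4 : ∑ k ∈ Finset.range K, ENNReal.ofReal (2 * (2 ^ k * ε)) * n (2 ^ k * ε)
        = ENNReal.ofReal (4 * ∑ k ∈ Finset.range K, 2 ^ k * ε * a k) := by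
      rw [Finset.mul_sum, ENNReal.ofReal_sum_of_nonneg
        (fun k _ => mul_nonneg (by norm_num) (mul_nonneg (hlpos k).le (ha0 k)))]
      refine Finset.sum_congr rfl fun k _ => ?_
      rw [hna, ← ENNReal.ofReal_mul (by positivity)]
      congr 1
      ring
    rw [h4]
    refine ENNReal.ofReal_le_ofReal ?_
    have h5 : 1 + M = 2 + (8 * D / ε) ^ 2 := by rw [hM]; ring
    rw [h5] at hsum
    linarith
  obtain ⟨c, hc0, hc⟩ := exists_log_two_add_mul_le (a := 8 * D) (by positivity)
  refine ⟨hPN, hP0, 64 * D * c, by positivity, fun T hT => ?_⟩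
  refine (step3 T⁻¹ (by positivity)).trans (ENNReal.ofReal_le_ofReal ?_)
  have h1 : Real.log (2 + (8 * D / T⁻¹) ^ 2) ≤ Real.log ((2 + 8 * D * T) ^ 2) := by
    rw [div_inv_eq_mul]
    have : 0 < 8 * D * T := by positivity
    exact Real.log_le_log (by positivity) (by nlinarith)
  rw [Real.log_pow] at h1
  push_cast at h1
  have h2 := hc T hT.le
  nlinarith

/-- Conversely μ(s) is at most ε plus twice the sum of the dyadic levels 2ᵏε whose ramp has trace
greater than s. Integrating over [0, t] recovers a sum of ramp traces, which a single soft threshold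
controls. -/
theorem mem_dixmierIdeal_of_logBounded_abs (hA : A ∈ N) (h : τ.LogBounded (CFC.abs A)) :
    A ∈ τ.dixmierIdeal := by
  obtain ⟨hPN, hP0, C, hC0, hC⟩ := h
  set P := CFC.abs A with hP
  have hlarge : ∀ t : ℝ, 0 < t → ∫ s in (0 : ℝ)..t, τ.singularValue s A
      ≤ 4 + 16 * (C * Real.log (2 + t)) := by
    intro t ht
    -- Balances the two errors: tε = 4, and the threshold ε/4 becomes 1/t.
    set ε := 4 / t with hε
    have hε0 : 0 < ε := by positivity
    obtain ⟨K, hK⟩ := exists_norm_le_two_pow_mul P hε0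
    have hlpos : ∀ k : ℕ, 0 < 2 ^ k * ε := fun k => by positivity
    have hthr : τ.toFun (softThr P (ε / 4)) ≤ ENNReal.ofReal (C * Real.log (2 + t)) := by
      have : ε / 4 = t⁻¹ := by rw [hε]; field_simp
      rw [this]; exact hC t ht
    have hlog0 : 0 ≤ C * Real.log (2 + t) := mul_nonneg hC0 (log_two_add_pos ht.le).le
    have hsum : ∑ k ∈ Finset.range K,
        ENNReal.ofReal (2 ^ k * ε) * τ.toFun (cfc (ramp (2 ^ k * ε)) P)
        ≤ ENNReal.ofReal (8 * (C * Real.log (2 + t))) := by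
      refine (τ.sum_ramp_le_softThr hPN hP0 hε0 K).trans ?_
      rw [ENNReal.ofReal_mul (by norm_num), ENNReal.ofReal_ofNat]
      gcongr
    set b : ℕ → ℝ := fun k => (τ.toFun (cfc (ramp (2 ^ k * ε)) P)).toReal with hb
    have hb0 : ∀ k, 0 ≤ b k := fun k => ENNReal.toReal_nonneg
    have hfin : ∀ k ∈ Finset.range K, τ.toFun (cfc (ramp (2 ^ k * ε)) P)
        = ENNReal.ofReal (b k) := by
      intro k hk
      have h1 := ENNReal.sum_lt_top.1 (hsum.trans_lt ENNReal.ofReal_lt_top) k hk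
      rw [hb, ENNReal.ofReal_toReal]
      intro htop
      rw [htop, ENNReal.mul_top (by simpa using hlpos k)] at h1
      exact lt_irrefl _ h1
    have hsum' : ∑ k ∈ Finset.range K, 2 ^ k * ε * b k ≤ 8 * (C * Real.log (2 + t)) := by
      rw [← ENNReal.ofReal_le_ofReal_iff (by positivity), ENNReal.ofReal_sum_of_nonneg
        (fun k _ => mul_nonneg (hlpos k).le (hb0 k))]
      refine le_trans (le_of_eq (Finset.sum_congr rfl fun k hk => ?_)) hsum
      rw [hfin k hk, ← ENNReal.ofReal_mul (hlpos k).le]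
    have hpt : ∀ s ∈ Icc (0 : ℝ) t, τ.singularValue s A ≤ ε + ∑ k ∈ Finset.range K,
        2 * (2 ^ k * ε) * (Iio (b k)).indicator (fun _ => (1 : ℝ)) s := by
      intro s hs
      have h1 := le_dyadic_indicator_sum (m := τ.singularValue s A) hε0 (fun k => s < b k) K ?_ ?_
      · simpa only [indicator_apply, mem_Iio] using h1
      · refine (τ.singularValue_le_norm s A).trans ?_
        rwa [hP, CFC.norm_abs] at hK
      · intro k hk hkb
        refine τ.singularValue_le_of_trace_ramp_le hA (hlpos k) ?_
        change τ.toFun (cfc (ramp (2 ^ k * ε)) P) ≤ _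
        rw [hfin k (Finset.mem_range.2 hk)]
        exact ENNReal.ofReal_le_ofReal (not_lt.1 hkb)
    have hi : ∀ k ∈ Finset.range K, IntervalIntegrable (fun s =>
        2 * (2 ^ k * ε) * (Iio (b k)).indicator (fun _ => (1 : ℝ)) s) volume 0 t :=
      fun k _ => (intervalIntegrable_indicator_Iio (b k) 0 t).const_mul _
    have hi' := IntervalIntegrable.sum (Finset.range K) hi
    have h1 := intervalIntegral.integral_mono_on ht.le (τ.intervalIntegrable_singularValue A 0 t)
      ((intervalIntegrable_const (c := ε)).add hi')
      (by intro s hs; simpa only [Pi.add_apply, Finset.sum_apply] using hpt s hs)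
    simp only [Finset.sum_apply] at h1
    rw [intervalIntegral.integral_add intervalIntegrable_const
      (by simpa only [Finset.sum_fn] using hi'), intervalIntegral.integral_finsetSum hi,
      intervalIntegral.integral_const, sub_zero, smul_eq_mul] at h1
    simp only [intervalIntegral.integral_const_mul] at h1
    have h2 : ∑ k ∈ Finset.range K, 2 * (2 ^ k * ε) *
        (∫ s in (0 : ℝ)..t, (Iio (b k)).indicator (fun _ => (1 : ℝ)) s)
        ≤ ∑ k ∈ Finset.range K, 2 * (2 ^ k * ε * b k) := by
      refine Finset.sum_le_sum fun k _ => ?_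
      rw [mul_assoc]
      refine mul_le_mul_of_nonneg_left (mul_le_mul_of_nonneg_left
        (integral_indicator_Iio_le (hb0 k) ht.le) (hlpos k).le) (by norm_num)
    rw [← Finset.mul_sum] at h2
    have h3 : t * ε = 4 := by rw [hε]; field_simp
    linarith
  have hl2 : 0 < Real.log 2 := Real.log_pos (by norm_num)
  refine ⟨hA, max (2 * ‖A‖) (4 / Real.log 2 + 32 * C), fun t ht => ?_⟩
  have hlog : 0 < Real.log (1 + t) := Real.log_pos (by linarith)
  rw [inv_mul_le_iff₀ hlog]
  -- For small t the denominator log(1 + t) vanishes linearly and boundedness of A is used; for t ≥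
  -- 1 additive constants are absorbed through log 2 ≤ log(1 + t).
  rcases le_total t 1 with h1 | h1
  · have h2 : ∫ s in (0 : ℝ)..t, τ.singularValue s A ≤ ∫ _ in (0 : ℝ)..t, ‖A‖ :=
      intervalIntegral.integral_mono_on ht.le (τ.intervalIntegrable_singularValue A 0 t)
        intervalIntegrable_const fun s _ => τ.singularValue_le_norm s A
    rw [intervalIntegral.integral_const, sub_zero, smul_eq_mul] at h2
    have h3 := half_le_log_one_add ht.le h1
    have h4 : Real.log (1 + t) * (2 * ‖A‖)
        ≤ Real.log (1 + t) * max (2 * ‖A‖) (4 / Real.log 2 + 32 * C) :=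
      mul_le_mul_of_nonneg_left (le_max_left _ _) hlog.le
    nlinarith [norm_nonneg A]
  · have h2 := hlarge t ht
    have h3 : Real.log (2 + t) ≤ 2 * Real.log (1 + t) := by
      have : Real.log (2 + t) ≤ Real.log ((1 + t) ^ 2) :=
        Real.log_le_log (by positivity) (by nlinarith)
      rw [Real.log_pow] at this
      exact_mod_cast this
    have h4 : Real.log 2 ≤ Real.log (1 + t) := Real.log_le_log (by norm_num) (by linarith)
    have h5 : 4 ≤ Real.log (1 + t) * (4 / Real.log 2) := by
      rw [mul_div_assoc', le_div_iff₀ hl2]; linarith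
    have h6 : Real.log (1 + t) * (4 / Real.log 2 + 32 * C)
        ≤ Real.log (1 + t) * max (2 * ‖A‖) (4 / Real.log 2 + 32 * C) :=
      mul_le_mul_of_nonneg_left (le_max_right _ _) hlog.le
    nlinarith [mul_le_mul_of_nonneg_left h3 hC0]

variable {τ}

/-! ### Stability properties of log-bounded operators -/

namespace LogBounded

theorem isSelfAdjoint (h : τ.LogBounded P) : IsSelfAdjoint P := isSelfAdjoint_of_nonneg h.nonneg

theorem softThr_lt_top (h : τ.LogBounded P) {ε : ℝ} (hε : 0 < ε) :
    τ.toFun (softThr P ε) < ∞ := by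
  obtain ⟨C, -, hC⟩ := h.bound
  have := hC ε⁻¹ (by positivity)
  rw [inv_inv] at this
  exact this.trans_lt ENNReal.ofReal_lt_top

/-- A fixed factor in the threshold only rescales T, which costs a constant in log(2 + T). -/
theorem of_le (h : τ.LogBounded Q) (hP : P ∈ N) (hP0 : 0 ≤ P) {a b : ℝ} (ha : 0 < a) (hb : 0 ≤ b)
    (hle : ∀ ε : ℝ, 0 < ε → τ.toFun (softThr P (a * ε)) ≤ ENNReal.ofReal b * τ.toFun (softThr Q ε)) :
    τ.LogBounded P := by
  obtain ⟨C, hC0, hC⟩ := h.bound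
  obtain ⟨c, hc0, hc⟩ := exists_log_two_add_mul_le ha.le
  refine ⟨hP, hP0, b * (C * c), by positivity, fun T hT => ?_⟩
  have h1 := hle (a * T)⁻¹ (by positivity)
  have h2 : a * (a * T)⁻¹ = T⁻¹ := by field_simp
  rw [h2] at h1
  refine h1.trans ?_
  rw [mul_assoc, ENNReal.ofReal_mul hb]
  gcongr
  refine (hC (a * T) (by positivity)).trans (ENNReal.ofReal_le_ofReal ?_)
  rw [mul_assoc]
  exact mul_le_mul_of_nonneg_left (hc T hT.le) hC0

theorem add (hP : τ.LogBounded P) (hQ : τ.LogBounded Q) : τ.LogBounded (P + Q) := by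
  obtain ⟨C, hC0, hC⟩ := hP.bound
  obtain ⟨D, hD0, hD⟩ := hQ.bound
  obtain ⟨c, hc0, hc⟩ := exists_log_two_add_mul_le (a := 2) (by norm_num)
  refine ⟨add_mem hP.mem hQ.mem, add_nonneg hP.nonneg hQ.nonneg, C * c + D * c, by positivity,
    fun T hT => ?_⟩
  have hl := (log_two_add_pos hT.le).le
  have h2 : T⁻¹ = (2 * T)⁻¹ + (2 * T)⁻¹ := by field_simp; norm_num
  rw [h2, add_mul, ENNReal.ofReal_add (by positivity) (by positivity)]
  refine (τ.softThr_add_le hP.mem hP.isSelfAdjoint hQ.mem hQ.isSelfAdjoint _ _).trans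
    (add_le_add ?_ ?_)
  · refine (hC (2 * T) (by positivity)).trans (ENNReal.ofReal_le_ofReal ?_)
    rw [mul_assoc]
    exact mul_le_mul_of_nonneg_left (hc T hT.le) hC0
  · refine (hD (2 * T) (by positivity)).trans (ENNReal.ofReal_le_ofReal ?_)
    rw [mul_assoc]
    exact mul_le_mul_of_nonneg_left (hc T hT.le) hD0

theorem zero : τ.LogBounded (0 : H →L[ℂ] H) := by
  refine ⟨zero_mem N, le_rfl, 0, le_rfl, fun T hT => ?_⟩
  have : softThr (0 : H →L[ℂ] H) T⁻¹ = 0 :=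
    le_antisymm (softThr_le le_rfl (by positivity)) (softThr_nonneg _ _)
  rw [this, τ.map_zero]
  exact zero_le

theorem smul (hP : τ.LogBounded P) {c : ℝ} (hc : 0 ≤ c) : τ.LogBounded (c • P) := by
  rcases hc.eq_or_lt with rfl | hc'
  · rw [zero_smul]; exact zero
  · refine hP.of_le (rsmul_mem _ hP.mem) (smul_nonneg hc hP.nonneg) hc' hc fun ε _ => ?_
    rw [softThr_smul P hc, τ.map_smul _ hc _ (softThr_mem hP.mem _) (softThr_nonneg _ _)]

/-- The heredity that lets additive functionals on this cone be extended linearly. -/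
theorem posPart_of_le (hY : τ.LogBounded Y) (hX : X ∈ N) (hXs : IsSelfAdjoint X) (h : X ≤ Y) :
    τ.LogBounded X⁺ := by
  refine hY.of_le (posPart_mem hX) (CFC.posPart_nonneg X) one_pos zero_le_one fun ε hε => ?_
  rw [one_mul, ENNReal.ofReal_one, one_mul, softThr_posPart hXs hε.le]
  exact τ.softThr_mono hX hXs hY.mem hY.isSelfAdjoint h ε

theorem conj (hP : τ.LogBounded P) {K : H →L[ℂ] H} (hK : K ∈ N) :
    τ.LogBounded (star K * P * K) := by
  set r := ‖K‖ + 1 with hr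
  have hr0 : 0 < r := by positivity
  have hK1 : ‖r⁻¹ • K‖ ≤ 1 := by
    rw [norm_smul, norm_inv, Real.norm_eq_abs, abs_of_pos hr0, inv_mul_le_iff₀ hr0]
    linarith
  have hKN := rsmul_mem r⁻¹ hK
  have h1 : τ.LogBounded (star (r⁻¹ • K) * P * (r⁻¹ • K)) := by
    refine hP.of_le (mul_mem (mul_mem (star_mem hKN) hP.mem) hKN) (conj_nonneg' hP.nonneg _) one_pos
      zero_le_one fun ε hε => ?_
    rw [one_mul, ENNReal.ofReal_one, one_mul]
    exact (τ.softThr_conj_le hP.mem hP.isSelfAdjoint hKN hK1 hε.le).trans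
      (τ.conj_le (softThr_mem hP.mem _) (softThr_nonneg _ _) hKN hK1)
  have h2 := h1.smul (c := r * r) (by positivity)
  convert h2 using 1
  rw [star_smul, star_trivial (r⁻¹ : ℝ), smul_mul_assoc, smul_mul_assoc, mul_smul_comm, smul_smul, smul_smul,
    show r * r * r⁻¹ * r⁻¹ = 1 by field_simp, one_smul]

theorem mem_dixmierIdeal (hP : τ.LogBounded P) : P ∈ τ.dixmierIdeal := by
  refine τ.mem_dixmierIdeal_of_logBounded_abs hP.mem ?_
  rwa [CFC.abs_of_nonneg P hP.nonneg]

theorem posPart_realPart (hA : A ∈ N) (h : τ.LogBounded (CFC.abs A)) {V : H →L[ℂ] H} (hV : V ∈ N)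
    (hV1 : ‖V‖ ≤ 1) : τ.LogBounded (ℜ (V * A) : H →L[ℂ] H)⁺ := by
  have hm := realPart_mem (mul_mem hV hA)
  refine h.of_le (posPart_mem hm) (CFC.posPart_nonneg _) two_pos zero_le_one fun ε hε => ?_
  rw [ENNReal.ofReal_one, one_mul, softThr_posPart (ℜ (V * A)).2 (by positivity)]
  have := τ.softThr_realPart_le hA hV (one_mem N) hV1 ContinuousLinearMap.norm_id_le hε
  rwa [mul_one] at this

end LogBounded

/-- The four parts are the positive parts of ℜ(cA) for c = 1, -1, -i, i. -/
theorem logBounded_of_mem_jordanParts (hA : A ∈ τ.dixmierIdeal) (hP : P ∈ jordanParts A) :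
    τ.LogBounded P := by
  have h := τ.logBounded_abs hA
  have hAN := hA.1
  have key : ∀ c : ℂ, ‖c‖ ≤ 1 → τ.LogBounded (ℜ (c • A) : H →L[ℂ] H)⁺ := by
    intro c hc
    have := LogBounded.posPart_realPart hAN h (V := c • 1) (csmul_mem c (one_mem N)) ?_
    · rwa [smul_mul_assoc, one_mul] at this
    · rw [norm_smul]
      exact mul_le_one₀ hc (norm_nonneg _) ContinuousLinearMap.norm_id_le
  rcases hP with rfl | rfl | rfl | rfl
  · simpa using key 1 (by simp)
  · have := key (-1) (by simp)
    simpa only [neg_smul, one_smul, _root_.map_neg, NegMemClass.coe_neg, CFC.posPart_neg] using this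
  · have := key (-Complex.I) (by simp)
    rwa [neg_smul, _root_.map_neg, realPart_I_smul, neg_neg] at this
  · have := key Complex.I (by simp)
    rwa [realPart_I_smul, NegMemClass.coe_neg, CFC.posPart_neg] at this

theorem mul_mem_dixmierIdeal (hA : A ∈ τ.dixmierIdeal) (hB : B ∈ N) :
    A * B ∈ τ.dixmierIdeal := by
  have hAN := hA.1
  set r := ‖B‖ + 1 with hr
  have hr0 : 0 < r := by positivity
  have hB1 : ‖r⁻¹ • B‖ ≤ 1 := by
    rw [norm_smul, norm_inv, Real.norm_eq_abs, abs_of_pos hr0, inv_mul_le_iff₀ hr0]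
    linarith
  have hAB : A * B = (r • A) * (r⁻¹ • B) := by
    rw [smul_mul_assoc, mul_smul_comm, smul_smul, mul_inv_cancel₀ hr0.ne', one_smul]
  have habs : CFC.abs (r • A) = r • CFC.abs A := by
    rw [CFC.abs_smul, Real.norm_eq_abs, abs_of_pos hr0]
  have h1 : τ.LogBounded (CFC.abs (r • A)) := by
    rw [habs]; exact (τ.logBounded_abs hA).smul hr0.le
  refine τ.mem_dixmierIdeal_of_logBounded_abs (mul_mem hAN hB) ?_
  refine h1.of_le (abs_mem (mul_mem hAN hB)) (CFC.abs_nonneg _) (a := 3) (by norm_num) zero_le_one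
    fun ε hε => ?_
  rw [ENNReal.ofReal_one, one_mul, hAB]
  exact τ.softThr_abs_mul_le (rsmul_mem r hAN) (rsmul_mem _ hB) hB1 hε

end FNSTrace

end NCHeat

namespace NCHeat

variable {H : Type*} [NormedAddCommGroup H] [InnerProductSpace ℂ H] [CompleteSpace H]

/-! ### The trace of `min(T P², P)` -/

/-- The function equal to `min(T x², x)` for `x ≥ 0`, `T > 0`. -/
def quadCut (T x : ℝ) : ℝ := x ^ 2 * (max x T⁻¹)⁻¹

theorem continuous_inv_max {T : ℝ} (hT : 0 < T) : Continuous fun x : ℝ => (max x T⁻¹)⁻¹ := by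
  refine Continuous.inv₀ (by fun_prop) fun x => ?_
  have : 0 < max x T⁻¹ := lt_max_of_lt_right (by positivity)
  exact this.ne'

theorem continuous_quadCut {T : ℝ} (hT : 0 < T) : Continuous (quadCut T) :=
  (continuous_pow 2).mul (continuous_inv_max hT)

theorem inv_max_nonneg {T : ℝ} (hT : 0 < T) (x : ℝ) : 0 ≤ (max x T⁻¹)⁻¹ := by
  have : 0 < max x T⁻¹ := lt_max_of_lt_right (by positivity)
  positivity

theorem quadCut_nonneg {T : ℝ} (hT : 0 < T) (x : ℝ) : 0 ≤ quadCut T x :=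
  mul_nonneg (sq_nonneg x) (inv_max_nonneg hT x)

theorem quadCut_le_mul_sq {T : ℝ} (hT : 0 < T) (x : ℝ) : quadCut T x ≤ T * x ^ 2 := by
  have h : (max x T⁻¹)⁻¹ ≤ T := inv_le_of_inv_le₀ hT (le_max_right _ _)
  rw [quadCut, mul_comm]
  exact mul_le_mul_of_nonneg_right h (sq_nonneg x)

theorem quadCut_le {T x : ℝ} (hT : 0 < T) (hx : 0 ≤ x) : quadCut T x ≤ x := by
  have h0 : 0 < max x T⁻¹ := lt_max_of_lt_right (by positivity)
  rw [quadCut, ← div_eq_mul_inv, div_le_iff₀ h0, sq]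
  exact mul_le_mul_of_nonneg_left (le_max_left _ _) hx

/-- For x between 2^{-j}/T and 2^{1-j}/T the j-th term alone suffices: Tx² ≤ 2·2^{-j}x, and
subtracting 2^{-j-1}/T leaves at least half of x. -/
theorem quadCut_le_sum {T x : ℝ} (hT : 0 < T) (J : ℕ) (hx : (2 ^ J * T)⁻¹ ≤ x) :
    quadCut T x ≤ ∑ j ∈ Finset.range (J + 1),
      4 * (2 ^ j)⁻¹ * max (x - (2 ^ (j + 1) * T)⁻¹) 0 := by
  induction J with
  | zero =>
    have hx0 : 0 < T⁻¹ := by positivity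
    simp only [pow_zero, one_mul] at hx
    simp only [zero_add, Finset.sum_range_one, pow_zero, inv_one, mul_one, pow_one, mul_inv]
    have h1 := quadCut_le hT (hx0.le.trans hx)
    have h2 := le_max_left (x - 2⁻¹ * T⁻¹) 0
    linarith
  | succ J ih =>
    rw [Finset.sum_range_succ]
    rcases le_total (2 ^ J * T)⁻¹ x with h | h
    · refine (ih h).trans (le_add_of_nonneg_right ?_)
      positivity
    · have hs : 0 ≤ ∑ j ∈ Finset.range (J + 1),
          4 * (2 ^ j : ℝ)⁻¹ * max (x - (2 ^ (j + 1) * T)⁻¹) 0 :=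
        Finset.sum_nonneg fun j _ => by positivity
      have h1 := quadCut_le_mul_sq hT x
      set a := (2 ^ (J + 1) : ℝ)⁻¹ with ha
      have ha0 : 0 < a := by positivity
      have e1 : (2 ^ (J + 1) * T)⁻¹ = a * T⁻¹ := by rw [ha, mul_inv]
      have e2 : (2 ^ J * T)⁻¹ = 2 * a * T⁻¹ := by
        rw [ha, mul_inv, pow_succ, mul_inv]; ring
      have e3 : (2 ^ (J + 1 + 1) * T)⁻¹ = a / 2 * T⁻¹ := by
        rw [ha, mul_inv, pow_succ, mul_inv]; ring
      rw [e1] at hx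
      rw [e2] at h
      rw [e3]
      have h2 := le_max_left (x - a / 2 * T⁻¹) 0
      have h3 : 0 < a * T⁻¹ := by positivity
      have h4 : T * x ≤ 2 * a := by
        have := mul_le_mul_of_nonneg_left h hT.le
        have e : T * (2 * a * T⁻¹) = 2 * a := by field_simp
        linarith
      have h5 : T * x ^ 2 ≤ 2 * a * x := by
        have : 0 ≤ x := h3.le.trans hx
        nlinarith
      have h6 : 2 * a * x ≤ 4 * a * (x - a / 2 * T⁻¹) := by nlinarith
      have h7 := mul_le_mul_of_nonneg_left h2 (by positivity : 0 ≤ 4 * a)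
      linarith

theorem sum_add_two_div_two_pow (J : ℕ) :
    ∑ j ∈ Finset.range J, ((j : ℝ) + 2) * (2 ^ j)⁻¹ = 6 - 2 * (J + 3) * (2 ^ J)⁻¹ := by
  induction J with
  | zero => norm_num
  | succ J ih =>
    rw [Finset.sum_range_succ, ih, pow_succ, mul_inv]
    push_cast
    ring

namespace FNSTrace

variable {N : VonNeumannAlgebra H} {τ : FNSTrace N} {P S : H →L[ℂ] H}

theorem LogBounded.trace_quadCut_le (h : τ.LogBounded P) : ∃ C : ℝ, 0 ≤ C ∧ ∀ T : ℝ, 0 < T →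
    τ.toFun (cfc (quadCut T) P) ≤ ENNReal.ofReal (C * Real.log (2 + T)) := by
  obtain ⟨C, hC0, hC⟩ := h.bound
  -- 24 = 4·6, where 6 is the sum of (j + 2)2^{-j}; the factor j + 2 bounds log(2 + 2^{j+1}T)/log(2
  -- + T).
  refine ⟨24 * C, by positivity, fun T hT => ?_⟩
  have hPs := h.isSelfAdjoint
  have hcq := continuous_quadCut hT
  refine τ.le_of_softThr_le (cfc_mem h.mem _) (cfc_nonneg fun x _ => quadCut_nonneg hT x)
    fun δ hδ => ?_
  -- Below 2^{-J}/T ≤ δ the function is at most δ and the threshold δ kills it, so finitely many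
  -- dyadic terms are enough; normality then removes δ.
  obtain ⟨J, hJ⟩ := pow_unbounded_of_one_lt ((T * δ)⁻¹) (by norm_num : (1 : ℝ) < 2)
  have hlog0 : 0 < Real.log (2 + T) := log_two_add_pos hT.le
  obtain ⟨h1, -, h3⟩ := τ.map_sum_smul (J + 1) (fun j => 4 * (2 ^ j)⁻¹) (fun j => by positivity)
    (fun j => softThr P (2 ^ (j + 1) * T)⁻¹) (fun j => softThr_mem h.mem _)
    (fun j => softThr_nonneg _ _)
  have hop : softThr (cfc (quadCut T) P) δ ≤ ∑ j ∈ Finset.range (J + 1),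
      (4 * (2 ^ j)⁻¹ : ℝ) • softThr P (2 ^ (j + 1) * T)⁻¹ := by
    have e1 : ∑ j ∈ Finset.range (J + 1), (4 * (2 ^ j)⁻¹ : ℝ) • softThr P (2 ^ (j + 1) * T)⁻¹
        = cfc (fun x => ∑ j ∈ Finset.range (J + 1),
          4 * (2 ^ j)⁻¹ * max (x - (2 ^ (j + 1) * T)⁻¹) 0) P := by
      have hs := cfc_sum (fun (j : ℕ) (x : ℝ) => 4 * (2 ^ j)⁻¹ * max (x - (2 ^ (j + 1) * T)⁻¹) 0) P
        (Finset.range (J + 1)) (fun j _ => by fun_prop)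
      rw [Finset.sum_fn] at hs
      rw [hs]
      refine Finset.sum_congr rfl fun j _ => ?_
      rw [softThr_eq_cfc hPs, ← cfc_smul _ _ P (by fun_prop)]
      rfl
    rw [e1, softThr_eq_cfc IsSelfAdjoint.cfc,
      ← cfc_comp (fun x : ℝ => max (x - δ) 0) (quadCut T) P hPs (by fun_prop) hcq.continuousOn]
    refine cfc_mono (fun x hx => ?_) (by fun_prop) (by fun_prop)
    have hx0 : 0 ≤ x := spectrum_nonneg_of_nonneg h.nonneg hx
    have hnn : 0 ≤ ∑ j ∈ Finset.range (J + 1),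
        4 * (2 ^ j : ℝ)⁻¹ * max (x - (2 ^ (j + 1) * T)⁻¹) 0 :=
      Finset.sum_nonneg fun j _ => by positivity
    refine max_le ?_ hnn
    rcases le_total (2 ^ J * T)⁻¹ x with hc | hc
    · exact (sub_le_self _ hδ.le).trans (quadCut_le_sum hT J hc)
    · refine le_trans ?_ hnn
      rw [sub_nonpos]
      have h5 : (2 ^ J * T)⁻¹ ≤ δ := by
        rw [inv_le_comm₀ (by positivity) hδ]
        have : (T * δ)⁻¹ * T = δ⁻¹ := by field_simp
        rw [← this]
        exact mul_le_mul_of_nonneg_right hJ.le hT.le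
      exact (quadCut_le hT hx0).trans (hc.trans h5)
  refine (τ.mono (softThr_mem (cfc_mem h.mem _) _) h1 (softThr_nonneg _ _) hop).trans ?_
  rw [h3]
  have hterm : ∀ j ∈ Finset.range (J + 1), ENNReal.ofReal (4 * (2 ^ j)⁻¹) *
      τ.toFun (softThr P (2 ^ (j + 1) * T)⁻¹)
      ≤ ENNReal.ofReal (4 * C * Real.log (2 + T) * (((j : ℝ) + 2) * (2 ^ j)⁻¹)) := by
    intro j _
    have h4 := hC (2 ^ (j + 1) * T) (by positivity)
    have h5 : Real.log (2 + 2 ^ (j + 1) * T) ≤ ((j : ℝ) + 2) * Real.log (2 + T) := by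
      have h6 : Real.log (2 + 2 ^ (j + 1) * T) ≤ Real.log (2 ^ (j + 1) * (2 + T)) := by
        refine Real.log_le_log (by positivity) ?_
        have : (1 : ℝ) ≤ 2 ^ (j + 1) := one_le_pow₀ (by norm_num)
        nlinarith
      rw [Real.log_mul (by positivity) (by positivity), Real.log_pow] at h6
      have h7 := log_two_le hT.le
      push_cast at h6
      have h8 : ((j : ℝ) + 1) * Real.log 2 ≤ ((j : ℝ) + 1) * Real.log (2 + T) :=
        mul_le_mul_of_nonneg_left h7 (by positivity)
      linarith
    refine (mul_le_mul_right (h4.trans (ENNReal.ofReal_le_ofReal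
      (mul_le_mul_of_nonneg_left h5 hC0))) _).trans ?_
    rw [← ENNReal.ofReal_mul (by positivity)]
    refine ENNReal.ofReal_le_ofReal (le_of_eq ?_)
    ring
  refine (Finset.sum_le_sum hterm).trans ?_
  rw [← ENNReal.ofReal_sum_of_nonneg (fun j _ => by positivity), ← Finset.mul_sum,
    sum_add_two_div_two_pow]
  refine ENNReal.ofReal_le_ofReal ?_
  have h9 : 0 ≤ 2 * (((J + 1 : ℕ) : ℝ) + 3) * (2 ^ (J + 1))⁻¹ := by positivity
  have h10 : 0 ≤ 4 * C * Real.log (2 + T) := by positivity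
  nlinarith

/-! ### Spectral measures -/

-- On the compact spectrum of P, k ↦ τ(S* k(P) S) is a positive linear functional, finite because
-- τ(S*S) is; Riesz–Markov represents it. The measure is then pushed forward to the real line.
open scoped CompactlySupported in
theorem exists_spectralMeasure (hP : P ∈ N) (hP0 : 0 ≤ P) (hS : S ∈ N)
    (hS2 : τ.toFun (star S * S) < ∞) : ∃ m : Measure ℝ, IsFiniteMeasure m ∧ (∀ᵐ x ∂m, 0 ≤ x) ∧
      ∀ k : ℝ → ℝ, ContinuousOn k (Ici 0) → (∀ x, 0 ≤ x → 0 ≤ k x) →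
        τ.toFun (star S * cfc k P * S) = ∫⁻ x, ENNReal.ofReal (k x) ∂m := by
  have hPs := isSelfAdjoint_of_nonneg hP0
  have hsp : ∀ x ∈ spectrum ℝ P, 0 ≤ x := fun x hx => spectrum_nonneg_of_nonneg hP0 hx
  set E := spectrum ℝ P with hE
  let r : C_c(E, NNReal) → C(E, ℝ) := fun h => ⟨fun x => (h x : ℝ), by fun_prop⟩
  let F : C_c(E, NNReal) → (H →L[ℂ] H) := fun h => star S * cfcHom hPs (r h) * S
  have hmem0 : ∀ g : C(E, ℝ), cfcHom hPs g ∈ N := fun g => by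
    rw [cfcHom_eq_cfc_extend (R := ℝ) 0]
    exact cfc_mem hP _
  have hmem : ∀ h, F h ∈ N := fun h => mul_mem (mul_mem (star_mem hS) (hmem0 _)) hS
  have hr0 : ∀ h, 0 ≤ r h := fun h x => (h x).2
  have hnn : ∀ h, 0 ≤ F h := fun h =>
    conj_nonneg' ((cfcHom_nonneg_iff hPs).2 (hr0 h)) S
  have hfin : ∀ h, τ.toFun (F h) < ∞ := by
    intro h
    have h1 : r h ≤ ‖r h‖ • (1 : C(E, ℝ)) := fun x => by
      simpa using (le_abs_self _).trans ((r h).norm_coe_le_norm x)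
    have h2 : cfcHom hPs (r h) ≤ ‖r h‖ • (1 : H →L[ℂ] H) := by
      have := cfcHom_mono hPs h1
      rwa [_root_.map_smul, map_one] at this
    have h3 : F h ≤ ‖r h‖ • (star S * S) := by
      have := conj_mono h2 S
      rwa [mul_smul_comm, mul_one, smul_mul_assoc] at this
    refine (τ.mono (hmem h) (rsmul_mem _ (mul_mem (star_mem hS) hS)) (hnn h) h3).trans_lt ?_
    rw [τ.map_smul _ (norm_nonneg _) _ (mul_mem (star_mem hS) hS) (star_mul_self_nonneg S)]
    exact ENNReal.mul_lt_top ENNReal.ofReal_lt_top hS2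
  let L : C_c(E, NNReal) →ₗ[NNReal] NNReal :=
    { toFun := fun h => (τ.toFun (F h)).toNNReal
      map_add' := fun g h => by
        have : F (g + h) = F g + F h := by
          have e : r (g + h) = r g + r h := by ext x; simp [r]
          simp only [F, e, _root_.map_add, mul_add, add_mul]
        rw [this, τ.map_add _ (hmem g) _ (hmem h) (hnn g) (hnn h),
          ENNReal.toNNReal_add (hfin g).ne (hfin h).ne]
      map_smul' := fun c h => by
        have : F (c • h) = (c : ℝ) • F h := by
          have e : r (c • h) = (c : ℝ) • r h := by ext x; simp [r]
          simp only [F, e, _root_.map_smul, mul_smul_comm, smul_mul_assoc]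
        rw [this, τ.map_smul _ (NNReal.coe_nonneg c) _ (hmem h) (hnn h), ENNReal.toNNReal_mul]
        simp }
  set m₀ := NNRealRMK.rieszMeasure L with hm₀
  have hm₀ : ∀ h : C_c(E, NNReal), ∫⁻ x, (h x : ℝ≥0∞) ∂m₀ = τ.toFun (F h) := fun h => by
    rw [NNRealRMK.lintegral_rieszMeasure]
    exact ENNReal.coe_toNNReal (hfin h).ne
  have hkey : ∀ k : ℝ → ℝ, ContinuousOn k (Ici 0) → (∀ x, 0 ≤ x → 0 ≤ k x) →
      τ.toFun (star S * cfc k P * S) = ∫⁻ x : E, ENNReal.ofReal (k x) ∂m₀ := by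
    intro k hk hk0
    have hkE : ContinuousOn k E := hk.mono fun x hx => hsp x hx
    let h : C_c(E, NNReal) :=
      ⟨⟨fun x => (k x).toNNReal, (continuous_real_toNNReal.comp hkE.domRestrict)⟩,
        HasCompactSupport.of_compactSpace _⟩
    have e : F h = star S * cfc k P * S := by
      rw [cfc_apply k P hPs hkE]
      simp only [F]
      congr 3
      ext x
      exact Real.coe_toNNReal _ (hk0 _ (hsp _ x.2))
    rw [← e, ← hm₀ h]
    rfl
  refine ⟨m₀.map Subtype.val, inferInstance, ?_, fun k hk hk0 => ?_⟩
  · rw [ae_map_iff measurable_subtype_coe.aemeasurable measurableSet_Ici]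
    exact Eventually.of_forall fun x => hsp _ x.2
  · have hEm : MeasurableSet E := (isCompact_iff_compactSpace.2 inferInstance : IsCompact E).measurableSet
    rw [hkey k hk hk0, (MeasurableEmbedding.subtype_coe hEm).lintegral_map]

end FNSTrace

end NCHeat

namespace NCHeat

/-! ### Evaluation of generalised limits -/

theorem memLInfty_iff {u : ℝ → ℝ} : MemLInfty u ↔
    AEMeasurable u (volume.restrict (Ioi 0)) ∧ ∃ C : ℝ, ∀ t : ℝ, 0 < t → |u t| ≤ C := by
  rw [aemeasurable_restrict_iff_comap_subtype measurableSet_Ioi]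
  refine and_congr Iff.rfl (exists_congr fun C => ?_)
  exact ⟨fun h t ht => h ⟨t, ht⟩, fun h t => h t t.2⟩

theorem memLInfty_of_measurable {u : ℝ → ℝ} (hu : Measurable u) {C : ℝ}
    (h : ∀ t : ℝ, 0 < t → |u t| ≤ C) : MemLInfty u :=
  memLInfty_iff.2 ⟨hu.aemeasurable, C, h⟩

theorem MemLInfty.add {u v : ℝ → ℝ} (hu : MemLInfty u) (hv : MemLInfty v) :
    MemLInfty fun t => u t + v t :=
  LInfty.add_mem hu hv

theorem MemLInfty.const_mul {u : ℝ → ℝ} (hu : MemLInfty u) (c : ℝ) :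
    MemLInfty fun t => c * u t :=
  LInfty.smul_mem c hu

theorem MemLInfty.congr {u v : ℝ → ℝ} (hu : MemLInfty u) (h : ∀ t, 0 < t → v t = u t) :
    MemLInfty v := by
  have : (fun t : HalfLine => v t) = fun t : HalfLine => u t := funext fun t => h t t.2
  rw [MemLInfty, this]
  exact hu

theorem MemLInfty.mul {u v : ℝ → ℝ} (hu : MemLInfty u) (hv : MemLInfty v) :
    MemLInfty fun t => u t * v t := by
  obtain ⟨h1, C, hC⟩ := memLInfty_iff.1 hu
  obtain ⟨h2, D, hD⟩ := memLInfty_iff.1 hv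
  refine memLInfty_iff.2 ⟨h1.mul h2, C * D, fun t ht => ?_⟩
  rw [abs_mul]
  exact mul_le_mul (hC t ht) (hD t ht) (abs_nonneg _) ((abs_nonneg _).trans (hC t ht))

theorem MemLInfty.sum {ι : Type*} (s : Finset ι) {u : ι → ℝ → ℝ} (hu : ∀ i ∈ s, MemLInfty (u i)) :
    MemLInfty fun t => ∑ i ∈ s, u i t := by
  have h := LInfty.sum_mem (t := s) (f := fun i (t : HalfLine) => u i t) hu
  have e : (fun t : HalfLine => ∑ i ∈ s, u i t) = ∑ i ∈ s, fun t : HalfLine => u i t := by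
    ext t; simp
  rw [MemLInfty, e]
  exact h

variable {ω : LInfty →ₗ[ℝ] ℝ} {u v : ℝ → ℝ}

theorem evalAt_of_mem (hu : MemLInfty u) : evalAt ω u = ω ⟨fun t : HalfLine => u t, hu⟩ := by
  rw [evalAt, dif_pos hu]

theorem evalAt_add (hu : MemLInfty u) (hv : MemLInfty v) :
    evalAt ω (fun t => u t + v t) = evalAt ω u + evalAt ω v := by
  rw [evalAt_of_mem hu, evalAt_of_mem hv, evalAt_of_mem (hu.add hv), ← map_add]
  rfl

theorem evalAt_const_mul (hu : MemLInfty u) (c : ℝ) :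
    evalAt ω (fun t => c * u t) = c * evalAt ω u := by
  rw [evalAt_of_mem hu, evalAt_of_mem (hu.const_mul c), ← smul_eq_mul c (ω _), ← map_smul]
  rfl

theorem evalAt_zero : evalAt ω (fun _ => 0) = 0 := by
  have h : MemLInfty fun _ => (0 : ℝ) := LInfty.zero_mem
  rw [evalAt_of_mem h]
  exact map_zero ω

theorem evalAt_sum {ι : Type*} (s : Finset ι) {u : ι → ℝ → ℝ} (hu : ∀ i ∈ s, MemLInfty (u i)) :
    evalAt ω (fun t => ∑ i ∈ s, u i t) = ∑ i ∈ s, evalAt ω (u i) := by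
  classical
  induction s using Finset.induction_on with
  | empty => simpa using evalAt_zero
  | insert i s hi ih =>
    simp only [Finset.sum_insert hi]
    rw [evalAt_add (hu i (Finset.mem_insert_self i s))
      (MemLInfty.sum s fun j hj => hu j (Finset.mem_insert_of_mem hj)),
      ih fun j hj => hu j (Finset.mem_insert_of_mem hj)]

theorem evalAt_congr (h : ∀ t, 0 < t → u t = v t) : evalAt ω u = evalAt ω v := by
  have e : (fun t : HalfLine => u t) = fun t : HalfLine => v t := funext fun t => h t t.2
  by_cases hu : MemLInfty u
  · rw [evalAt_of_mem hu, evalAt_of_mem (hu.congr fun t ht => (h t ht).symm)]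
    congr 2
  · rw [evalAt, evalAt, dif_neg hu, dif_neg fun hv : MemLInfty v => hu (hv.congr h)]

theorem evalAt_eq_zero_of_tendsto (hω : IsGeneralisedLimit ω) (hu : MemLInfty u)
    (h : Tendsto u atTop (𝓝 0)) : evalAt ω u = 0 := by
  rw [evalAt_of_mem hu]
  refine hω.vanish _ ?_
  exact tendsto_comp_val_Ioi_atTop.2 h

theorem evalAt_eq_of_tendsto_sub (hω : IsGeneralisedLimit ω) (hu : MemLInfty u) (hv : MemLInfty v)
    (h : Tendsto (fun t => u t - v t) atTop (𝓝 0)) : evalAt ω u = evalAt ω v := by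
  have hw : MemLInfty fun t => u t + -1 * v t := hu.add (hv.const_mul (-1))
  have h0 := evalAt_eq_zero_of_tendsto hω hw (h.congr fun t => by ring)
  rw [evalAt_add hu (hv.const_mul (-1)), evalAt_const_mul hv] at h0
  linarith

/-- Replacing u by max(u, 0) changes it by an eventually vanishing function, which ω ignores. -/
theorem evalAt_nonneg (hω : IsGeneralisedLimit ω) (hu : MemLInfty u)
    (h : ∀ᶠ t in atTop, 0 ≤ u t) : 0 ≤ evalAt ω u := by
  obtain ⟨h1, C, hC⟩ := memLInfty_iff.1 hu
  have hp : MemLInfty fun t => max (u t) 0 := by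
    refine memLInfty_iff.2 ⟨h1.max aemeasurable_const, C, fun t ht => ?_⟩
    have := hC t ht
    rw [abs_of_nonneg (le_max_right _ _)]
    exact max_le ((le_abs_self _).trans this) ((abs_nonneg _).trans this)
  have : evalAt ω u = evalAt ω fun t => max (u t) 0 := by
    refine evalAt_eq_of_tendsto_sub hω hu hp ?_
    refine tendsto_const_nhds.congr' ?_
    filter_upwards [h] with t ht
    rw [max_eq_left ht, sub_self]
  rw [this, evalAt_of_mem hp]
  exact hω.nonneg _ fun t => le_max_right _ _

theorem evalAt_mono (hω : IsGeneralisedLimit ω) (hu : MemLInfty u) (hv : MemLInfty v)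
    (h : ∀ᶠ t in atTop, u t ≤ v t) : evalAt ω u ≤ evalAt ω v := by
  have h0 := evalAt_nonneg hω (hv.add (hu.const_mul (-1))) (h.mono fun t ht => by linarith)
  rw [evalAt_add hv (hu.const_mul (-1)), evalAt_const_mul hu] at h0
  linarith

theorem evalAt_const (hω : IsGeneralisedLimit ω) (c : ℝ) : evalAt ω (fun _ => c) = c := by
  have h1 : MemLInfty fun _ => (1 : ℝ) := LInfty.one.2
  have h2 := evalAt_const_mul (ω := ω) h1 c
  rw [evalAt_of_mem h1] at h2
  have h3 : ω ⟨fun _ : HalfLine => (1 : ℝ), h1⟩ = 1 := hω.one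
  rw [h3] at h2
  simpa using h2

theorem MemLInfty.dilate (hu : MemLInfty u) {s : ℝ} (hs : 0 < s) :
    MemLInfty fun t => u (t / s) :=
  (dilation ⟨s, hs⟩ ⟨_, hu⟩).2

theorem evalAt_dilate (hωd : IsDilationInvariant ω) (hu : MemLInfty u) {s : ℝ} (hs : 0 < s) :
    evalAt ω (fun t => u (t / s)) = evalAt ω u := by
  rw [evalAt_of_mem hu, evalAt_of_mem (hu.dilate hs)]
  exact hωd ⟨s, hs⟩ ⟨_, hu⟩

/-! ### Limits normalised by the logarithm -/

/-- `Θ` is measurable on the half-line and `O(log(2 + T))`. -/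
def LogGrowth (Θ : ℝ → ℝ) : Prop := MemLInfty fun T => Θ T / Real.log (2 + T)

/-- The generalised limit of `Θ(T) / log(2 + T)`. -/
def logLim (ω : LInfty →ₗ[ℝ] ℝ) (Θ : ℝ → ℝ) : ℝ := evalAt ω fun T => Θ T / Real.log (2 + T)

variable {Θ Ξ : ℝ → ℝ}

theorem logGrowth_of_measurable (h : AEMeasurable Θ (volume.restrict (Ioi 0))) {C : ℝ}
    (hC : ∀ T : ℝ, 0 < T → |Θ T| ≤ C * Real.log (2 + T)) : LogGrowth Θ := by
  refine memLInfty_iff.2 ⟨h.div (by fun_prop), C, fun T hT => ?_⟩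
  have hl := log_two_add_pos hT.le
  rw [abs_div, abs_of_pos hl, div_le_iff₀ hl]
  exact hC T hT

theorem LogGrowth.exists_bound (h : LogGrowth Θ) :
    ∃ C : ℝ, 0 ≤ C ∧ ∀ T : ℝ, 0 < T → |Θ T| ≤ C * Real.log (2 + T) := by
  obtain ⟨-, C, hC⟩ := memLInfty_iff.1 h
  refine ⟨C, (abs_nonneg _).trans (hC 1 one_pos), fun T hT => ?_⟩
  have hl := log_two_add_pos hT.le
  have := hC T hT
  rwa [abs_div, abs_of_pos hl, div_le_iff₀ hl] at this

theorem LogGrowth.add (hΘ : LogGrowth Θ) (hΞ : LogGrowth Ξ) : LogGrowth fun T => Θ T + Ξ T :=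
  (MemLInfty.add hΘ hΞ).congr fun _ _ => add_div _ _ _

theorem LogGrowth.const_mul (hΘ : LogGrowth Θ) (c : ℝ) : LogGrowth fun T => c * Θ T :=
  (MemLInfty.const_mul hΘ c).congr fun _ _ => mul_div_assoc _ _ _

theorem LogGrowth.sum {ι : Type*} (s : Finset ι) {Θ : ι → ℝ → ℝ} (h : ∀ i ∈ s, LogGrowth (Θ i)) :
    LogGrowth fun t => ∑ i ∈ s, Θ i t :=
  (MemLInfty.sum s h).congr fun _ _ => Finset.sum_div _ _ _

theorem logLim_add (hΘ : LogGrowth Θ) (hΞ : LogGrowth Ξ) :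
    logLim ω (fun T => Θ T + Ξ T) = logLim ω Θ + logLim ω Ξ := by
  rw [logLim, logLim, logLim, ← evalAt_add hΘ hΞ]
  exact evalAt_congr fun _ _ => add_div _ _ _

theorem logLim_const_mul (hΘ : LogGrowth Θ) (c : ℝ) :
    logLim ω (fun T => c * Θ T) = c * logLim ω Θ := by
  rw [logLim, logLim, ← evalAt_const_mul hΘ]
  exact evalAt_congr fun _ _ => mul_div_assoc _ _ _

theorem logLim_sum {ι : Type*} (s : Finset ι) {Θ : ι → ℝ → ℝ} (h : ∀ i ∈ s, LogGrowth (Θ i)) :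
    logLim ω (fun t => ∑ i ∈ s, Θ i t) = ∑ i ∈ s, logLim ω (Θ i) := by
  simp only [logLim]
  rw [← evalAt_sum s h]
  exact evalAt_congr fun _ _ => Finset.sum_div _ _ _

theorem logLim_congr (h : ∀ T, 0 < T → Θ T = Ξ T) : logLim ω Θ = logLim ω Ξ :=
  evalAt_congr fun T hT => by rw [h T hT]

theorem LogGrowth.congr (hΘ : LogGrowth Θ) (h : ∀ T, 0 < T → Ξ T = Θ T) : LogGrowth Ξ :=
  MemLInfty.congr hΘ fun T hT => by rw [h T hT]

theorem logLim_mono (hω : IsGeneralisedLimit ω) (hΘ : LogGrowth Θ) (hΞ : LogGrowth Ξ)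
    (h : ∀ T, 0 < T → Θ T ≤ Ξ T) : logLim ω Θ ≤ logLim ω Ξ := by
  refine evalAt_mono hω hΘ hΞ ?_
  filter_upwards [eventually_gt_atTop 0] with T hT
  exact div_le_div_of_nonneg_right (h T hT) (log_two_add_pos hT.le).le

theorem abs_logLim_le (hω : IsGeneralisedLimit ω) (hΘ : LogGrowth Θ) {C : ℝ}
    (h : ∀ T, 0 < T → |Θ T| ≤ C * Real.log (2 + T)) : |logLim ω Θ| ≤ C := by
  have hb : ∀ T : ℝ, 0 < T → |Θ T / Real.log (2 + T)| ≤ C := fun T hT => by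
    have hl := log_two_add_pos hT.le
    rw [abs_div, abs_of_pos hl, div_le_iff₀ hl]
    exact h T hT
  have hc : ∀ c : ℝ, MemLInfty fun _ => c := fun c =>
    memLInfty_of_measurable measurable_const (C := |c|) fun _ _ => le_rfl
  rw [abs_le]
  constructor
  · rw [← evalAt_const hω (-C)]
    refine evalAt_mono hω (hc _) hΘ ?_
    filter_upwards [eventually_gt_atTop 0] with T hT
    exact (abs_le.1 (hb T hT)).1
  · conv_rhs => rw [← evalAt_const hω C]
    refine evalAt_mono hω hΘ (hc _) ?_
    filter_upwards [eventually_gt_atTop 0] with T hT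
    exact (abs_le.1 (hb T hT)).2

theorem abs_log_sub_log_le {s T : ℝ} (hs : 0 < s) (hT : 0 < T) :
    |Real.log (2 + T / s) - Real.log (2 + T)| ≤ |Real.log s| := by
  have hd : 0 < T / s := by positivity
  rcases le_total s 1 with h | h
  · have h1 : T ≤ T / s := by rw [le_div_iff₀ hs]; nlinarith
    have h2 : Real.log (2 + T) ≤ Real.log (2 + T / s) :=
      Real.log_le_log (by positivity) (by linarith)
    have h3 : Real.log (2 + T / s) ≤ Real.log ((2 + T) / s) := by
      refine Real.log_le_log (by positivity) ?_
      rw [add_div]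
      have : (2 : ℝ) ≤ 2 / s := by rw [le_div_iff₀ hs]; linarith
      linarith
    rw [Real.log_div (by positivity) hs.ne'] at h3
    rw [abs_of_nonneg (by linarith), abs_of_nonpos (Real.log_nonpos hs.le h)]
    linarith
  · have h1 : T / s ≤ T := by rw [div_le_iff₀ hs]; nlinarith
    have h2 : Real.log (2 + T / s) ≤ Real.log (2 + T) :=
      Real.log_le_log (by positivity) (by linarith)
    have h3 : Real.log (2 + T) ≤ Real.log (s * (2 + T / s)) := by
      refine Real.log_le_log (by positivity) ?_
      rw [mul_add, mul_div_cancel₀ T hs.ne']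
      nlinarith
    rw [Real.log_mul hs.ne' (by positivity)] at h3
    rw [abs_of_nonpos (by linarith), abs_of_nonneg (Real.log_nonneg h)]
    linarith

theorem tendsto_log_two_add : Tendsto (fun T : ℝ => Real.log (2 + T)) atTop atTop :=
  Real.tendsto_log_atTop.comp (tendsto_atTop_add_const_left _ _ tendsto_id)

/-- Invariance of ω applies to Θ(T)/log(2 + T) as a whole. Replacing log(2 + T/s) by log(2 + T) is a
relative error ρ(T) = O(1/log T), which disappears in the limit. -/
theorem logLim_dilate (hω : IsGeneralisedLimit ω) (hωd : IsDilationInvariant ω) (hΘ : LogGrowth Θ)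
    {s : ℝ} (hs : 0 < s) :
    LogGrowth (fun T => Θ (T / s)) ∧ logLim ω (fun T => Θ (T / s)) = logLim ω Θ := by
  set ρ : ℝ → ℝ := fun T => (Real.log (2 + T / s) - Real.log (2 + T)) / Real.log (2 + T) with hρ
  have hρm : MemLInfty ρ := by
    refine memLInfty_of_measurable (by fun_prop) (C := |Real.log s| / Real.log 2) fun T hT => ?_
    have hl := log_two_add_pos hT.le
    rw [hρ, abs_div, abs_of_pos hl]
    exact div_le_div₀ (abs_nonneg _) (abs_log_sub_log_le hs hT) (Real.log_pos (by norm_num))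
      (log_two_le hT.le)
  have hρt : Tendsto ρ atTop (𝓝 0) := by
    have h1 : Tendsto (fun T : ℝ => |Real.log s| / Real.log (2 + T)) atTop (𝓝 0) :=
      tendsto_const_nhds.div_atTop tendsto_log_two_add
    refine squeeze_zero_norm' ?_ h1
    filter_upwards [eventually_gt_atTop 0] with T hT
    have hl := log_two_add_pos hT.le
    rw [hρ, Real.norm_eq_abs, abs_div, abs_of_pos hl]
    exact div_le_div_of_nonneg_right (abs_log_sub_log_le hs hT) hl.le
  set u : ℝ → ℝ := fun T => Θ T / Real.log (2 + T) with hu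
  have hum : MemLInfty u := hΘ
  have hud := hum.dilate hs
  have e : ∀ T, 0 < T → Θ (T / s) / Real.log (2 + T) = u (T / s) + u (T / s) * ρ T := by
    intro T hT
    have h1 : Real.log (2 + T) ≠ 0 := (log_two_add_pos hT.le).ne'
    have h2 : Real.log (2 + T / s) ≠ 0 := (log_two_add_pos (by positivity)).ne'
    simp only [hu, hρ]
    generalize Real.log (2 + T / s) = a at h2 ⊢
    field_simp
    ring
  have hm : LogGrowth fun T => Θ (T / s) := (hud.add (hud.mul hρm)).congr e
  refine ⟨hm, ?_⟩
  rw [logLim, evalAt_congr e, evalAt_add hud (hud.mul hρm), evalAt_dilate hωd hum hs]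
  have h0 : evalAt ω (fun T => u (T / s) * ρ T) = 0 := by
    refine evalAt_eq_zero_of_tendsto hω (hud.mul hρm) ?_
    obtain ⟨-, C, hC⟩ := memLInfty_iff.1 hud
    refine squeeze_zero_norm' (a := fun T => C * |ρ T|) ?_ (by simpa using hρt.abs.const_mul C)
    filter_upwards [eventually_gt_atTop 0] with T hT
    rw [Real.norm_eq_abs, abs_mul]
    exact mul_le_mul_of_nonneg_right (hC T hT) (abs_nonneg _)
  rw [h0, add_zero]
  rfl

/-- Passing from the Cesàro normalisation log T to log(2 + T), and dropping the constant c, costs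
only O(1/log T). -/
theorem evalAt_eq_logLim (hω : IsGeneralisedLimit ω) (hu : MemLInfty u) (hΘ : LogGrowth Θ) {c : ℝ}
    (h : ∀ T : ℝ, 1 < T → u T = (Real.log T)⁻¹ * (Θ T + c)) : evalAt ω u = logLim ω Θ := by
  refine evalAt_eq_of_tendsto_sub hω hu hΘ ?_
  obtain ⟨C, hC0, hC⟩ := hΘ.exists_bound
  have h1 : Tendsto (fun T : ℝ => (2 * C + |c|) / Real.log T) atTop (𝓝 0) :=
    tendsto_const_nhds.div_atTop Real.tendsto_log_atTop
  refine squeeze_zero_norm' ?_ h1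
  filter_upwards [eventually_gt_atTop 1] with T hT
  have hT0 : 0 < T := by linarith
  have hl : 0 < Real.log T := Real.log_pos hT
  have hl2 := log_two_add_pos hT0.le
  have h2 : Real.log (2 + T) - Real.log T ≤ 2 := by
    rw [← Real.log_div (by positivity) hT0.ne']
    have h3 := Real.log_le_sub_one_of_pos (show 0 < (2 + T) / T by positivity)
    have h4 : (2 + T) / T - 1 = 2 / T := by field_simp; ring
    have h5 : 2 / T ≤ 2 := div_le_self (by norm_num) hT.le
    linarith
  have h2' : 0 ≤ Real.log (2 + T) - Real.log T := by
    have := Real.log_le_log hT0 (by linarith : T ≤ 2 + T)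
    linarith
  have e : u T - Θ T / Real.log (2 + T)
      = (Θ T / Real.log (2 + T) * (Real.log (2 + T) - Real.log T) + c) / Real.log T := by
    rw [h T hT]
    field_simp
    ring
  rw [e, Real.norm_eq_abs, abs_div, abs_of_pos hl]
  refine div_le_div_of_nonneg_right ((abs_add_le _ _).trans (add_le_add ?_ le_rfl)) hl.le
  rw [abs_mul, abs_div, abs_of_pos hl2, abs_of_nonneg h2']
  have h6 : |Θ T| / Real.log (2 + T) ≤ C := by
    rw [div_le_iff₀ hl2]; exact hC T hT0
  calc |Θ T| / Real.log (2 + T) * (Real.log (2 + T) - Real.log T) ≤ C * 2 :=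
        mul_le_mul h6 h2 h2' hC0
    _ = 2 * C := by ring

end NCHeat

namespace NCHeat

/-! ### Dilated integrals against a measure of logarithmic growth -/

/-- `∫ T η(T x) dm(x)`. -/
def dilInt (m : Measure ℝ) (η : ℝ → ℝ) (T : ℝ) : ℝ := ∫ x, T * η (T * x) ∂m

/-- The measure `m` satisfies `∫ min(T, 1/x) dm(x) = O(log(2 + T))`. -/
def LogMeasure (m : Measure ℝ) : Prop :=
  ∃ D : ℝ, 0 ≤ D ∧ ∀ T : ℝ, 0 < T → ∫ x, (max x T⁻¹)⁻¹ ∂m ≤ D * Real.log (2 + T)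

theorem one_le_max_one (y : ℝ) : 1 ≤ max y 1 := le_max_right _ _

theorem inv_max_one_le_one (y : ℝ) : (max y 1)⁻¹ ≤ 1 := inv_le_one_of_one_le₀ (one_le_max_one y)

theorem inv_max_one_sq_le (y : ℝ) : ((max y 1) ^ 2)⁻¹ ≤ (max y 1)⁻¹ := by
  have h := one_le_max_one y
  exact inv_anti₀ (by linarith) (by nlinarith)

theorem mul_inv_max_one {T : ℝ} (hT : 0 < T) (x : ℝ) :
    T * (max (T * x) 1)⁻¹ = (max x T⁻¹)⁻¹ := by
  have h : max (T * x) 1 = T * max x T⁻¹ := by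
    rw [mul_max_of_nonneg _ _ hT.le, mul_inv_cancel₀ hT.ne']
  rw [h, mul_inv, ← mul_assoc, mul_inv_cancel₀ hT.ne', one_mul]

/-- Each term is at most six times a telescoping difference of (z + 2ᵏ)⁻¹ with z = max(y, 0), so the
bound is independent of n. -/
theorem dyadic_square_sum_le (y : ℝ) (n : ℕ) :
    ∑ k ∈ Finset.range n, (2 ^ k : ℝ)⁻¹ * ((max (y / 2 ^ k) 1) ^ 2)⁻¹ ≤ 6 * (max y 1)⁻¹ := by
  set z := max y 0 with hz
  have hz0 : 0 ≤ z := le_max_right _ _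
  have hterm : ∀ k ∈ Finset.range n, (2 ^ k : ℝ)⁻¹ * ((max (y / 2 ^ k) 1) ^ 2)⁻¹
      ≤ 6 * ((z + 2 ^ k)⁻¹ - (z + 2 ^ (k + 1))⁻¹) := by
    intro k _
    set a : ℝ := 2 ^ k with ha
    have ha0 : 0 < a := by positivity
    have h1 : max (y / a) 1 = max z a / a := by
      have h2 : max z a = max y a := by
        rw [hz, max_assoc, max_eq_right ha0.le]
      rw [h2, eq_div_iff ha0.ne', max_mul_of_nonneg _ _ ha0.le, div_mul_cancel₀ _ ha0.ne', one_mul]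
    set M := max z a with hM
    have hMz : z ≤ M := le_max_left _ _
    have hMa : a ≤ M := le_max_right _ _
    have hM0 : 0 < M := by linarith
    have e1 : a⁻¹ * ((max (y / a) 1) ^ 2)⁻¹ = a / M ^ 2 := by
      rw [h1]; field_simp
    have e2 : (z + a)⁻¹ - (z + 2 ^ (k + 1))⁻¹ = a / ((z + a) * (z + 2 * a)) := by
      have : (2 : ℝ) ^ (k + 1) = 2 * a := by rw [pow_succ, ha]; ring
      rw [this]
      field_simp
      ring
    rw [e1, e2, mul_div_assoc', div_le_div_iff₀ (by positivity) (by positivity)]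
    have h3 : (z + a) * (z + 2 * a) ≤ (2 * M) * (3 * M) :=
      mul_le_mul (by linarith) (by linarith) (by positivity) (by positivity)
    nlinarith
  refine (Finset.sum_le_sum hterm).trans ?_
  rw [← Finset.mul_sum, Finset.sum_range_sub']
  have h4 : (z + 2 ^ 0)⁻¹ ≤ (max y 1)⁻¹ := by
    refine inv_anti₀ (by have := one_le_max_one y; linarith) (max_le ?_ ?_)
    · have := le_max_left y 0
      rw [pow_zero]; linarith
    · rw [pow_zero]; linarith
  have h5 : 0 ≤ (z + 2 ^ n)⁻¹ := by positivity
  linarith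

section

variable {m : Measure ℝ} [IsFiniteMeasure m] {η : ℝ → ℝ} {C : ℝ}

theorem integrable_dil (hη : Continuous η) (hC : ∀ y, |η y| ≤ C) (T : ℝ) :
    Integrable (fun x => T * η (T * x)) m := by
  refine Integrable.of_bound (by fun_prop) (|T| * C) (Eventually.of_forall fun x => ?_)
  rw [Real.norm_eq_abs, abs_mul]
  exact mul_le_mul_of_nonneg_left (hC _) (abs_nonneg _)

theorem measurable_dilInt (hη : Continuous η) : Measurable (dilInt m η) := by
  have h : StronglyMeasurable fun p : ℝ × ℝ => p.1 * η (p.1 * p.2) :=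
    Continuous.stronglyMeasurable (by fun_prop)
  exact h.integral_prod_right'.measurable

theorem integrable_inv_max {T : ℝ} (hT : 0 < T) : Integrable (fun x => (max x T⁻¹)⁻¹) m := by
  refine Integrable.of_bound (continuous_inv_max hT).aestronglyMeasurable T
    (Eventually.of_forall fun x => ?_)
  rw [Real.norm_eq_abs, abs_of_nonneg (inv_max_nonneg hT x)]
  exact inv_le_of_inv_le₀ hT (le_max_right _ _)

theorem abs_dilInt_le (hC : ∀ y, |η y| ≤ C * (max y 1)⁻¹) {T : ℝ}
    (hT : 0 < T) : |dilInt m η T| ≤ C * ∫ x, (max x T⁻¹)⁻¹ ∂m := by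
  rw [← integral_const_mul, ← Real.norm_eq_abs]
  refine norm_integral_le_of_norm_le ((integrable_inv_max hT).const_mul C)
    (Eventually.of_forall fun x => ?_)
  rw [Real.norm_eq_abs, abs_mul, abs_of_pos hT, ← mul_inv_max_one hT]
  have := mul_le_mul_of_nonneg_left (hC (T * x)) hT.le
  linarith

theorem nonneg_of_bound (hC : ∀ y, |η y| ≤ C * (max y 1)⁻¹) : 0 ≤ C := by
  have := (abs_nonneg _).trans (hC 0)
  simpa using this

theorem logGrowth_dilInt (hm : LogMeasure m) (hη : Continuous η)
    (hC : ∀ y, |η y| ≤ C * (max y 1)⁻¹) : LogGrowth (dilInt m η) := by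
  obtain ⟨D, hD0, hD⟩ := hm
  refine logGrowth_of_measurable (measurable_dilInt hη).aemeasurable (C := C * D) fun T hT => ?_
  refine (abs_dilInt_le hC hT).trans ?_
  rw [mul_assoc]
  exact mul_le_mul_of_nonneg_left (hD T hT) (nonneg_of_bound hC)

variable {ω : LInfty →ₗ[ℝ] ℝ}

theorem bound_of_square (hC : ∀ y, |η y| ≤ C * ((max y 1) ^ 2)⁻¹) :
    0 ≤ C ∧ (∀ y, |η y| ≤ C * (max y 1)⁻¹) ∧ ∀ y, |η y| ≤ C := by
  have h0 : 0 ≤ C := by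
    have := (abs_nonneg _).trans (hC 0)
    simpa using this
  have h1 : ∀ y, |η y| ≤ C * (max y 1)⁻¹ := fun y =>
    (hC y).trans (mul_le_mul_of_nonneg_left (inv_max_one_sq_le y) h0)
  exact ⟨h0, h1, fun y => (h1 y).trans (mul_le_of_le_one_right h0 (inv_max_one_le_one y))⟩

/-- Averaging over dilations annihilates functions decaying like `min(1, y⁻²)`. -/
theorem logLim_dilInt_eq_zero (hω : IsGeneralisedLimit ω) (hωd : IsDilationInvariant ω)
    (hm : LogMeasure m) (hη : Continuous η) (hC : ∀ y, |η y| ≤ C * ((max y 1) ^ 2)⁻¹) :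
    logLim ω (dilInt m η) = 0 := by
  obtain ⟨hC0, hC1, hC2⟩ := bound_of_square hC
  have hg := logGrowth_dilInt hm hη hC1
  obtain ⟨D, hD0, hD⟩ := hm
  have hpow : ∀ k : ℕ, (0 : ℝ) < 2 ^ k := fun k => by positivity
  -- The n dilates by 2ᵏ share one limit, while their sum has a profile bounded by 6C min(1, 1/y)
  -- uniformly in n.
  have key : ∀ n : ℕ, |(n : ℝ) * logLim ω (dilInt m η)| ≤ 6 * C * D := by
    intro n
    have hd : ∀ k ∈ Finset.range n, LogGrowth fun T => dilInt m η (T / 2 ^ k) :=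
      fun k _ => (logLim_dilate hω hωd hg (hpow k)).1
    have h1 : (n : ℝ) * logLim ω (dilInt m η)
        = logLim ω fun T => ∑ k ∈ Finset.range n, dilInt m η (T / 2 ^ k) := by
      rw [logLim_sum (Finset.range n) (Θ := fun k T => dilInt m η (T / 2 ^ k)) hd,
        Finset.sum_congr rfl fun k _ => (logLim_dilate hω hωd hg (hpow k)).2]
      simp
    rw [h1]
    refine abs_logLim_le hω (LogGrowth.sum (Finset.range n) hd) fun T hT => ?_
    have h2 : ∑ k ∈ Finset.range n, dilInt m η (T / 2 ^ k)
        = ∫ x, ∑ k ∈ Finset.range n, T / 2 ^ k * η (T / 2 ^ k * x) ∂m := by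
      rw [integral_finsetSum _ fun k _ => integrable_dil hη hC2 (T / 2 ^ k)]
      rfl
    rw [h2, mul_assoc (6 * C)]
    refine le_trans ?_ (mul_le_mul_of_nonneg_left (hD T hT) (by positivity : 0 ≤ 6 * C))
    rw [← integral_const_mul, ← Real.norm_eq_abs]
    refine norm_integral_le_of_norm_le ((integrable_inv_max hT).const_mul _)
      (Eventually.of_forall fun x => ?_)
    rw [Real.norm_eq_abs, ← mul_inv_max_one hT]
    refine (Finset.abs_sum_le_sum_abs _ _).trans ?_
    have h3 : ∀ k ∈ Finset.range n, |T / 2 ^ k * η (T / 2 ^ k * x)|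
        ≤ T * C * ((2 ^ k : ℝ)⁻¹ * ((max (T * x / 2 ^ k) 1) ^ 2)⁻¹) := by
      intro k _
      rw [abs_mul, abs_of_pos (div_pos hT (hpow k))]
      refine (mul_le_mul_of_nonneg_left (hC _) (div_pos hT (hpow k)).le).trans (le_of_eq ?_)
      rw [div_mul_eq_mul_div T _ x]
      generalize ((max (T * x / 2 ^ k) 1) ^ 2)⁻¹ = w
      ring
    refine (Finset.sum_le_sum h3).trans ?_
    rw [← Finset.mul_sum]
    have := mul_le_mul_of_nonneg_left (dyadic_square_sum_le (T * x) n)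
      (by positivity : 0 ≤ T * C)
    linarith
  by_contra hne
  have hpos : 0 < |logLim ω (dilInt m η)| := abs_pos.2 hne
  obtain ⟨n, hn⟩ := exists_nat_gt (6 * C * D / |logLim ω (dilInt m η)|)
  rw [div_lt_iff₀ hpos] at hn
  have := key n
  rw [abs_mul, Nat.abs_cast] at this
  linarith

/-- The reference profile `(y - 1)₊ / y²`. -/
def refProfile (y : ℝ) : ℝ := max (y - 1) 0 * ((max y 1) ^ 2)⁻¹

theorem continuous_refProfile : Continuous refProfile := by
  refine Continuous.mul (by fun_prop) (Continuous.inv₀ (by fun_prop) fun y => ?_)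
  have := one_le_max_one y
  positivity

theorem refProfile_of_le {y : ℝ} (h : y ≤ 1) : refProfile y = 0 := by
  rw [refProfile, max_eq_right (by linarith), zero_mul]

theorem refProfile_of_ge {y : ℝ} (h : 1 ≤ y) : refProfile y = (y - 1) / y ^ 2 := by
  rw [refProfile, max_eq_left (by linarith), max_eq_left h, div_eq_mul_inv]

theorem abs_refProfile_le (y : ℝ) : |refProfile y| ≤ 1 * (max y 1)⁻¹ := by
  have h1 := one_le_max_one y
  rw [one_mul, refProfile, abs_of_nonneg (by positivity), ← div_eq_mul_inv,
    div_le_iff₀ (by positivity), sq, ← mul_assoc, inv_mul_cancel₀ (by positivity), one_mul]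
  exact max_le (by linarith [le_max_left y 1]) (by linarith)

/-- The mean `∫₀¹ k(u y) du`. -/
def meanProfile (k : ℝ → ℝ) (y : ℝ) : ℝ := ∫ u in (0 : ℝ)..1, k (u * y)

variable {k : ℝ → ℝ}

theorem continuous_meanProfile (hk : Continuous k) : Continuous (meanProfile k) :=
  intervalIntegral.continuous_parametric_intervalIntegral_of_continuous'
    (f := fun y u => k (u * y)) (by simp only [Function.uncurry_def]; fun_prop) 0 1

theorem mul_meanProfile (k : ℝ → ℝ) (y : ℝ) : y * meanProfile k y = ∫ u in (0 : ℝ)..y, k u := by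
  rw [meanProfile, intervalIntegral.mul_integral_comp_mul_right, zero_mul, one_mul]

theorem integrableOn_Ioi_of_square (hk : Continuous k) (hC : ∀ y, |k y| ≤ C * ((max y 1) ^ 2)⁻¹)
    {y : ℝ} (hy : 1 ≤ y) : IntegrableOn k (Ioi y) ∧ |∫ u in Ioi y, k u| ≤ C / y := by
  have hy0 : 0 < y := by linarith
  have hi := (integrableOn_Ioi_rpow_of_lt (by norm_num : (-2 : ℝ) < -1) hy0).const_mul C
  have hb : ∀ᵐ u ∂volume.restrict (Ioi y), ‖k u‖ ≤ C * u ^ (-2 : ℝ) := by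
    refine (ae_restrict_iff' measurableSet_Ioi).2 (Eventually.of_forall fun u hu => ?_)
    have hu1 : y < u := hu
    have := hC u
    rw [max_eq_left (by linarith)] at this
    rw [Real.norm_eq_abs, Real.rpow_neg (by linarith)]
    exact_mod_cast this
  refine ⟨Integrable.mono' hi hk.aestronglyMeasurable hb, ?_⟩
  have h1 := norm_integral_le_of_norm_le hi hb
  rw [integral_const_mul, integral_Ioi_rpow_of_lt (by norm_num) hy0] at h1
  rw [← Real.norm_eq_abs]
  refine h1.trans (le_of_eq ?_)
  have : -y ^ (-2 + 1 : ℝ) / (-2 + 1) = y⁻¹ := by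
    rw [show (-2 + 1 : ℝ) = -1 by norm_num, Real.rpow_neg_one]; ring
  rw [this, div_eq_mul_inv]

theorem integrableOn_Ioi_zero (hk : Continuous k) (hC : ∀ y, |k y| ≤ C * ((max y 1) ^ 2)⁻¹) :
    IntegrableOn k (Ioi 0) := by
  have h1 := (integrableOn_Ioi_of_square hk hC le_rfl).1
  have h2 : IntegrableOn k (Ioc 0 1) := hk.integrableOn_Ioc
  have := h2.union h1
  rwa [Ioc_union_Ioi_eq_Ioi zero_le_one] at this

/-- For y ≥ 1, y times the mean is c minus a tail of size at most C/y, where |c| ≤ 2C. Subtracting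
c(y - 1)/y² leaves c/y² minus the tail over y, at most 3C/y² in absolute value. -/
theorem meanProfile_estimates (hk : Continuous k) (hC : ∀ y, |k y| ≤ C * ((max y 1) ^ 2)⁻¹) :
    (∀ y, |meanProfile k y| ≤ 3 * C * (max y 1)⁻¹) ∧
    ∀ y, |meanProfile k y + -(∫ u in Ioi (0 : ℝ), k u) * refProfile y|
      ≤ 3 * C * ((max y 1) ^ 2)⁻¹ := by
  obtain ⟨hC0, -, hC2⟩ := bound_of_square hC
  set c := ∫ u in Ioi (0 : ℝ), k u with hc
  have hi0 := integrableOn_Ioi_zero hk hC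
  have hsplit : ∀ y : ℝ, 1 ≤ y → |y * meanProfile k y - c| ≤ C / y := by
    intro y hy
    obtain ⟨h1, h2⟩ := integrableOn_Ioi_of_square hk hC hy
    have h3 := intervalIntegral.integral_interval_add_Ioi hi0 h1
    rw [mul_meanProfile, hc, ← h3, sub_add_cancel_left, abs_neg]
    exact h2
  have hsmall : ∀ y, |meanProfile k y| ≤ C := by
    intro y
    have := intervalIntegral.norm_integral_le_of_norm_le_const (a := 0) (b := 1)
      (f := fun u => k (u * y)) (C := C) fun u _ => hC2 _
    simpa [meanProfile] using this
  have hcb : |c| ≤ 2 * C := by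
    have h1 := hsplit 1 le_rfl
    have h2 := hsmall 1
    rw [one_mul, div_one] at h1
    rw [abs_le] at *
    constructor <;> linarith [h1.1, h1.2, h2.1, h2.2]
  constructor
  · intro y
    rcases le_total y 1 with hy | hy
    · rw [max_eq_right hy, inv_one, mul_one]
      linarith [hsmall y]
    · have hy0 : 0 < y := by linarith
      have h1 := hsplit y hy
      have h2 : C / y ≤ C := div_le_self hC0 hy
      have h3 : |y * meanProfile k y| ≤ 3 * C := by
        have := abs_add_le (y * meanProfile k y - c) c
        rw [sub_add_cancel] at this
        linarith
      rw [abs_mul, abs_of_pos hy0] at h3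
      rw [max_eq_left hy, ← div_eq_mul_inv, le_div_iff₀ hy0]
      linarith
  · intro y
    rcases le_total y 1 with hy | hy
    · rw [refProfile_of_le hy, mul_zero, add_zero, max_eq_right hy]
      simp only [one_pow, inv_one, mul_one]
      linarith [hsmall y]
    · have hy0 : 0 < y := by linarith
      have h1 := hsplit y hy
      have e : meanProfile k y + -c * refProfile y
          = ((y * meanProfile k y - c) * y + c) / y ^ 2 := by
        rw [refProfile_of_ge hy]
        field_simp
        ring
      rw [e, abs_div, abs_of_pos (by positivity : 0 < y ^ 2), max_eq_left hy, ← div_eq_mul_inv]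
      refine div_le_div_of_nonneg_right ?_ (by positivity)
      refine (abs_add_le _ _).trans ?_
      rw [abs_mul, abs_of_pos hy0]
      rw [le_div_iff₀ hy0] at h1
      linarith

theorem logLim_dilInt_meanProfile (hω : IsGeneralisedLimit ω) (hωd : IsDilationInvariant ω)
    (hm : LogMeasure m) (hk : Continuous k) (hC : ∀ y, |k y| ≤ C * ((max y 1) ^ 2)⁻¹) :
    LogGrowth (dilInt m (meanProfile k)) ∧ logLim ω (dilInt m (meanProfile k))
      = (∫ u in Ioi (0 : ℝ), k u) * logLim ω (dilInt m refProfile) := by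
  obtain ⟨h1, h2⟩ := meanProfile_estimates hk hC
  set c := ∫ u in Ioi (0 : ℝ), k u with hc
  have hcm := continuous_meanProfile hk
  have hg := logGrowth_dilInt hm hcm h1
  have hg0 := logGrowth_dilInt hm continuous_refProfile abs_refProfile_le
  refine ⟨hg, ?_⟩
  have h3 := logLim_dilInt_eq_zero hω hωd hm
    (hcm.add (continuous_const.mul continuous_refProfile)) h2
  have e : ∀ T, 0 < T → dilInt m (fun y => meanProfile k y + -c * refProfile y) T
      = dilInt m (meanProfile k) T + -c * dilInt m refProfile T := by
    intro T _
    have hi1 : Integrable (fun x => T * meanProfile k (T * x)) m :=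
      integrable_dil hcm (C := 3 * C) (fun y => (h1 y).trans (mul_le_of_le_one_right
        (nonneg_of_bound h1) (inv_max_one_le_one y))) T
    have hi2 : Integrable (fun x => T * refProfile (T * x)) m :=
      integrable_dil continuous_refProfile (C := 1) (fun y => (abs_refProfile_le y).trans
        (mul_le_of_le_one_right zero_le_one (inv_max_one_le_one y))) T
    rw [dilInt, dilInt, dilInt, ← integral_const_mul, ← integral_add hi1 (hi2.const_mul _)]
    refine integral_congr_ae (Eventually.of_forall fun x => ?_)
    simp only
    ring
  have h4 := logLim_congr (ω := ω) e
  rw [logLim_add hg (hg0.const_mul _), logLim_const_mul hg0] at h4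
  have h5 : logLim ω (dilInt m fun y => meanProfile k y + -c * refProfile y) = 0 := h3
  rw [h5] at h4
  linarith

/-- The real form of the Cesàro operator. -/
def realCesaro (z : ℝ → ℝ) (T : ℝ) : ℝ := (Real.log T)⁻¹ * ∫ s in (1 : ℝ)..T, z s / s

theorem abs_dilInt_le_mul (hC : ∀ y, |k y| ≤ C) (s : ℝ) :
    |dilInt m k s| ≤ |s| * (C * m.real univ) := by
  rw [dilInt, integral_const_mul, abs_mul]
  refine mul_le_mul_of_nonneg_left ?_ (abs_nonneg _)
  rw [← Real.norm_eq_abs]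
  exact norm_integral_le_of_norm_le_const (Eventually.of_forall fun x => by
    rw [Real.norm_eq_abs]; exact hC _)

theorem locallyIntegrable_dilInt (hk : Continuous k) (hC : ∀ y, |k y| ≤ C) :
    LocallyIntegrable (dilInt m k) volume := by
  have h1 : LocallyIntegrable (fun s : ℝ => s * (C * m.real univ)) volume :=
    Continuous.locallyIntegrable (by fun_prop)
  refine h1.mono (measurable_dilInt hk).aestronglyMeasurable (Eventually.of_forall fun s => ?_)
  rw [norm_mul, Real.norm_eq_abs, Real.norm_eq_abs]
  exact (abs_dilInt_le_mul hC s).trans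
    (mul_le_mul_of_nonneg_left (le_abs_self _) (abs_nonneg _))

/-- The weight 1/s cancels the factor s of `dilInt`. After Fubini the inner integral of k(sx) over
[1, T] is a difference of means at T and at 1. -/
theorem intervalIntegral_dilInt_div (hk : Continuous k) (hC : ∀ y, |k y| ≤ C) {T : ℝ}
    (hT : 0 < T) : ∫ s in (1 : ℝ)..T, dilInt m k s / s
      = dilInt m (meanProfile k) T + -dilInt m (meanProfile k) 1 := by
  have h1 : ∫ s in (1 : ℝ)..T, dilInt m k s / s = ∫ s in (1 : ℝ)..T, ∫ x, k (s * x) ∂m := by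
    refine intervalIntegral.integral_congr fun s hs => ?_
    have hs0 : 0 < s := lt_of_lt_of_le (lt_min one_pos hT) hs.1
    simp only [dilInt, integral_const_mul]
    field_simp
  have hmean : ∀ S : ℝ, ∀ x : ℝ, ∫ s in (0 : ℝ)..S, k (s * x) = S * meanProfile k (S * x) := by
    intro S x
    have := intervalIntegral.mul_integral_comp_mul_right (a := 0) (b := 1)
      (f := fun s => k (s * x)) S
    rw [zero_mul, one_mul] at this
    rw [← this, meanProfile]
    simp only [mul_assoc]
  have hb : ∀ y, |meanProfile k y| ≤ C := by
    intro y
    have := intervalIntegral.norm_integral_le_of_norm_le_const (a := 0) (b := 1)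
      (f := fun u => k (u * y)) (C := C) fun u _ => hC _
    simpa [meanProfile] using this
  rw [h1, intervalIntegral_integral_swap]
  · have h2 : ∀ x : ℝ, ∫ s in (1 : ℝ)..T, k (s * x)
        = T * meanProfile k (T * x) - 1 * meanProfile k (1 * x) := by
      intro x
      rw [← hmean T x, ← hmean 1 x, intervalIntegral.integral_interval_sub_left] <;>
      exact Continuous.intervalIntegrable (by fun_prop) _ _
    simp only [h2]
    rw [integral_sub (integrable_dil (continuous_meanProfile hk) hb T)
      (integrable_dil (continuous_meanProfile hk) hb 1), sub_eq_add_neg]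
    rfl
  · have : IsFiniteMeasure (volume.restrict (uIoc 1 T)) := by
      rw [uIoc]; infer_instance
    refine Integrable.of_bound (Continuous.aestronglyMeasurable ?_) C
      (Eventually.of_forall fun p => hC _)
    simp only [Function.uncurry_def]
    fun_prop

/-- Near T = 1 the singular factor 1/log T is compensated by the length of the interval of
integration. -/
theorem abs_sub_one_le_two_mul_abs_log {T : ℝ} (h0 : 0 < T) (h2 : T ≤ 2) :
    |T - 1| ≤ 2 * |Real.log T| := by
  rcases le_total T 1 with h | h
  · have := Real.log_le_sub_one_of_pos h0
    rw [abs_of_nonpos (by linarith), abs_of_nonpos (by linarith)]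
    linarith
  · have h3 := Real.one_sub_inv_le_log_of_pos h0
    have h4 : (T - 1) / 2 ≤ 1 - T⁻¹ := by
      have : 1 - T⁻¹ = (T - 1) / T := by field_simp
      rw [this]
      exact div_le_div_of_nonneg_left (by linarith) (by linarith) h2
    rw [abs_of_nonneg (by linarith), abs_of_nonneg (by linarith)]
    linarith

theorem evalAt_realCesaro_dilInt (hω : IsGeneralisedLimit ω) (hωd : IsDilationInvariant ω)
    (hm : LogMeasure m) (hk : Continuous k) (hC : ∀ y, |k y| ≤ C * ((max y 1) ^ 2)⁻¹) :
    MemLInfty (realCesaro (dilInt m k)) ∧ evalAt ω (realCesaro (dilInt m k))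
      = (∫ u in Ioi (0 : ℝ), k u) * logLim ω (dilInt m refProfile) := by
  obtain ⟨hC0, -, hC2⟩ := bound_of_square hC
  obtain ⟨hg, hlim⟩ := logLim_dilInt_meanProfile hω hωd hm hk hC
  set c := -dilInt m (meanProfile k) 1 with hc
  have hform : ∀ T : ℝ, 0 < T → realCesaro (dilInt m k) T
      = (Real.log T)⁻¹ * (dilInt m (meanProfile k) T + c) := fun T hT => by
    rw [realCesaro, intervalIntegral_dilInt_div hk hC2 hT]
  have hmem : MemLInfty (realCesaro (dilInt m k)) := by
    have hmeas : Measurable fun T => (Real.log T)⁻¹ * (dilInt m (meanProfile k) T + c) :=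
      Real.measurable_log.inv.mul ((measurable_dilInt (continuous_meanProfile hk)).add_const c)
    obtain ⟨E, hE0, hE⟩ := hg.exists_bound
    have hl2 : 0 < Real.log 2 := Real.log_pos (by norm_num)
    refine (memLInfty_of_measurable hmeas
      (C := max (2 * (C * m.real univ)) (2 * E + |c| / Real.log 2)) fun T hT => ?_).congr hform
    rcases le_total T 2 with h2 | h2
    · refine le_trans ?_ (le_max_left _ _)
      rw [← intervalIntegral_dilInt_div hk hC2 hT, abs_mul, abs_inv]
      have h3 : |∫ s in (1 : ℝ)..T, dilInt m k s / s| ≤ C * m.real univ * |T - 1| := by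
        rw [← Real.norm_eq_abs]
        refine intervalIntegral.norm_integral_le_of_norm_le_const fun s hs => ?_
        have hs0 : 0 < s := by
          rw [uIoc, mem_Ioc] at hs
          exact lt_of_le_of_lt (le_min zero_le_one hT.le) hs.1
        rw [Real.norm_eq_abs, abs_div, div_le_iff₀ (abs_pos.2 hs0.ne')]
        linarith [abs_dilInt_le_mul (m := m) hC2 s]
      -- At T = 1 the inverse of log T is 0 by convention, so the value there is 0.
      rcases eq_or_ne (Real.log T) 0 with h0 | h0
      · rw [h0]
        simp only [abs_zero, inv_zero, zero_mul]
        positivity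
      · rw [inv_mul_le_iff₀ (abs_pos.2 h0)]
        have h4 := mul_le_mul_of_nonneg_left (abs_sub_one_le_two_mul_abs_log hT h2)
          (by positivity : 0 ≤ C * m.real univ)
        linarith
    · refine le_trans ?_ (le_max_right _ _)
      have hlog : Real.log 2 ≤ Real.log T := Real.log_le_log (by norm_num) h2
      have hlog0 : 0 < Real.log T := by linarith
      have h5 : Real.log (2 + T) ≤ 2 * Real.log T := by
        have : Real.log (2 + T) ≤ Real.log (T ^ 2) :=
          Real.log_le_log (by linarith) (by nlinarith)
        rw [Real.log_pow] at this
        exact_mod_cast this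
      rw [abs_mul, abs_inv, abs_of_pos hlog0, inv_mul_le_iff₀ hlog0]
      refine (abs_add_le _ _).trans ?_
      have h6 := (hE T hT).trans (mul_le_mul_of_nonneg_left h5 hE0)
      have h7 : |c| ≤ Real.log T * (|c| / Real.log 2) := by
        rw [mul_div_assoc', le_div_iff₀ hl2, mul_comm]
        exact mul_le_mul_of_nonneg_right hlog (abs_nonneg _)
      linarith
  exact ⟨hmem, by rw [← hlim]; exact evalAt_eq_logLim hω hmem hg fun T hT => hform T (by linarith)⟩

end

end NCHeat

namespace NCHeat

variable {H : Type*} [NormedAddCommGroup H] [InnerProductSpace ℂ H] [CompleteSpace H]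

/-! ### Linear extension of additive functionals on hereditary cones -/

/-- An additive, positively homogeneous functional on a hereditary cone of positive operators. -/
structure ConeFunctional (N : VonNeumannAlgebra H) where
  cone : Set (H →L[ℂ] H)
  toFun : (H →L[ℂ] H) → ℝ
  mem : ∀ P ∈ cone, P ∈ N
  nonneg : ∀ P ∈ cone, 0 ≤ P
  add_mem : ∀ P ∈ cone, ∀ Q ∈ cone, P + Q ∈ cone
  smul_mem : ∀ c : ℝ, 0 ≤ c → ∀ P ∈ cone, c • P ∈ cone
  posPart_mem : ∀ Y ∈ cone, ∀ X ∈ N, IsSelfAdjoint X → X ≤ Y → X⁺ ∈ cone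
  map_add : ∀ P ∈ cone, ∀ Q ∈ cone, toFun (P + Q) = toFun P + toFun Q
  map_smul : ∀ c : ℝ, 0 ≤ c → ∀ P ∈ cone, toFun (c • P) = c * toFun P

namespace ConeFunctional

variable {N : VonNeumannAlgebra H} (Φ : ConeFunctional N) {X Y : H →L[ℂ] H} {v w : ℂ}

/-- Heredity puts Y⁺ and Y⁻ in the cone; additivity applied to Y⁺ + Q = P + Y⁻ then shows that the
value does not depend on the decomposition. -/
theorem jordan_sub {Y P Q : H →L[ℂ] H} (hP : P ∈ Φ.cone) (hQ : Q ∈ Φ.cone) (h : Y = P - Q) :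
    Φ.toFun Y⁺ - Φ.toFun Y⁻ = Φ.toFun P - Φ.toFun Q := by
  have hYs : IsSelfAdjoint Y := by
    rw [h]
    exact (isSelfAdjoint_of_nonneg (Φ.nonneg P hP)).sub (isSelfAdjoint_of_nonneg (Φ.nonneg Q hQ))
  have hYN : Y ∈ N := by rw [h]; exact sub_mem (Φ.mem P hP) (Φ.mem Q hQ)
  have h1 : Y⁺ ∈ Φ.cone := Φ.posPart_mem P hP Y hYN hYs (by
    rw [h]; exact sub_le_self _ (Φ.nonneg Q hQ))
  have h2 : Y⁻ ∈ Φ.cone := by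
    rw [← CFC.posPart_neg]
    refine Φ.posPart_mem Q hQ (-Y) (neg_mem hYN) hYs.neg ?_
    rw [h, neg_sub]
    exact sub_le_self _ (Φ.nonneg P hP)
  have e : Y⁺ + Q = P + Y⁻ := by
    have : Y⁺ - Y⁻ = P - Q := (CFC.posPart_sub_negPart Y hYs).trans h
    rw [sub_eq_sub_iff_add_eq_add] at this
    exact this
  have e2 := congrArg Φ.toFun e
  rw [Φ.map_add _ h1 _ hQ, Φ.map_add _ hP _ h2] at e2
  linarith

/-- `X` is a combination of elements of the cone for which the linear extension gives `v`. -/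
def HasValue (X : H →L[ℂ] H) (v : ℂ) : Prop :=
  ∃ P ∈ Φ.cone, ∃ Q ∈ Φ.cone, ∃ R ∈ Φ.cone, ∃ S ∈ Φ.cone,
    X = (P - Q) + Complex.I • (R - S) ∧
    v = (Φ.toFun P - Φ.toFun Q) + Complex.I * (Φ.toFun R - Φ.toFun S)

variable {Φ}

theorem HasValue.jordanExtend_eq (h : Φ.HasValue X v) :
    jordanExtend (fun P => (Φ.toFun P : ℂ)) X = v := by
  obtain ⟨P, hP, Q, hQ, R, hR, S, hS, rfl, rfl⟩ := h
  have hs : IsSelfAdjoint (P - Q) :=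
    (isSelfAdjoint_of_nonneg (Φ.nonneg P hP)).sub (isSelfAdjoint_of_nonneg (Φ.nonneg Q hQ))
  have hs' : IsSelfAdjoint (R - S) :=
    (isSelfAdjoint_of_nonneg (Φ.nonneg R hR)).sub (isSelfAdjoint_of_nonneg (Φ.nonneg S hS))
  have hre : (ℜ ((P - Q) + Complex.I • (R - S)) : H →L[ℂ] H) = P - Q := by
    rw [_root_.map_add, realPart_I_smul, AddSubgroup.coe_add, hs.coe_realPart, hs'.imaginaryPart]
    simp
  have him : (ℑ ((P - Q) + Complex.I • (R - S)) : H →L[ℂ] H) = R - S := by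
    rw [_root_.map_add, imaginaryPart_I_smul, AddSubgroup.coe_add, hs'.coe_realPart, hs.imaginaryPart]
    simp
  have h1 := Φ.jordan_sub hP hQ hre
  have h2 := Φ.jordan_sub hR hS him
  rw [jordanExtend, ← Complex.ofReal_sub, ← Complex.ofReal_sub, h1, h2]
  push_cast
  rfl

theorem HasValue.add (hX : Φ.HasValue X v) (hY : Φ.HasValue Y w) :
    Φ.HasValue (X + Y) (v + w) := by
  obtain ⟨P, hP, Q, hQ, R, hR, S, hS, rfl, rfl⟩ := hX
  obtain ⟨P', hP', Q', hQ', R', hR', S', hS', rfl, rfl⟩ := hY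
  refine ⟨P + P', Φ.add_mem _ hP _ hP', Q + Q', Φ.add_mem _ hQ _ hQ', R + R',
    Φ.add_mem _ hR _ hR', S + S', Φ.add_mem _ hS _ hS', by module, ?_⟩
  rw [Φ.map_add _ hP _ hP', Φ.map_add _ hQ _ hQ', Φ.map_add _ hR _ hR', Φ.map_add _ hS _ hS']
  push_cast
  ring

theorem HasValue.neg (hX : Φ.HasValue X v) : Φ.HasValue (-X) (-v) := by
  obtain ⟨P, hP, Q, hQ, R, hR, S, hS, rfl, rfl⟩ := hX
  exact ⟨Q, hQ, P, hP, S, hS, R, hR, by module, by ring⟩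

theorem HasValue.sub (hX : Φ.HasValue X v) (hY : Φ.HasValue Y w) :
    Φ.HasValue (X - Y) (v - w) := by
  rw [sub_eq_add_neg, sub_eq_add_neg]
  exact hX.add hY.neg

theorem HasValue.I_smul (hX : Φ.HasValue X v) :
    Φ.HasValue (Complex.I • X) (Complex.I * v) := by
  obtain ⟨P, hP, Q, hQ, R, hR, S, hS, rfl, rfl⟩ := hX
  refine ⟨S, hS, R, hR, P, hP, Q, hQ, ?_, ?_⟩
  · rw [smul_add, smul_smul, Complex.I_mul_I]
    module
  · rw [mul_add, ← mul_assoc, Complex.I_mul_I]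
    ring

theorem HasValue.real_smul (hX : Φ.HasValue X v) (c : ℝ) : Φ.HasValue (c • X) (c * v) := by
  have key : ∀ a : ℝ, 0 ≤ a → Φ.HasValue (a • X) (a * v) := by
    intro a ha
    obtain ⟨P, hP, Q, hQ, R, hR, S, hS, rfl, rfl⟩ := hX
    refine ⟨a • P, Φ.smul_mem a ha _ hP, a • Q, Φ.smul_mem a ha _ hQ, a • R,
      Φ.smul_mem a ha _ hR, a • S, Φ.smul_mem a ha _ hS, ?_, ?_⟩
    · rw [smul_add, smul_sub, smul_comm, smul_sub]
    · rw [Φ.map_smul a ha _ hP, Φ.map_smul a ha _ hQ, Φ.map_smul a ha _ hR, Φ.map_smul a ha _ hS]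
      push_cast
      ring
  rcases le_total 0 c with h | h
  · exact key c h
  · have := (key (-c) (by linarith)).neg
    simpa using this

theorem HasValue.smul (hX : Φ.HasValue X v) (c : ℂ) : Φ.HasValue (c • X) (c * v) := by
  have := (hX.real_smul c.re).add (hX.I_smul.real_smul c.im)
  convert this using 1
  · conv_lhs => rw [← Complex.re_add_im c]
    rw [add_smul, mul_smul, Complex.coe_smul, Complex.coe_smul]
  · conv_lhs => rw [← Complex.re_add_im c]
    ring

theorem HasValue.sum {ι : Type*} {s : Finset ι} (hs : s.Nonempty) {X : ι → H →L[ℂ] H} {v : ι → ℂ}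
    (h : ∀ i ∈ s, Φ.HasValue (X i) (v i)) : Φ.HasValue (∑ i ∈ s, X i) (∑ i ∈ s, v i) := by
  induction hs using Finset.Nonempty.cons_induction with
  | singleton a => simpa using h a (by simp)
  | cons a s ha hs ih =>
    rw [Finset.sum_cons, Finset.sum_cons]
    exact (h a (by simp)).add (ih fun i hi => h i (by simp [hi]))

theorem hasValue_of_mem {P : H →L[ℂ] H} (hP : P ∈ Φ.cone) : Φ.HasValue P (Φ.toFun P) := by
  have h0 := Φ.smul_mem 0 le_rfl P hP
  have e0 := Φ.map_smul 0 le_rfl P hP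
  rw [zero_smul] at h0 e0
  rw [zero_mul] at e0
  exact ⟨P, hP, 0, h0, 0, h0, 0, h0, by simp, by simp [e0]⟩

end ConeFunctional

/-! ### Polarisation -/

/-- The operators `B + i^k` of the polarisation identity. -/
def polar (B : H →L[ℂ] H) (k : ℕ) : H →L[ℂ] H := B + (Complex.I ^ k) • 1

theorem polar_mem {N : VonNeumannAlgebra H} {B : H →L[ℂ] H} (hB : B ∈ N) (k : ℕ) :
    polar B k ∈ N := add_mem hB (csmul_mem _ (one_mem N))

/-- Polarisation turns one-sided multiplication by B into conjugations, which preserve positivity.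
-/
theorem mul_eq_sum_polar (Q B : H →L[ℂ] H) :
    Q * B = (4⁻¹ : ℂ) • ∑ k ∈ Finset.range 4,
      (Complex.I ^ k) • (star (polar B k) * Q * polar B k) := by
  have hI2 : Complex.I ^ 2 = -1 := Complex.I_sq
  have hI3 : Complex.I ^ 3 = -Complex.I := by rw [pow_succ, hI2]; ring
  simp only [Finset.sum_range_succ, Finset.sum_range_zero, polar, hI2, hI3, pow_zero, pow_one,
    star_add, star_smul, star_one, RCLike.star_def, Complex.conj_I, map_neg, map_one,
    add_mul, mul_add, smul_mul_assoc, mul_smul_comm, one_mul, mul_one, smul_add, smul_smul,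
    Complex.I_mul_I, neg_mul, mul_neg, neg_neg]
  module

end NCHeat

namespace NCHeat

variable {H : Type*} [NormedAddCommGroup H] [InnerProductSpace ℂ H] [CompleteSpace H]

namespace FNSTrace

variable {N : VonNeumannAlgebra H} {τ : FNSTrace N} {P Q X C : H →L[ℂ] H}
  {ω : LInfty →ₗ[ℝ] ℝ}

/-! ### Spectral measures of log-bounded operators -/

theorem continuousOn_spectrum {k : ℝ → ℝ} (hP : 0 ≤ P) (hk : ContinuousOn k (Ici 0)) :
    ContinuousOn k (spectrum ℝ P) :=
  hk.mono fun _ hx => spectrum_nonneg_of_nonneg hP hx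

theorem mul_cfc_mul (hP : 0 ≤ P) {k : ℝ → ℝ} (hk : ContinuousOn k (Ici 0)) :
    P * cfc k P * P = cfc (fun x => x ^ 2 * k x) P := by
  have hPs := isSelfAdjoint_of_nonneg hP
  have hc := continuousOn_spectrum hP hk
  have h1 : cfc (fun x : ℝ => x * k x * x) P = P * cfc k P * P := by
    rw [cfc_mul (fun x : ℝ => x * k x) (fun x => x) P (continuousOn_id.mul hc) continuousOn_id,
      cfc_mul (fun x : ℝ => x) k P continuousOn_id hc, cfc_id' ℝ P]
  rw [← h1]
  exact cfc_congr fun x _ => by ring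

/-- For T = 1/(‖P‖ + 1) the cut-off is inactive on the spectrum: `quadCut` is a multiple of x²
there. -/
theorem LogBounded.sq_lt_top (hP : τ.LogBounded P) : τ.toFun (P * P) < ∞ := by
  obtain ⟨D, hD0, hD⟩ := hP.trace_quadCut_le
  set r := ‖P‖ + 1 with hr
  have hr0 : 0 < r := by positivity
  have hPs := hP.isSelfAdjoint
  have hq := continuous_quadCut (inv_pos.2 hr0)
  have e : P * P = r • cfc (quadCut r⁻¹) P := by
    rw [← cfc_smul r (quadCut r⁻¹) P hq.continuousOn, ← sq, ← cfc_pow_id (R := ℝ) P 2]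
    refine cfc_congr fun x hx => ?_
    have hx' : x ≤ r := (le_norm_of_mem_spectrum hx).trans (by linarith)
    simp only [quadCut, inv_inv, smul_eq_mul]
    rw [max_eq_right hx']
    field_simp
  rw [e, τ.map_smul r hr0.le _ (cfc_mem hP.mem _)
    (cfc_nonneg fun x _ => quadCut_nonneg (inv_pos.2 hr0) x)]
  exact ENNReal.mul_lt_top ENNReal.ofReal_lt_top
    ((hD _ (inv_pos.2 hr0)).trans_lt ENNReal.ofReal_lt_top)

theorem LogBounded.mul_sq_lt_top (hP : τ.LogBounded P) (hC : C ∈ N) :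
    τ.toFun (star (P * C) * (P * C)) < ∞ := by
  have hPs : star P = P := hP.isSelfAdjoint.star_eq
  have e : star (P * C) * (P * C) = star C * (P * P) * C := by
    rw [star_mul, hPs]; noncomm_ring
  have h0 : 0 ≤ P * P := by
    have := star_mul_self_nonneg P
    rwa [hPs] at this
  rw [e]
  exact (τ.conj_le' (mul_mem hP.mem hP.mem) h0 hC).trans_lt
    (ENNReal.mul_lt_top ENNReal.ofReal_lt_top hP.sq_lt_top)

/-- The measure `m` represents the functional `k ↦ τ(C* P k(P) P C)`. -/
structure Represents (τ : FNSTrace N) (P C : H →L[ℂ] H) (m : Measure ℝ) : Prop where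
  finite : IsFiniteMeasure m
  logMeasure : LogMeasure m
  trace_eq : ∀ k : ℝ → ℝ, ContinuousOn k (Ici 0) → (∀ x, 0 ≤ x → 0 ≤ k x) →
    τ.toFun (star C * cfc (fun x => x ^ 2 * k x) P * C) = ∫⁻ x, ENNReal.ofReal (k x) ∂m

/-- Take the spectral measure of P for S = PC, which is Hilbert–Schmidt. The weight min(T, 1/x)
pairs with x² to give `quadCut`, whence the logarithmic growth. -/
theorem LogBounded.exists_represents (hP : τ.LogBounded P) (hC : C ∈ N) :
    ∃ m : Measure ℝ, τ.Represents P C m := by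
  obtain ⟨m, hfin, -, hm⟩ := τ.exists_spectralMeasure hP.mem hP.nonneg (mul_mem hP.mem hC)
    (hP.mul_sq_lt_top hC)
  have hPs : star P = P := hP.isSelfAdjoint.star_eq
  have hrep : ∀ k : ℝ → ℝ, ContinuousOn k (Ici 0) → (∀ x, 0 ≤ x → 0 ≤ k x) →
      τ.toFun (star C * cfc (fun x => x ^ 2 * k x) P * C) = ∫⁻ x, ENNReal.ofReal (k x) ∂m := by
    intro k hk hk0
    rw [← hm k hk hk0, ← mul_cfc_mul hP.nonneg hk, star_mul, hPs]
    congr 1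
  refine ⟨m, hfin, ?_, hrep⟩
  obtain ⟨D, hD0, hD⟩ := hP.trace_quadCut_le
  refine ⟨‖C‖ ^ 2 * D, by positivity, fun T hT => ?_⟩
  have hl := log_two_add_pos hT.le
  rw [integral_eq_lintegral_of_nonneg_ae (Eventually.of_forall fun x => inv_max_nonneg hT x)
    (continuous_inv_max hT).aestronglyMeasurable, ← hrep _ (continuous_inv_max hT).continuousOn
    fun x _ => inv_max_nonneg hT x]
  refine ENNReal.toReal_le_of_le_ofReal (by positivity) ?_
  refine (τ.conj_le' (cfc_mem hP.mem _) (cfc_nonneg fun x _ => quadCut_nonneg hT x) hC).trans ?_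
  rw [mul_assoc, ENNReal.ofReal_mul (by positivity)]
  exact mul_le_mul_right (hD T hT) _

/-! ### The Dixmier functional -/

/-- `τ(C* (P - 1/T)₊ C)`. -/
def thrTrace (τ : FNSTrace N) (P C : H →L[ℂ] H) (T : ℝ) : ℝ :=
  (τ.toFun (star C * softThr P T⁻¹ * C)).toReal

/-- The generalised limit of `τ(C* (P - 1/T)₊ C) / log(2 + T)`. -/
def dixmier (τ : FNSTrace N) (ω : LInfty →ₗ[ℝ] ℝ) (P C : H →L[ℂ] H) : ℝ :=
  logLim ω (τ.thrTrace P C)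

theorem thrTrace_one (τ : FNSTrace N) (P : H →L[ℂ] H) (T : ℝ) :
    τ.thrTrace P 1 T = (τ.toFun (softThr P T⁻¹)).toReal := by
  rw [thrTrace, star_one, one_mul, mul_one]

/-- The reason for this reference profile: its dilated integral is exactly the thresholded trace. -/
theorem sq_mul_refProfile {T x : ℝ} (hT : 0 < T) :
    x ^ 2 * (T * refProfile (T * x)) = max (x - T⁻¹) 0 := by
  have hTi : T * T⁻¹ = 1 := mul_inv_cancel₀ hT.ne'
  rcases le_total (T * x) 1 with h | h
  · rw [refProfile_of_le h, max_eq_right]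
    · ring
    · by_contra hc
      push Not at hc
      nlinarith
  · have hx : 0 < x := by
      by_contra hc
      push Not at hc
      nlinarith
    rw [refProfile_of_ge h, max_eq_left]
    · field_simp
    · by_contra hc
      push Not at hc
      nlinarith

theorem refProfile_nonneg (y : ℝ) : 0 ≤ refProfile y := by
  have := one_le_max_one y
  rw [refProfile]
  positivity

theorem Represents.thrTrace_eq {m : Measure ℝ} (hP : τ.LogBounded P) (hm : τ.Represents P C m)
    {T : ℝ} (hT : 0 < T) : τ.thrTrace P C T = dilInt m refProfile T := by
  have hc : Continuous fun x => T * refProfile (T * x) :=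
    continuous_const.mul (continuous_refProfile.comp (continuous_const.mul continuous_id))
  have h0 : ∀ x, 0 ≤ T * refProfile (T * x) := fun x => mul_nonneg hT.le (refProfile_nonneg _)
  rw [thrTrace, dilInt, integral_eq_lintegral_of_nonneg_ae (Eventually.of_forall h0)
    hc.aestronglyMeasurable, ← hm.trace_eq _ hc.continuousOn fun x _ => h0 x,
    softThr_eq_cfc hP.isSelfAdjoint]
  simp only [sq_mul_refProfile hT]

theorem LogBounded.logGrowth (hP : τ.LogBounded P) (hC : C ∈ N) :
    LogGrowth (τ.thrTrace P C) := by
  obtain ⟨m, hm⟩ := hP.exists_represents hC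
  have := hm.finite
  exact (logGrowth_dilInt hm.logMeasure continuous_refProfile abs_refProfile_le).congr
    fun T hT => hm.thrTrace_eq hP hT

theorem LogBounded.logGrowth_one (hP : τ.LogBounded P) : LogGrowth (τ.thrTrace P 1) :=
  hP.logGrowth (one_mem N)

theorem LogBounded.conj_softThr_lt_top (hP : τ.LogBounded P) (hC : C ∈ N) {ε : ℝ} (hε : 0 < ε) :
    τ.toFun (star C * softThr P ε * C) < ∞ :=
  (τ.conj_le' (softThr_mem hP.mem ε) (softThr_nonneg _ _) hC).trans_lt
    (ENNReal.mul_lt_top ENNReal.ofReal_lt_top (hP.softThr_lt_top hε))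

theorem LogBounded.dixmier_add (hω : IsGeneralisedLimit ω) (hωd : IsDilationInvariant ω)
    (hP : τ.LogBounded P) (hQ : τ.LogBounded Q) :
    τ.dixmier ω (P + Q) 1 = τ.dixmier ω P 1 + τ.dixmier ω Q 1 := by
  have hPQ := hP.add hQ
  have hs := hP.logGrowth_one.add hQ.logGrowth_one
  have hfin : ∀ {T : ℝ}, 0 < T → τ.toFun (softThr P T⁻¹) < ∞ ∧ τ.toFun (softThr Q T⁻¹) < ∞ :=
    fun hT => ⟨hP.softThr_lt_top (inv_pos.2 hT), hQ.softThr_lt_top (inv_pos.2 hT)⟩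
  rw [dixmier, dixmier, dixmier, ← logLim_add hP.logGrowth_one hQ.logGrowth_one]
  refine le_antisymm ?_ ?_
  · obtain ⟨h1, h2⟩ := logLim_dilate hω hωd hPQ.logGrowth_one (s := 2) two_pos
    rw [← h2]
    refine logLim_mono hω h1 hs fun T hT => ?_
    rw [thrTrace_one, thrTrace_one, thrTrace_one,
      ← ENNReal.toReal_add (hfin hT).1.ne (hfin hT).2.ne]
    refine ENNReal.toReal_mono (ENNReal.add_lt_top.2 (hfin hT)).ne ?_
    have e : (T / 2)⁻¹ = T⁻¹ + T⁻¹ := by field_simp; norm_num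
    rw [e]
    exact τ.softThr_add_le hP.mem hP.isSelfAdjoint hQ.mem hQ.isSelfAdjoint _ _
  -- Superadditivity is used with loss δ = 1/(2T), which lowers the threshold 1/T to 1/(2T).
  · obtain ⟨h1, h2⟩ := logLim_dilate hω hωd hPQ.logGrowth_one (s := 1 / 2) (by norm_num)
    rw [← h2]
    refine logLim_mono hω hs h1 fun T hT => ?_
    rw [thrTrace_one, thrTrace_one, thrTrace_one,
      ← ENNReal.toReal_add (hfin hT).1.ne (hfin hT).2.ne]
    refine ENNReal.toReal_mono (hPQ.softThr_lt_top (by positivity)).ne ?_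
    have e : (T / (1 / 2))⁻¹ = T⁻¹ - T⁻¹ / 2 := by field_simp; norm_num
    rw [e]
    exact τ.softThr_add_ge hP.mem hP.nonneg hQ.mem hQ.nonneg (by positivity) (by positivity)

theorem LogBounded.dixmier_smul (hω : IsGeneralisedLimit ω) (hωd : IsDilationInvariant ω)
    (hP : τ.LogBounded P) {c : ℝ} (hc : 0 ≤ c) :
    τ.dixmier ω (c • P) 1 = c * τ.dixmier ω P 1 := by
  rcases hc.eq_or_lt with rfl | hc'
  · have h := LogBounded.dixmier_add hω hωd (LogBounded.zero (τ := τ)) LogBounded.zero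
    rw [add_zero] at h
    rw [zero_smul, zero_mul]
    linarith
  · obtain ⟨h1, h2⟩ := logLim_dilate hω hωd hP.logGrowth_one (s := c⁻¹) (by positivity)
    rw [dixmier, dixmier, ← h2, ← logLim_const_mul h1]
    refine logLim_congr fun T hT => ?_
    have e : T⁻¹ = c * (T / c⁻¹)⁻¹ := by field_simp
    rw [thrTrace_one, thrTrace_one]
    conv_lhs => rw [e]
    rw [softThr_smul P hc, τ.map_smul c hc _ (softThr_mem hP.mem _) (softThr_nonneg _ _),
      ENNReal.toReal_mul, ENNReal.toReal_ofReal hc]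

theorem dixmier_star_mul_self_le (hω : IsGeneralisedLimit ω) (hωd : IsDilationInvariant ω)
    (hX : X ∈ N) (h1 : τ.LogBounded (X * star X))
    (h2 : τ.LogBounded (star X * X)) :
    τ.dixmier ω (star X * X) 1 ≤ τ.dixmier ω (X * star X) 1 := by
  obtain ⟨h3, h4⟩ := logLim_dilate hω hωd h2.logGrowth_one (s := 2) two_pos
  rw [dixmier, dixmier, ← h4]
  refine logLim_mono hω h3 h1.logGrowth_one fun T hT => ?_
  rw [thrTrace_one, thrTrace_one]
  refine ENNReal.toReal_mono (h1.softThr_lt_top (inv_pos.2 hT)).ne ?_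
  have e : (T / 2)⁻¹ = 2 * T⁻¹ := by field_simp
  rw [e]
  exact τ.softThr_star_mul_self_le hX (inv_pos.2 hT)

theorem logBounded_mul_star_self (hX : X ∈ N) (h : τ.LogBounded (star X * X)) :
    τ.LogBounded (X * star X) := by
  refine h.of_le (mul_mem hX (star_mem hX)) (mul_star_self_nonneg X) two_pos zero_le_one
    fun ε hε => ?_
  have := τ.softThr_star_mul_self_le (star_mem hX) hε
  rw [star_star] at this
  rwa [ENNReal.ofReal_one, one_mul]

theorem dixmier_star_mul_self (hω : IsGeneralisedLimit ω) (hωd : IsDilationInvariant ω)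
    (hX : X ∈ N) (h : τ.LogBounded (star X * X)) :
    τ.dixmier ω (star X * X) 1 = τ.dixmier ω (X * star X) 1 := by
  have h' := logBounded_mul_star_self hX h
  refine le_antisymm (dixmier_star_mul_self_le hω hωd hX h' h) ?_
  have := dixmier_star_mul_self_le hω hωd (star_mem hX) (τ := τ) (by rwa [star_star])
    (by rwa [star_star])
  rwa [star_star] at this

theorem LogBounded.dixmier_conj_le (hω : IsGeneralisedLimit ω) (hP : τ.LogBounded P) (hC : C ∈ N) (h1 : ‖C‖ ≤ 1) :
    τ.dixmier ω (star C * P * C) 1 ≤ τ.dixmier ω P C := by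
  refine logLim_mono hω (hP.conj hC).logGrowth_one (hP.logGrowth hC) fun T hT => ?_
  rw [thrTrace_one, thrTrace]
  exact ENNReal.toReal_mono (hP.conj_softThr_lt_top hC (inv_pos.2 hT)).ne
    (τ.softThr_conj_le hP.mem hP.isSelfAdjoint hC h1 (by positivity))

/-- Already true before the limit: for Y = (P - 1/T)₊ the two traces add up to τ(√Y(CC* + DD*)√Y) =
τ(Y). -/
theorem LogBounded.dixmier_add_dixmier (hP : τ.LogBounded P) {D : H →L[ℂ] H} (hC : C ∈ N)
    (hD : D ∈ N) (h : C * star C + D * star D = 1) :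
    τ.dixmier ω P C + τ.dixmier ω P D = τ.dixmier ω P 1 := by
  rw [dixmier, dixmier, dixmier, ← logLim_add (hP.logGrowth hC) (hP.logGrowth hD)]
  refine logLim_congr fun T hT => ?_
  have hT' := inv_pos.2 hT
  rw [thrTrace, thrTrace, thrTrace_one, ← ENNReal.toReal_add (hP.conj_softThr_lt_top hC hT').ne
    (hP.conj_softThr_lt_top hD hT').ne]
  have hYN : softThr P T⁻¹ ∈ N := softThr_mem hP.mem _
  have hY0 : 0 ≤ softThr P T⁻¹ := softThr_nonneg _ _
  generalize softThr P T⁻¹ = Y at hYN hY0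
  have hss : star (CFC.sqrt Y) = CFC.sqrt Y :=
    (isSelfAdjoint_of_nonneg (CFC.sqrt_nonneg Y)).star_eq
  have hsm := sqrt_mem hYN
  have hpos : ∀ K : H →L[ℂ] H, 0 ≤ CFC.sqrt Y * (K * star K) * CFC.sqrt Y := fun K => by
    have := conj_nonneg' (mul_star_self_nonneg K) (CFC.sqrt Y)
    rwa [hss] at this
  rw [τ.conj_eq hYN hY0 hC, τ.conj_eq hYN hY0 hD, ← τ.map_add _
    (mul_mem (mul_mem hsm (mul_mem hC (star_mem hC))) hsm) _
    (mul_mem (mul_mem hsm (mul_mem hD (star_mem hD))) hsm) (hpos C) (hpos D), ← add_mul,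
    ← mul_add, h, mul_one, CFC.sqrt_mul_sqrt_self _ hY0]

theorem LogBounded.dixmier_conj_eq_sqrt (hω : IsGeneralisedLimit ω) (hωd : IsDilationInvariant ω)
    (hP : τ.LogBounded P) {K : H →L[ℂ] H} (hK : K ∈ N) :
    τ.LogBounded (CFC.sqrt P * (K * star K) * CFC.sqrt P) ∧
      τ.dixmier ω (star K * P * K) 1
        = τ.dixmier ω (CFC.sqrt P * (K * star K) * CFC.sqrt P) 1 := by
  have hss : star (CFC.sqrt P) = CFC.sqrt P :=
    (isSelfAdjoint_of_nonneg (CFC.sqrt_nonneg P)).star_eq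
  have hsm := sqrt_mem hP.mem
  have e1 : star (CFC.sqrt P * K) * (CFC.sqrt P * K) = star K * P * K := by
    rw [star_mul, hss, mul_assoc, ← mul_assoc (CFC.sqrt P), CFC.sqrt_mul_sqrt_self _ hP.nonneg,
      mul_assoc]
  have e2 : CFC.sqrt P * K * star (CFC.sqrt P * K)
      = CFC.sqrt P * (K * star K) * CFC.sqrt P := by
    rw [star_mul, hss]
    simp only [mul_assoc]
  have hb : τ.LogBounded (star (CFC.sqrt P * K) * (CFC.sqrt P * K)) := by
    rw [e1]; exact hP.conj hK
  rw [← e1, ← e2]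
  exact ⟨logBounded_mul_star_self (mul_mem hsm hK) hb,
    dixmier_star_mul_self hω hωd (mul_mem hsm hK) hb⟩

/-- Complete C by D = (1 - CC*)^{1/2}. The functional of the conjugates and the localised functional
both have total φ(P) over C and D, and the former is at most the latter for each; hence equality. -/
theorem LogBounded.dixmier_conj_of_norm_le_one (hω : IsGeneralisedLimit ω)
    (hωd : IsDilationInvariant ω) (hP : τ.LogBounded P) (hC : C ∈ N) (h1 : ‖C‖ ≤ 1) :
    τ.dixmier ω (star C * P * C) 1 = τ.dixmier ω P C := by
  obtain ⟨D, hDN, hDs, hDD⟩ : ∃ D ∈ N, star D = D ∧ D * D = 1 - C * star C := by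
    have hE0 : 0 ≤ 1 - C * star C := sub_nonneg.2 (self_mul_star_le_one h1)
    have hEN : 1 - C * star C ∈ N := sub_mem (one_mem N) (mul_mem hC (star_mem hC))
    generalize 1 - C * star C = E at hE0 hEN
    exact ⟨CFC.sqrt E, sqrt_mem hEN, (isSelfAdjoint_of_nonneg (CFC.sqrt_nonneg E)).star_eq,
      CFC.sqrt_mul_sqrt_self E hE0⟩
  have hD1 : ‖D‖ ≤ 1 := by
    refine norm_le_one_of_star_mul_self_le_one ?_
    rw [hDs, hDD]
    exact sub_le_self _ (mul_star_self_nonneg C)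
  have hsum : C * star C + D * star D = 1 := by rw [hDs, hDD]; abel
  have hphi : τ.dixmier ω (star C * P * C) 1 + τ.dixmier ω (star D * P * D) 1
      = τ.dixmier ω P 1 := by
    obtain ⟨hCb, hCe⟩ := hP.dixmier_conj_eq_sqrt hω hωd hC
    obtain ⟨hDb, hDe⟩ := hP.dixmier_conj_eq_sqrt hω hωd hDN
    rw [hCe, hDe, ← LogBounded.dixmier_add hω hωd hCb hDb, ← add_mul, ← mul_add, hsum, mul_one,
      CFC.sqrt_mul_sqrt_self _ hP.nonneg]
  have hpsi := hP.dixmier_add_dixmier (ω := ω) hC hDN hsum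
  have i1 := hP.dixmier_conj_le hω hC h1
  have i2 := hP.dixmier_conj_le hω hDN hD1
  linarith

theorem LogBounded.dixmier_conj (hω : IsGeneralisedLimit ω) (hωd : IsDilationInvariant ω)
    (hP : τ.LogBounded P) (hC : C ∈ N) :
    τ.dixmier ω (star C * P * C) 1 = τ.dixmier ω P C := by
  set r := ‖C‖ + 1 with hr
  have hr0 : 0 < r := by positivity
  set K := r⁻¹ • C with hK
  have hKN : K ∈ N := rsmul_mem _ hC
  have hK1 : ‖K‖ ≤ 1 := by
    rw [hK, norm_smul, norm_inv, Real.norm_eq_abs, abs_of_pos hr0, inv_mul_le_iff₀ hr0]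
    linarith
  have hCK : C = r • K := by rw [hK, smul_smul, mul_inv_cancel₀ hr0.ne', one_smul]
  have hconj : ∀ Y : H →L[ℂ] H, star C * Y * C = (r ^ 2) • (star K * Y * K) := by
    intro Y
    rw [hCK, star_smul, star_trivial, smul_mul_assoc, smul_mul_assoc, mul_smul_comm, smul_smul, sq]
  rw [hconj, LogBounded.dixmier_smul hω hωd (hP.conj hKN) (by positivity),
    hP.dixmier_conj_of_norm_le_one hω hωd hKN hK1, dixmier, dixmier,
    ← logLim_const_mul (hP.logGrowth hKN)]
  refine logLim_congr fun T hT => ?_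
  rw [thrTrace, thrTrace, hconj, τ.map_smul _ (by positivity) _
    (mul_mem (mul_mem (star_mem hKN) (softThr_mem hP.mem _)) hKN)
    (conj_nonneg' (softThr_nonneg _ _) K), ENNReal.toReal_mul,
    ENNReal.toReal_ofReal (by positivity)]

/-- The Dixmier functional on the cone of log-bounded operators. -/
def dixmierFunctional (τ : FNSTrace N) (hω : IsGeneralisedLimit ω) (hωd : IsDilationInvariant ω) :
    ConeFunctional N where
  cone := {P | τ.LogBounded P}
  toFun P := τ.dixmier ω P 1
  mem _ h := h.mem
  nonneg _ h := h.nonneg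
  add_mem _ h _ h' := LogBounded.add h h'
  smul_mem _ hc _ h := LogBounded.smul h hc
  posPart_mem _ hY _ hX hXs h := LogBounded.posPart_of_le hY hX hXs h
  map_add _ h _ h' := LogBounded.dixmier_add hω hωd h h'
  map_smul _ hc _ h := LogBounded.dixmier_smul hω hωd h hc

/-- The trace on the cone of positive operators of finite trace. -/
def finiteFunctional (τ : FNSTrace N) : ConeFunctional N where
  cone := {P | P ∈ N ∧ 0 ≤ P ∧ τ.toFun P < ∞}
  toFun P := (τ.toFun P).toReal
  mem _ h := h.1
  nonneg _ h := h.2.1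
  add_mem P h Q h' := ⟨add_mem h.1 h'.1, add_nonneg h.2.1 h'.2.1, by
    rw [τ.map_add _ h.1 _ h'.1 h.2.1 h'.2.1]; exact ENNReal.add_lt_top.2 ⟨h.2.2, h'.2.2⟩⟩
  smul_mem c hc P h := ⟨rsmul_mem _ h.1, smul_nonneg hc h.2.1, by
    rw [τ.map_smul c hc _ h.1 h.2.1]; exact ENNReal.mul_lt_top ENNReal.ofReal_lt_top h.2.2⟩
  posPart_mem Y hY X hX hXs h := ⟨posPart_mem hX, CFC.posPart_nonneg X,
    (τ.posPart_le hX hXs hY.1 hY.2.1 h).trans_lt hY.2.2⟩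
  map_add P h Q h' := by
    rw [τ.map_add _ h.1 _ h'.1 h.2.1 h'.2.1, ENNReal.toReal_add h.2.2.ne h'.2.2.ne]
  map_smul c hc P h := by
    rw [τ.map_smul c hc _ h.1 h.2.1, ENNReal.toReal_mul, ENNReal.toReal_ofReal hc]

/-- The value at `P B` of the linear extension of the Dixmier functional. -/
def dixmierMul (τ : FNSTrace N) (ω : LInfty →ₗ[ℝ] ℝ) (P B : H →L[ℂ] H) : ℂ :=
  4⁻¹ * ∑ k ∈ Finset.range 4, Complex.I ^ k * (τ.dixmier ω P (polar B k) : ℂ)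

theorem LogBounded.hasValue_mul (hω : IsGeneralisedLimit ω) (hωd : IsDilationInvariant ω)
    (hP : τ.LogBounded P) {B : H →L[ℂ] H} (hB : B ∈ N) :
    (τ.dixmierFunctional hω hωd).HasValue (P * B) (τ.dixmierMul ω P B) := by
  rw [mul_eq_sum_polar]
  refine ConeFunctional.HasValue.smul (ConeFunctional.HasValue.sum (by simp) fun k _ => ?_) _
  refine ConeFunctional.HasValue.smul ?_ _
  rw [← hP.dixmier_conj hω hωd (polar_mem hB k)]
  exact ConeFunctional.hasValue_of_mem (Φ := τ.dixmierFunctional hω hωd) (hP.conj (polar_mem hB k))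

/-- The products of the Jordan parts of A with B recombine to AB. They are not positive in general,
so independence of the decomposition is what identifies the value. -/
theorem jordanExtend_dixmier_mul (hω : IsGeneralisedLimit ω) (hωd : IsDilationInvariant ω)
    {A B : H →L[ℂ] H} (hA : A ∈ τ.dixmierIdeal) (hB : B ∈ N) :
    jordanExtend (fun P => (τ.dixmier ω P 1 : ℂ)) (A * B)
      = jordanExtend (fun P => τ.dixmierMul ω P B) A := by
  have key : ∀ {P}, P ∈ jordanParts A →
      (τ.dixmierFunctional hω hωd).HasValue (P * B) (τ.dixmierMul ω P B) := fun hP =>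
    (logBounded_of_mem_jordanParts hA hP).hasValue_mul hω hωd hB
  have h := ((key (P := (ℜ A : H →L[ℂ] H)⁺) (by simp [jordanParts])).sub
    (key (P := (ℜ A : H →L[ℂ] H)⁻) (by simp [jordanParts]))).add
    ((key (P := (ℑ A : H →L[ℂ] H)⁺) (by simp [jordanParts])).sub
    (key (P := (ℑ A : H →L[ℂ] H)⁻) (by simp [jordanParts]))).I_smul
  rw [← sub_mul, ← sub_mul, CFC.posPart_sub_negPart _ (ℜ A).2, CFC.posPart_sub_negPart _ (ℑ A).2,
    ← smul_mul_assoc, ← add_mul, realPart_add_I_smul_imaginaryPart] at h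
  exact h.jordanExtend_eq

end FNSTrace

end NCHeat

namespace NCHeat

variable {H : Type*} [NormedAddCommGroup H] [InnerProductSpace ℂ H] [CompleteSpace H]

/-! ### Profiles of functions vanishing to second order -/

/-- `f(x) = x² k(x)` on `[0,∞)` with `k` continuous and `O(min(1, x⁻²))`. -/
structure IsProfile (f k : ℝ → ℝ) (C : ℝ) : Prop where
  continuous : Continuous k
  bound : ∀ y, |k y| ≤ C * ((max y 1) ^ 2)⁻¹
  eq : ∀ x, 0 ≤ x → f x = x ^ 2 * k x

/-- k is f(x)/x² completed at 0 by its limit and extended as a constant to the negative axis;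
boundedness of f gives the decay at infinity. -/
theorem exists_isProfile {f : ℝ → ℝ} (hf : ContinuousOn f (Ioi 0))
    (hb : ∃ C : ℝ, ∀ s : ℝ, 0 ≤ s → |f s| ≤ C) (h0 : f 0 = 0) {a : ℝ}
    (ha : Tendsto (fun x => f x / x ^ 2) (𝓝[>] 0) (𝓝 a)) : ∃ k C, IsProfile f k C := by
  obtain ⟨D, hD⟩ := hb
  set g : ℝ → ℝ := Function.update (fun x => f x / x ^ 2) 0 a with hg
  have hgpos : ∀ x, x ≠ 0 → g x = f x / x ^ 2 := fun x hx => Function.update_of_ne hx _ _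
  have hgc : ContinuousOn g (Ici 0) := by
    intro x hx
    rcases (mem_Ici.1 hx).eq_or_lt with rfl | hx0
    · rw [hg, continuousWithinAt_update_same, Ici_sdiff_left]
      exact ha
    · have h1 : ContinuousAt (fun x => f x / x ^ 2) x :=
        (hf.continuousAt (Ioi_mem_nhds hx0)).div (by fun_prop) (by positivity)
      refine (h1.congr ?_).continuousWithinAt
      filter_upwards [Ioi_mem_nhds hx0] with y hy
      exact (hgpos y (ne_of_gt hy)).symm
  have hk : Continuous fun y : ℝ => g (max y 0) :=
    hgc.comp_continuous (by fun_prop) fun y => mem_Ici.2 (le_max_right _ _)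
  obtain ⟨E, hE⟩ := (isCompact_Icc (a := (0 : ℝ)) (b := 1)).exists_bound_of_continuousOn
    (hgc.mono Icc_subset_Ici_self)
  refine ⟨fun y => g (max y 0), max E D, hk, fun y => ?_, fun x hx => ?_⟩
  · rcases le_total y 1 with hy | hy
    · rw [max_eq_right hy]
      have := hE (max y 0) ⟨le_max_right _ _, max_le hy zero_le_one⟩
      rw [Real.norm_eq_abs] at this
      simpa using Or.inl this
    · have hy0 : 0 < y := by linarith
      rw [max_eq_left hy0.le, max_eq_left hy, hgpos y hy0.ne', abs_div,
        abs_of_pos (by positivity : 0 < y ^ 2), div_eq_mul_inv]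
      exact mul_le_mul_of_nonneg_right ((hD y hy0.le).trans (le_max_right _ _)) (by positivity)
  · simp only [max_eq_left hx]
    rcases hx.eq_or_lt with rfl | hx0
    · rw [h0]; ring
    · rw [hgpos x hx0.ne']
      field_simp

theorem IsProfile.continuousOn {f k : ℝ → ℝ} {C : ℝ} (h : IsProfile f k C) :
    ContinuousOn f (Ici 0) :=
  ((continuous_pow 2).mul h.continuous).continuousOn.congr fun x hx => h.eq x hx

theorem IsProfile.integral {f k : ℝ → ℝ} {C : ℝ} (h : IsProfile f k C) :
    IntegrableOn (fun s => f s / s ^ 2) (Ioi 0) ∧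
      ∫ s in Ioi (0 : ℝ), f s / s ^ 2 = ∫ s in Ioi (0 : ℝ), k s := by
  have e : EqOn (fun s => f s / s ^ 2) k (Ioi 0) := fun s hs => by
    have hs0 : 0 < s := hs
    simp only [h.eq s hs0.le]
    field_simp
  exact ⟨(integrableOn_Ioi_zero h.continuous h.bound).congr_fun e.symm measurableSet_Ioi,
    setIntegral_congr_fun measurableSet_Ioi e⟩

theorem tendsto_div_sq_of_contDiffOn {f : ℝ → ℝ} (hf : ContDiffOn ℝ 2 f (Ici 0)) (h0 : f 0 = 0)
    (h1 : derivWithin f (Ici 0) 0 = 0) : ∃ a, Tendsto (fun x => f x / x ^ 2) (𝓝[>] 0) (𝓝 a) := by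
  set a := 2⁻¹ * iteratedDerivWithin 2 f (Ici 0) 0 with ha
  have ht := (Real.taylor_tendsto (n := 2) (convex_Ici 0) (self_mem_Ici (a := (0 : ℝ)))
    (by exact_mod_cast hf)).mono_left (nhdsWithin_mono 0 Ioi_subset_Ici_self)
  refine ⟨a, ?_⟩
  have h2 := ht.add_const a
  rw [zero_add] at h2
  refine h2.congr' ?_
  filter_upwards [self_mem_nhdsWithin] with x hx
  have hx0 : 0 < x := hx
  have e : taylorWithinEval f 2 (Ici 0) 0 x = a * x ^ 2 := by
    rw [taylorWithinEval_succ, taylorWithinEval_succ, taylor_within_zero_eval,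
      iteratedDerivWithin_one, h0, h1, ha]
    simp
    ring
  rw [e, sub_zero]
  field_simp
  ring

/-! ### The exponential profile -/

theorem expInv_of_pos {q x : ℝ} (hx : 0 < x) : expInv q x = Real.exp (-(x ^ (-q))) := by
  rw [expInv, if_neg (not_le.2 hx)]

theorem exists_isProfile_expInv {q : ℝ} (hq : 0 < q) : ∃ k C, IsProfile (expInv q) k C := by
  refine exists_isProfile (a := 0) ?_ ⟨1, fun s _ => ?_⟩ (by simp [expInv]) ?_
  · have : ContinuousOn (fun x : ℝ => Real.exp (-(x ^ (-q)))) (Ioi 0) := by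
      refine Real.continuous_exp.comp_continuousOn (ContinuousOn.neg fun x hx => ?_)
      exact (Real.continuousAt_rpow_const x (-q) (Or.inl (ne_of_gt hx))).continuousWithinAt
    exact this.congr fun x hx => expInv_of_pos hx
  · rw [expInv]
    split_ifs with h
    · simp
    · push Not at h
      rw [Real.abs_exp, Real.exp_le_one_iff, neg_nonpos]
      positivity
  -- With y = x^{-q}, the quotient exp(-x^{-q})/x² is y^{2/q}e^{-y}, and y → ∞.
  · have h1 := tendsto_rpow_mul_exp_neg_mul_atTop_nhds_zero (2 / q) 1 one_pos
    have h2 : Tendsto (fun x : ℝ => x⁻¹ ^ q) (𝓝[>] 0) atTop :=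
      (tendsto_rpow_atTop hq).comp tendsto_inv_nhdsGT_zero
    refine (h1.comp h2).congr' ?_
    filter_upwards [self_mem_nhdsWithin] with x hx
    have hx0 : 0 < x := hx
    have e : x ^ (-q) = x⁻¹ ^ q := by rw [Real.rpow_neg hx0.le, Real.inv_rpow hx0.le]
    rw [Function.comp_apply, expInv_of_pos hx0, ← Real.rpow_mul (by positivity),
      mul_div_cancel₀ _ hq.ne', e, Real.rpow_two, neg_one_mul, inv_pow, div_eq_inv_mul]

/-- The substitution s ↦ 1/s turns this into ∫₀^∞ exp(-x^q) dx. -/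
theorem integral_expInv {q : ℝ} (hq : 0 < q) :
    ∫ s in Ioi (0 : ℝ), expInv q s / s ^ 2 = Real.Gamma (1 + 1 / q) := by
  rw [add_comm, ← integral_exp_neg_rpow hq,
    ← integral_comp_rpow_Ioi (fun x : ℝ => Real.exp (-x ^ q)) (p := -1) (by norm_num)]
  refine setIntegral_congr_fun measurableSet_Ioi fun s hs => ?_
  have hs0 : 0 < s := hs
  have e1 : s ^ (-1 - 1 : ℝ) = (s ^ 2)⁻¹ := by
    rw [show (-1 - 1 : ℝ) = -(2 : ℝ) by norm_num, Real.rpow_neg hs0.le, Real.rpow_two]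
  simp only [e1, smul_eq_mul, abs_neg, abs_one, one_mul]
  rw [expInv_of_pos hs0, ← Real.rpow_mul hs0.le, neg_one_mul, div_eq_inv_mul]

/-! ### Cesàro means of finite combinations -/

theorem cesaro_sum {ω : LInfty →ₗ[ℝ] ℝ} {ι : Type*} (s : Finset ι) {c : ι → ℂ} {u : ι → ℝ → ℝ}
    {z : ℝ → ℂ} (hu : ∀ i ∈ s, LocallyIntegrable (u i) volume)
    (hm : ∀ i ∈ s, MemLInfty (realCesaro (u i)))
    (hz : ∀ t, 0 < t → z t = ∑ i ∈ s, c i * (u i t : ℂ)) :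
    CesaroBounded z ∧ evalCesaro ω z = ∑ i ∈ s, c i * (evalAt ω (realCesaro (u i)) : ℂ) := by
  have hces : ∀ T : ℝ, 0 < T → cesaro z T = ∑ i ∈ s, c i * (realCesaro (u i) T : ℂ) := by
    intro T hT
    have hpos : ∀ x ∈ uIcc 1 T, 0 < x := fun x hx => lt_of_lt_of_le (lt_min one_pos hT) hx.1
    have h1 : ∫ x in (1 : ℝ)..T, z x / (x : ℂ)
        = ∫ x in (1 : ℝ)..T, ∑ i ∈ s, c i * ((u i x / x : ℝ) : ℂ) := by
      refine intervalIntegral.integral_congr fun x hx => ?_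
      simp only [hz x (hpos x hx), Finset.sum_div, Complex.ofReal_div, mul_div_assoc]
    have hi : ∀ i ∈ s, IntervalIntegrable (fun x => u i x / x) volume 1 T := by
      intro i hi
      simp only [div_eq_mul_inv]
      refine IntervalIntegrable.mul_continuousOn (IntegrableOn.intervalIntegrable
        ((hu i hi).integrableOn_isCompact isCompact_uIcc)) ?_
      exact continuousOn_inv₀.mono fun x hx => (hpos x hx).ne'
    have h2 : ∀ i ∈ s, IntervalIntegrable (fun x => c i * ((u i x / x : ℝ) : ℂ)) volume 1 T :=
      fun i hi' => IntervalIntegrable.const_mul ⟨(hi i hi').1.ofReal, (hi i hi').2.ofReal⟩ _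
    rw [cesaro, h1, intervalIntegral.integral_finsetSum h2, Finset.mul_sum]
    refine Finset.sum_congr rfl fun i _ => ?_
    rw [intervalIntegral.integral_const_mul, intervalIntegral.integral_ofReal, realCesaro]
    push_cast
    ring
  have hre : ∀ T : ℝ, 0 < T → (cesaro z T).re = ∑ i ∈ s, (c i).re * realCesaro (u i) T := by
    intro T hT
    rw [hces T hT, Complex.re_sum]
    exact Finset.sum_congr rfl fun i _ => Complex.re_mul_ofReal _ _
  have him : ∀ T : ℝ, 0 < T → (cesaro z T).im = ∑ i ∈ s, (c i).im * realCesaro (u i) T := by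
    intro T hT
    rw [hces T hT, Complex.im_sum]
    exact Finset.sum_congr rfl fun i _ => Complex.im_mul_ofReal _ _
  have hm1 : ∀ i ∈ s, MemLInfty fun T => (c i).re * realCesaro (u i) T :=
    fun i hi => (hm i hi).const_mul _
  have hm2 : ∀ i ∈ s, MemLInfty fun T => (c i).im * realCesaro (u i) T :=
    fun i hi => (hm i hi).const_mul _
  refine ⟨⟨?_, (MemLInfty.sum s hm1).congr hre, (MemLInfty.sum s hm2).congr him⟩, ?_⟩
  · have hw : LocallyIntegrable (fun t => ∑ i ∈ s, c i * (u i t : ℂ)) volume := by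
      refine locallyIntegrable_finsetSum s fun i hi => ?_
      intro x
      obtain ⟨U, hU, hiU⟩ := hu i hi x
      exact ⟨U, hU, (Integrable.ofReal hiU).const_mul _⟩
    refine (hw.locallyIntegrableOn (Ioi 0)).congr ?_
    exact (ae_restrict_iff' measurableSet_Ioi).2 (Eventually.of_forall fun t ht => (hz t ht).symm)
  · rw [evalCesaro, evalComplex, evalAt_congr hre, evalAt_congr him, evalAt_sum s hm1,
      evalAt_sum s hm2]
    push_cast
    rw [Finset.mul_sum, ← Finset.sum_add_distrib]
    refine Finset.sum_congr rfl fun i hi => ?_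
    rw [evalAt_const_mul (hm i hi), evalAt_const_mul (hm i hi)]
    conv_rhs => rw [← Complex.re_add_im (c i)]
    push_cast
    ring

/-! ### The heat functional of a positive operator -/

namespace FNSTrace

variable {N : VonNeumannAlgebra H} {τ : FNSTrace N} {P B C : H →L[ℂ] H}
  {ω : LInfty →ₗ[ℝ] ℝ} {m : Measure ℝ}

theorem Represents.hasValue_of_nonneg (hP : τ.LogBounded P) (hC : C ∈ N)
    (hm : τ.Represents P C m) {κ : ℝ → ℝ} (hκ : Continuous κ) (h0 : ∀ x, 0 ≤ κ x) {D : ℝ}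
    (hD : ∀ x, κ x ≤ D) :
    τ.finiteFunctional.HasValue (star C * cfc (fun x => x ^ 2 * κ x) P * C)
      ((∫ x, κ x ∂m : ℝ) : ℂ) := by
  have := hm.finite
  have ht := hm.trace_eq κ hκ.continuousOn fun x _ => h0 x
  have hfin : ∫⁻ x, ENNReal.ofReal (κ x) ∂m < ∞ :=
    (lintegral_mono fun x => ENNReal.ofReal_le_ofReal (hD x)).trans_lt
      (by rw [lintegral_const]; exact ENNReal.mul_lt_top ENNReal.ofReal_lt_top (measure_lt_top _ _))
  have hmem : star C * cfc (fun x => x ^ 2 * κ x) P * C ∈ τ.finiteFunctional.cone :=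
    ⟨mul_mem (mul_mem (star_mem hC) (cfc_mem hP.mem _)) hC,
      conj_nonneg' (cfc_nonneg fun x _ => mul_nonneg (sq_nonneg x) (h0 x)) C, by rwa [ht]⟩
  have h := ConeFunctional.hasValue_of_mem hmem
  rw [integral_eq_lintegral_of_nonneg_ae (Eventually.of_forall h0) hκ.aestronglyMeasurable, ← ht]
  exact h

/-- Signed κ are split into positive and negative parts, to which the trace formula applies. -/
theorem Represents.hasValue (hP : τ.LogBounded P) (hC : C ∈ N) (hm : τ.Represents P C m)
    {κ : ℝ → ℝ} (hκ : Continuous κ) {D : ℝ} (hD : ∀ x, |κ x| ≤ D) :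
    τ.finiteFunctional.HasValue (star C * cfc (fun x => x ^ 2 * κ x) P * C)
      ((∫ x, κ x ∂m : ℝ) : ℂ) := by
  have := hm.finite
  have hD0 : 0 ≤ D := (abs_nonneg _).trans (hD 0)
  have hp : Continuous fun x => max (κ x) 0 := by fun_prop
  have hn : Continuous fun x => max (-κ x) 0 := by fun_prop
  have hpD : ∀ x, max (κ x) 0 ≤ D := fun x => max_le ((le_abs_self _).trans (hD x)) hD0
  have hnD : ∀ x, max (-κ x) 0 ≤ D := fun x => max_le ((neg_le_abs _).trans (hD x)) hD0
  have hsplit : ∀ x, κ x = max (κ x) 0 - max (-κ x) 0 := fun x => by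
    rcases le_total 0 (κ x) with h | h
    · rw [max_eq_left h, max_eq_right (by linarith), sub_zero]
    · rw [max_eq_right h, max_eq_left (by linarith)]; ring
  have hintegr : ∀ {g : ℝ → ℝ}, Continuous g → (∀ x, 0 ≤ g x) → (∀ x, g x ≤ D) → Integrable g m :=
    fun hg hg0 hgD => Integrable.of_bound hg.aestronglyMeasurable D
      (Eventually.of_forall fun x => by rw [Real.norm_eq_abs, abs_of_nonneg (hg0 x)]; exact hgD x)
  have h1 := hm.hasValue_of_nonneg hP hC hp (fun x => le_max_right _ _) hpD
  have h2 := hm.hasValue_of_nonneg hP hC hn (fun x => le_max_right _ _) hnD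
  have h3 := h1.sub h2
  rw [← Complex.ofReal_sub, ← integral_sub (hintegr hp (fun x => le_max_right _ _) hpD)
    (hintegr hn (fun x => le_max_right _ _) hnD), ← sub_mul, ← mul_sub,
    ← cfc_sub (fun x => x ^ 2 * max (κ x) 0) (fun x => x ^ 2 * max (-κ x) 0) P
      (by fun_prop) (by fun_prop)] at h3
  simp only [← mul_sub, ← hsplit] at h3
  exact h3

theorem cfc_smul_eq {f k : ℝ → ℝ} {D : ℝ} (hf : IsProfile f k D) (hP : 0 ≤ P) {t : ℝ}
    (ht : 0 < t) : cfc f (t • P) = cfc (fun x => x ^ 2 * (t ^ 2 * k (t * x))) P := by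
  have hPs := isSelfAdjoint_of_nonneg hP
  have hsp : ∀ x ∈ spectrum ℝ P, 0 ≤ t * x := fun x hx =>
    mul_nonneg ht.le (spectrum_nonneg_of_nonneg hP hx)
  rw [← cfc_comp_const_mul t f P (hf.continuousOn.mono (by rintro _ ⟨x, hx, rfl⟩; exact hsp x hx))]
  refine cfc_congr fun x hx => ?_
  simp only [hf.eq _ (hsp x hx)]
  ring

/-- Second-order vanishing of f gives f(tP) = PRP with R bounded, so f(tP)B = (PR)*(PB) is a product
of two Hilbert–Schmidt operators. -/
theorem LogBounded.isTraceClass_cfc_mul (hP : τ.LogBounded P) (hB : B ∈ N) {f k : ℝ → ℝ} {D : ℝ}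
    (hf : IsProfile f k D) {t : ℝ} (ht : 0 < t) : τ.IsTraceClass (cfc f (t • P) * B) := by
  refine ⟨mul_mem (cfc_mem (rsmul_mem t hP.mem) f) hB, ?_⟩
  have hκ : Continuous fun x => t ^ 2 * k (t * x) :=
    continuous_const.mul (hf.continuous.comp (continuous_const.mul continuous_id))
  set R := cfc (fun x => t ^ 2 * k (t * x)) P with hR
  have hRN : R ∈ N := cfc_mem hP.mem _
  have hRs : star R = R := (cfc_predicate (p := IsSelfAdjoint) _ P).star_eq
  have hcomm : R * P = P * R := ((Commute.refl P).cfc_real _).eq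
  have e : cfc f (t • P) * B = star (P * R) * (P * B) := by
    rw [cfc_smul_eq hf hP.nonneg ht, ← mul_cfc_mul hP.nonneg hκ.continuousOn, star_mul, hRs,
      hP.isSelfAdjoint.star_eq, hcomm]
    simp only [mul_assoc, hR]
  rw [e]
  exact τ.abs_star_mul_lt_top (mul_mem hP.mem hRN) (mul_mem hP.mem hB) (hP.mul_sq_lt_top hRN)
    (hP.mul_sq_lt_top hB)

theorem LogBounded.heat_eq (hP : τ.LogBounded P) (hB : B ∈ N) {f k : ℝ → ℝ} {D : ℝ}
    (hf : IsProfile f k D) {m : ℕ → Measure ℝ} (hm : ∀ j, τ.Represents P (polar B j) (m j)) {t : ℝ}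
    (ht : 0 < t) : τ.heat f B P t
      = ∑ j ∈ Finset.range 4, (4⁻¹ * Complex.I ^ j) * (dilInt (m j) k t : ℂ) := by
  obtain ⟨hD0, -, hD⟩ := bound_of_square hf.bound
  have hκ : Continuous fun x => t ^ 2 * k (t * x) :=
    continuous_const.mul (hf.continuous.comp (continuous_const.mul continuous_id))
  have hκb : ∀ x, |t ^ 2 * k (t * x)| ≤ t ^ 2 * D := fun x => by
    rw [abs_mul, abs_of_nonneg (sq_nonneg t)]
    exact mul_le_mul_of_nonneg_left (hD _) (sq_nonneg t)
  have hval : τ.finiteFunctional.HasValue (cfc f (t • P) * B) (4⁻¹ * ∑ j ∈ Finset.range 4,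
      Complex.I ^ j * ((∫ x, t ^ 2 * k (t * x) ∂(m j) : ℝ) : ℂ)) := by
    rw [mul_eq_sum_polar, cfc_smul_eq hf hP.nonneg ht]
    exact (ConeFunctional.HasValue.sum (by simp) fun j _ =>
      ((hm j).hasValue hP (polar_mem hB j) hκ hκb).smul _).smul _
  have htr : τ.tr (cfc f (t • P) * B) = _ := hval.jordanExtend_eq
  have ht' : (t : ℂ) ≠ 0 := Complex.ofReal_ne_zero.2 ht.ne'
  rw [heat, htr, Finset.mul_sum, Finset.mul_sum]
  refine Finset.sum_congr rfl fun j _ => ?_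
  have e : ∫ x, t ^ 2 * k (t * x) ∂(m j) = t * dilInt (m j) k t := by
    rw [dilInt, ← integral_const_mul]
    exact integral_congr_ae (Eventually.of_forall fun x => by simp only; ring)
  rw [e]
  push_cast
  field_simp

theorem LogBounded.heat_theorem (hω : IsGeneralisedLimit ω) (hωd : IsDilationInvariant ω)
    (hP : τ.LogBounded P) (hB : B ∈ N) {f k : ℝ → ℝ} {D : ℝ} (hf : IsProfile f k D) :
    τ.HeatAdmissible f B P ∧ evalCesaro ω (τ.heat f B P)
      = ((∫ s in Ioi (0 : ℝ), f s / s ^ 2 : ℝ) : ℂ) * τ.dixmierMul ω P B := by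
  choose m hm using fun j => hP.exists_represents (polar_mem hB j)
  have hfin := fun j => (hm j).finite
  have hces := fun j => evalAt_realCesaro_dilInt hω hωd (hm j).logMeasure hf.continuous hf.bound
  obtain ⟨h1, h2⟩ := cesaro_sum (ω := ω) (Finset.range 4)
    (fun j _ => locallyIntegrable_dilInt (m := m j) hf.continuous (bound_of_square hf.bound).2.2)
    (fun j _ => (hces j).1) fun t ht => hP.heat_eq hB hf hm ht
  refine ⟨⟨hP.mem_dixmierIdeal, fun t ht => hP.isTraceClass_cfc_mul hB hf ht, h1⟩, ?_⟩
  rw [h2, hf.integral.2, dixmierMul, Finset.mul_sum, Finset.mul_sum]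
  refine Finset.sum_congr rfl fun j _ => ?_
  have e : τ.dixmier ω P (polar B j) = logLim ω (dilInt (m j) refProfile) :=
    logLim_congr fun T hT => (hm j).thrTrace_eq hP hT
  rw [(hces j).2, e]
  push_cast
  ring

/-- Reduction of `ξ_{ω,B,f}` to the Dixmier functional. -/
theorem xiGen_eq (hω : IsGeneralisedLimit ω) (hωd : IsDilationInvariant ω) {A : H →L[ℂ] H}
    (hA : A ∈ τ.dixmierIdeal) (hB : B ∈ N) {f k : ℝ → ℝ} {D : ℝ} (hf : IsProfile f k D) :
    τ.xiGen ω B f A = ((∫ s in Ioi (0 : ℝ), f s / s ^ 2 : ℝ) : ℂ) *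
      jordanExtend (fun P => (τ.dixmier ω P 1 : ℂ)) (A * B) := by
  have key : ∀ {P}, P ∈ jordanParts A → evalCesaro ω (τ.heat f B P) = _ := fun hP =>
    ((logBounded_of_mem_jordanParts hA hP).heat_theorem hω hωd hB hf).2
  rw [jordanExtend_dixmier_mul hω hωd hA hB, xiGen, jordanExtend, jordanExtend,
    key (by simp [jordanParts]), key (by simp [jordanParts]), key (by simp [jordanParts]),
    key (by simp [jordanParts])]
  ring

end FNSTrace

end NCHeat

end

/-! ### Comparison of the two heat functionals -/

theorem mainTheorem1 {H : Type*} [NormedAddCommGroup H] [InnerProductSpace ℂ H] [CompleteSpace H]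
    (N : VonNeumannAlgebra H) (τ : FNSTrace N) (q : ℝ) (hq : 0 < q)
    (f : ℝ → ℝ) (hf : ContDiffOn ℝ 2 f (Set.Ici 0)) (hfb : ∃ C : ℝ, ∀ s : ℝ, 0 ≤ s → |f s| ≤ C)
    (hf0 : f 0 = 0) (hf0' : derivWithin f (Set.Ici 0) 0 = 0)
    (A : H →L[ℂ] H) (hA : A ∈ τ.dixmierIdeal) (B : H →L[ℂ] H) (hB : B ∈ N)
    (ω : LInfty →ₗ[ℝ] ℝ) (hω : IsGeneralisedLimit ω) (hωd : IsDilationInvariant ω) :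
    -- all the expressions in the formula are well defined
    MeasureTheory.IntegrableOn (fun s : ℝ => f s / s ^ 2) (Set.Ioi 0) ∧
    A * B ∈ τ.dixmierIdeal ∧
    (∀ P ∈ jordanParts A, τ.HeatAdmissible f B P) ∧
    (∀ P ∈ jordanParts (A * B), τ.HeatAdmissible (expInv q) 1 P) ∧
    -- the reduction formula
    τ.xiGen ω B f A =
      (((Real.Gamma (1 + 1 / q))⁻¹ * ∫ s in Set.Ioi (0 : ℝ), f s / s ^ 2 : ℝ) : ℂ) *
        τ.xi q ω (A * B) := by
  obtain ⟨a, ha⟩ := tendsto_div_sq_of_contDiffOn hf hf0 hf0'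
  obtain ⟨k, C, hk⟩ := exists_isProfile (hf.continuousOn.mono Set.Ioi_subset_Ici_self) hfb hf0 ha
  obtain ⟨l, D, hl⟩ := exists_isProfile_expInv hq
  have hAB := FNSTrace.mul_mem_dixmierIdeal hA hB
  refine ⟨hk.integral.1, hAB,
    fun P hP => ((FNSTrace.logBounded_of_mem_jordanParts hA hP).heat_theorem hω hωd hB hk).1,
    fun P hP => ((FNSTrace.logBounded_of_mem_jordanParts hAB hP).heat_theorem hω hωd
      (one_mem N) hl).1, ?_⟩
  have hΓ : (Real.Gamma (1 + 1 / q) : ℂ) ≠ 0 :=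
    Complex.ofReal_ne_zero.2 (Real.Gamma_pos_of_pos (by positivity)).ne'
  -- Both sides are multiples of the Dixmier functional at AB; the one on the right carries the
  -- factor Γ(1 + 1/q), which is nonzero and cancels.
  rw [FNSTrace.xi, FNSTrace.xiGen_eq hω hωd hA hB hk,
    FNSTrace.xiGen_eq hω hωd hAB (one_mem N) hl, mul_one, integral_expInv hq]
  rw [Complex.ofReal_mul, Complex.ofReal_inv]
  generalize (Real.Gamma (1 + 1 / q) : ℂ) = g at hΓ ⊢
  field_simp
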